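/- Let $(Y,d)$ be a bounded metric space with its Borel $\sigma$-algebra, $\nu$ a finite Borel measure on $Y$, and $f\colon Y\to Y$ a measurable map that is nonsingular ($\nu(A)=0\Rightarrow\nu(f^{-1}A)=0$) and ergodic with respect to $\nu$. Let $Z\subset Y$ be a Borel set with $\nu(Z)>0$, let $\mathcal P$ be an at most countable measurable partition of $Z$ (up to a $\nu$-null set) with $\nu(a)>0$ for all $a\in\mathcal P$, let $\tau\colon Z\to\{1,2,\dots\}$ be measurable and constant on each $a\in\mathcal P$ with value $\tau(a)$, such that $f^{\tau(a)}z\in Z$ for all $z\in a$, $a\in\mathcal P$, and let $F\colon Z\to Z$, $Fz=f^{\tau(z)}z$, be the induced map (the formula being required on the elements of $\mathcal P$, hence almost everywhere on $Z$). Assume that $f$ is nonuniformly expanding, that is: (i) $F$ is Gibbs--Markov: $F$ is measurable, nonsingular and ergodic with respect to $\nu|_Z$, and there are $\lambda>1$, $K>0$, $\theta\in(0,1]$ such that for all $a\in\mathcal P$ and $z,z'\in a$: up to null sets $Fa$ is a union of elements of $\mathcal P$; $F$ restricts to a measure-theoretic bijection $a\to Fa$; $\inf_{a\in\mathcal P}\nu(Fa)>0$;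 $d(Fz,Fz')\ge\lambda d(z,z')$; and the inverse Jacobian $\zeta_a=\frac{d\nu}{d\nu\circ F}$ of $F\colon a\to Fa$ is positive and satisfies $|\log\zeta_a(z)-\log\zeta_a(z')|\le K d(Fz,Fz')^\theta$; (ii) there is $C>0$ such that $d(f^kz,f^kz')\le C\,d(Fz,Fz')$ for all $0\le k\le\tau(a)$, $z,z'\in a$, $a\in\mathcal P$. Let $\mu_Z$ be the unique $F$-invariant probability measure on $Z$ that is absolutely continuous with respect to $\nu$. Assume that $\mu_Z$ is mixing and that $\bar\tau=\int_Z\tau\,d\mu_Z<\infty$. Let $\mu=\pi_*\mu_\Delta$, where $\Delta=\{(z,\ell):z\in Z,\ 0\le\ell<\tau(z)\}$, $\mu_\Delta=(\mu_Z\times\text{counting})/\bar\tau$ and $\pi(z,\ell)=f^\ell z$. Let $v\colon Y\to\mathbb R^d$ be H\"older continuous with $\int_Y v\,d\mu=0$, let $(b_n)_{n\ge1}$ be a sequence of positive numbers, and define $$W_n(t)=b_n^{-1}\sum_{j=0}^{\lfloor nt\rfloor-1}v\circ f^j,\qquad t\in[0,1].$$ Suppose that $\tau$ is regularly varying with index $\alpha\in(1,2)$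 on $(Z,\mu_Z)$, i.e. $\mu_Z(\tau>rt)/\mu_Z(\tau>t)\to r^{-\alpha}$ as $t\to\infty$ for all $r>0$, and that $\lim_{n\to\infty}n\,\mu_Z(\tau>b_n)=1$. Then for every $p>\alpha$ and every probability measure $\mathbb P$ on $Y$ that is absolutely continuous with respect to $\nu$, the family $\{\|W_n\|_{p\text{-var}}\}_{n\ge1}$ is tight on $(Y,\mathbb P)$: for every $\varepsilon>0$ there is $M<\infty$ with $\mathbb P(\|W_n\|_{p\text{-var}}>M)\le\varepsilon$ for all $n\ge1$. Here $$\|u\|_{p\text{-var}}=\sup_{0=t_0<t_1<\dots<t_k=1}\Bigl(\sum_{j=1}^k|u(t_j)-u(t_{j-1})|^p\Bigr)^{1/p}.$$ -/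

import Mathlib

open MeasureTheory Filter Topology Set
open scoped ENNReal NNReal

/-- A measure-preserving system `(F, μ)` is (strongly) mixing:
`μ (A ∩ F^{-n} B) → μ A * μ B` for all measurable `A`, `B`. -/
def IsMixing {X : Type*} [MeasurableSpace X] (F : X → X) (μ : Measure X) : Prop :=
  ∀ A B : Set X, MeasurableSet A → MeasurableSet B →
    Tendsto (fun n : ℕ => μ (A ∩ F^[n] ⁻¹' B)) atTop (𝓝 (μ A * μ B))

/-- `𝒜` is an at most countable measurable partition, up to a `ν`-null set, of the whole space,
all of whose elements have positive `ν`-measure. -/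
structure IsCountablePartition {X : Type*} [MeasurableSpace X] (ν : Measure X)
    (𝒜 : Set (Set X)) : Prop where
  countable : 𝒜.Countable
  measurableSet : ∀ a ∈ 𝒜, MeasurableSet a
  disjoint : 𝒜.PairwiseDisjoint id
  cover : ν (⋃₀ 𝒜)ᶜ = 0
  pos : ∀ a ∈ 𝒜, 0 < ν a

/-- Gibbs-Markov maps `F` of a bounded metric space `X` with reference measure `ν` and partition `𝒜`.
`QuasiErgodic F ν` says that `F` is measurable, nonsingular and ergodic with respect to `ν`.
The uniform expansion on `a` makes `F` injective on `a`; together with `image_meas` (images of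
measurable subsets of `a` are `ν`-measurable) this is the measure-theoretic bijection `a → F a`,
and `E ↦ ν (F '' E)` is the measure `ν ∘ F` on `a`. In `distortion`, `ζ` restricted to `a` is the
inverse Jacobian `ζ_a = dν / d(ν ∘ F)`, i.e. `d(ν ∘ F) / dν = 1 / ζ_a` on `a`. -/
structure IsGibbsMarkov {X : Type*} [MetricSpace X] [MeasurableSpace X] (ν : Measure X)
    (𝒜 : Set (Set X)) (F : X → X) : Prop where
  partition : IsCountablePartition ν 𝒜
  quasiErgodic : QuasiErgodic F ν
  image_union : ∀ a ∈ 𝒜, ∃ ℬ ⊆ 𝒜, F '' a =ᵐ[ν] ⋃₀ ℬ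
  image_meas : ∀ a ∈ 𝒜, ∀ E ⊆ a, MeasurableSet E → NullMeasurableSet (F '' E) ν
  big_images : ∃ c : ℝ≥0∞, 0 < c ∧ ∀ a ∈ 𝒜, c ≤ ν (F '' a)
  expanding : ∃ lam : ℝ, 1 < lam ∧
    ∀ a ∈ 𝒜, ∀ z ∈ a, ∀ z' ∈ a, lam * dist z z' ≤ dist (F z) (F z')
  distortion : ∃ ζ : X → ℝ, ∃ K θ : ℝ, 0 < K ∧ 0 < θ ∧ θ ≤ 1 ∧ ∀ a ∈ 𝒜,
    (∀ z ∈ a, 0 < ζ z) ∧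
    (∀ E ⊆ a, MeasurableSet E → ν (F '' E) = ∫⁻ z in E, ENNReal.ofReal (ζ z)⁻¹ ∂ν) ∧
    (∀ z ∈ a, ∀ z' ∈ a,
      |Real.log (ζ z) - Real.log (ζ z')| ≤ K * dist (F z) (F z') ^ θ)

/-- The restriction of a measure `ν` on `Y` to a subset `Z`, as a measure on the subtype `Z`. -/
noncomputable abbrev subMeasure {Y : Type*} [MeasurableSpace Y] (ν : Measure Y) (Z : Set Y) :
    Measure Z :=
  ν.comap Subtype.val

/-- `f : Y → Y` is nonuniformly expanding, with base `Z`, partition `𝒜` of `Z` (up to a null set),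
return time `τ : Z → {1, 2, …}` constant on partition elements (not necessarily the first return
time), and induced map `F z = f^{τ z} z`. As `𝒜` covers `Z` only up to a null set, the formula
for `F` is required on the partition elements only. -/
structure IsNonuniformlyExpanding {Y : Type*} [MetricSpace Y] [MeasurableSpace Y]
    (ν : Measure Y) (f : Y → Y) (Z : Set Y) (𝒜 : Set (Set Z)) (τ : Z → ℕ) (F : Z → Z) : Prop where
  measurable : Measurable f
  measurableSet_base : MeasurableSet Z
  base_pos : 0 < ν Z
  measurable_tau : Measurable τ
  one_le_tau : ∀ z, 1 ≤ τ z
  tau_const : ∀ a ∈ 𝒜, ∀ z ∈ a, ∀ z' ∈ a, τ z = τ z'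
  induced : ∀ a ∈ 𝒜, ∀ z ∈ a, (F z : Y) = f^[τ z] (z : Y)
  gibbsMarkov : IsGibbsMarkov (subMeasure ν Z) 𝒜 F
  excursion : ∃ C : ℝ, 0 < C ∧ ∀ a ∈ 𝒜, ∀ z ∈ a, ∀ z' ∈ a, ∀ k ≤ τ z,
    dist (f^[k] (z : Y)) (f^[k] (z' : Y)) ≤ C * dist (F z) (F z')

/-- The tower measure `μ_Δ = (μ_Z × counting) / τ̄` on `Δ = {(z, ℓ) : ℓ < τ z} ⊆ Z × ℕ`,
where `τ̄ = ∫ τ dμ_Z`. -/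
noncomputable def towerMeasure {Y : Type*} [MeasurableSpace Y] {Z : Set Y}
    (τ : Z → ℕ) (μZ : Measure Z) : Measure (Z × ℕ) :=
  (∫⁻ z, (τ z : ℝ≥0∞) ∂μZ)⁻¹ •
    (μZ.prod (Measure.count : Measure ℕ)).restrict {q | q.2 < τ q.1}

/-- The `f`-invariant measure `μ = π_* μ_Δ` on `Y`, with `π (z, ℓ) = f^ℓ z`. -/
noncomputable def inducedMeasure {Y : Type*} [MeasurableSpace Y] {Z : Set Y}
    (f : Y → Y) (τ : Z → ℕ) (μZ : Measure Z) : Measure Y :=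
  (towerMeasure τ μZ).map (fun q => f^[q.2] (q.1 : Y))

/-- An `E`-valued random variable `ξ` on `(Ω, P)` is regularly varying with index `α`:
for some probability measure `σ` on the unit sphere,
`P (|ξ| > r t, ξ / |ξ| ∈ B) / P (|ξ| > t) → r ^ (-α) * σ B` as `t → ∞`,
for all `r > 0` and all Borel subsets `B` of the sphere with `σ (∂B) = 0`. -/
def IsRegularlyVarying {Ω E : Type*} [MeasurableSpace Ω] [NormedAddCommGroup E] [NormedSpace ℝ E]
    [MeasurableSpace E] (P : Measure Ω) (ξ : Ω → E) (α : ℝ) : Prop :=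
  ∃ σ : Measure (Metric.sphere (0 : E) 1), IsProbabilityMeasure σ ∧
    ∀ r : ℝ, 0 < r → ∀ B : Set (Metric.sphere (0 : E) 1), MeasurableSet B → σ (frontier B) = 0 →
      Tendsto
        (fun t : ℝ => P.real {ω | r * t < ‖ξ ω‖ ∧ ‖ξ ω‖⁻¹ • ξ ω ∈ Subtype.val '' B}
          / P.real {ω | t < ‖ξ ω‖})
        atTop (𝓝 (r ^ (-α) * σ.real B))

/-- The `p`-variation on `[0, 1]`: the supremum, over all `0 = t_0 < t_1 < ⋯ < t_k = 1`, of
`(∑_j |u (t_{j+1}) - u (t_j)| ^ p) ^ (1 / p)`. -/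
noncomputable def pVariation {E : Type*} [PseudoEMetricSpace E] (p : ℝ) (u : ℝ → E) : ℝ≥0∞ :=
  ⨆ (k : ℕ) (t : ℕ → ℝ) (_ : t 0 = 0 ∧ t k = 1 ∧ ∀ j < k, t j < t (j + 1)),
    (∑ j ∈ Finset.range k, edist (u (t (j + 1))) (u (t j)) ^ p) ^ (1 / p)

/-- The process `W_n(t) = b_n⁻¹ ∑_{j < ⌊n t⌋} v ∘ f^j`, as a function of the initial point `y`
and of the time `t`. -/
noncomputable def birkhoffProcess {Y E : Type*} [AddCommGroup E] [Module ℝ E]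
    (f : Y → Y) (v : Y → E) (b : ℕ → ℝ) (n : ℕ) (y : Y) (t : ℝ) : E :=
  (b n)⁻¹ • ∑ j ∈ Finset.range ⌊(n : ℝ) * t⌋₊, v (f^[j] y)

/-- Tightness on `(Ω, P)` of a sequence `(X_n)_{n ≥ 1}` of random variables with values in
`[0, ∞]`: for every `ε > 0` there is a finite `M` with `P (X_n > M) ≤ ε` for all `n ≥ 1`. -/
def IsTightSeq {Ω : Type*} [MeasurableSpace Ω] (P : Measure Ω) (X : ℕ → Ω → ℝ≥0∞) : Prop :=
  ∀ ε : ℝ≥0∞, 0 < ε → ∃ M : ℝ≥0, ∀ n : ℕ, 1 ≤ n → P {ω | (M : ℝ≥0∞) < X n ω} ≤ ε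

/-!
# Tightness of the `p`-variation of Birkhoff sums in the stable domain

On the base `Z` the orbit of `z` splits into excursions of lengths `τ z, τ (F z), …`. Sampled at the
ends of excursions, the Birkhoff sums of `v` are the Birkhoff sums under `F` of the unbounded
observable `V z = ∑_{l < τ z} v (f^l z)`, and what is lost by sampling is at most of the order
`(∑_{k < n} τ (F^k z)^p)^{1/p}` (`discreteVar_le_sampled`). At the scale `b n` this loss is tight
because `τ` is regularly varying with index `α < p` (`isTightSeq_sum_rpow`).

For the Birkhoff sums of `V`, fix `q` with `α < q < min p 2` and truncate `V` to `{τ ≤ b n}`. By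
Karamata-type estimates the part of `V` above the truncation level contributes to the first moment
of the total variation a quantity of order `b n`, and so does the drift made by centring. The centred
truncated variables have `q`-th moments of order `(b n)^q / n` (`exists_truncated_moment_bounds`). Their
Birkhoff sums are compared with the martingale `m ↦ μ[S_n | ℱ_m]`, where `ℱ_m` is generated by the
first `m` symbols of the itinerary (`exists_martingale_approximation`). The difference has two sources.
Past terms are nearly `ℱ_m`-measurable, as `F` expands and `V` oscillates on partition
elements by at most a multiple of `τ z * dist (F z) (F z')^η`. Future terms have small conditional
expectation, as conditioning on a cylinder and iterating `F` yields a measure with log-Hölder density,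
and all such measures agree after `k` steps up to an exponentially small mass
(`exists_common_part`). The latter is a coupling argument: regular densities satisfy a uniform Doeblin
condition, for which bounded distortion, big images and mixing suffice. Thus the error is of order
`(b n) n^{-1/q}` in `L^q`, uniformly in `m ≤ n`, and the same holds for the martingale increments.

The `p`-variation of a martingale whose increments have `q`-th moments with bounded sum, `q < p`, is
tight (`isTightSeq_discreteVar_martingale`). A greedy detection of moves of size `lam` stops the
martingale at its successive large moves; an inequality of von Bahr–Esseen type bounds the expected
number of these moves by a multiple of `lam^{-q}` (`integral_greedy_count_le`), and the sum of
`lam^p * lam^{-q}` over dyadic `lam` converges.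

Finally, let `P ≪ ν`. Ergodicity of `f` makes `P`-almost every orbit enter the set where `μZ` has positive
density with respect to `ν`. At the time of entrance, which is finite and does not depend on `n`, the law
of the orbit point is absolutely continuous with respect to `μZ` (`exists_entranceTime`). Tightness is inherited
by absolutely continuous measures, and the piece of the orbit before the entrance
adds at most a multiple of the entrance time.
-/


/-! ### Variation of discrete paths -/

/-- The supremum of `∑ ω (t_j) (t_{j+1})` over all chains `t_0 ≤ t_1 ≤ ⋯ ≤ t_k ≤ n` of integers.
Repetitions are allowed, so that images of chains under monotone time changes are chains. -/
noncomputable def chainSup (n : ℕ) (ω : ℕ → ℕ → ℝ≥0∞) : ℝ≥0∞ :=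
  ⨆ (k : ℕ) (t : ℕ → ℕ) (_ : Monotone t ∧ t k ≤ n), ∑ j ∈ Finset.range k, ω (t j) (t (j + 1))

/-- The `p`-th power of the `p`-variation of the discrete path `x 0, …, x n`. -/
noncomputable def discreteVar {E : Type*} [PseudoEMetricSpace E] (p : ℝ) (n : ℕ) (x : ℕ → E) :
    ℝ≥0∞ :=
  chainSup n fun s t => edist (x t) (x s) ^ p

lemma le_chainSup {n : ℕ} (ω : ℕ → ℕ → ℝ≥0∞) {k : ℕ} {t : ℕ → ℕ} (ht : Monotone t)
    (hk : t k ≤ n) : ∑ j ∈ Finset.range k, ω (t j) (t (j + 1)) ≤ chainSup n ω :=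
  le_iSup_of_le k (le_iSup_of_le t (le_iSup_of_le ⟨ht, hk⟩ le_rfl))

lemma chainSup_le {n : ℕ} {ω : ℕ → ℕ → ℝ≥0∞} {c : ℝ≥0∞}
    (h : ∀ (k : ℕ) (t : ℕ → ℕ), Monotone t → t k ≤ n →
      ∑ j ∈ Finset.range k, ω (t j) (t (j + 1)) ≤ c) : chainSup n ω ≤ c :=
  iSup_le fun k => iSup_le fun t => iSup_le fun ht => h k t ht.1 ht.2

lemma chainSup_mono {n : ℕ} {ω ω' : ℕ → ℕ → ℝ≥0∞} (h : ∀ s t, s ≤ t → t ≤ n → ω s t ≤ ω' s t) :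
    chainSup n ω ≤ chainSup n ω' :=
  chainSup_le fun _ _ ht hk => (Finset.sum_le_sum fun j hj => h _ _ (ht j.le_succ)
    ((ht (Finset.mem_range.1 hj)).trans hk)).trans (le_chainSup ω' ht hk)

lemma chainSup_add_le (n : ℕ) (ω ω' : ℕ → ℕ → ℝ≥0∞) :
    chainSup n (fun s t => ω s t + ω' s t) ≤ chainSup n ω + chainSup n ω' :=
  chainSup_le fun _ _ ht hk => by
    rw [Finset.sum_add_distrib]
    exact add_le_add (le_chainSup ω ht hk) (le_chainSup ω' ht hk)

lemma chainSup_const_mul_le (n : ℕ) (c : ℝ≥0∞) (ω : ℕ → ℕ → ℝ≥0∞) :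
    chainSup n (fun s t => c * ω s t) ≤ c * chainSup n ω :=
  chainSup_le fun _ _ ht hk => by
    rw [← Finset.mul_sum]
    exact mul_le_mul_right (le_chainSup ω ht hk) c

lemma chainSup_comp_le {n m : ℕ} {κ : ℕ → ℕ} (hκ : Monotone κ) (hn : κ n ≤ m)
    (ω : ℕ → ℕ → ℝ≥0∞) : chainSup n (fun s t => ω (κ s) (κ t)) ≤ chainSup m ω :=
  chainSup_le fun _ t ht hk => le_chainSup ω (t := κ ∘ t) (hκ.comp ht) ((hκ hk).trans hn)

lemma sum_sum_Ico_chain (w : ℕ → ℝ≥0∞) {t : ℕ → ℕ} (ht : Monotone t) (k : ℕ) :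
    ∑ j ∈ Finset.range k, ∑ m ∈ Finset.Ico (t j) (t (j + 1)), w m =
      ∑ m ∈ Finset.Ico (t 0) (t k), w m := by
  induction k with
  | zero => simp
  | succ k ih =>
    rw [Finset.sum_range_succ, ih, Finset.sum_Ico_consecutive _ (ht k.zero_le) (ht k.le_succ)]

lemma sum_Ico_le_sum_range (w : ℕ → ℝ≥0∞) {s t n : ℕ} (h : t ≤ n) :
    ∑ m ∈ Finset.Ico s t, w m ≤ ∑ m ∈ Finset.range n, w m :=
  Finset.sum_le_sum_of_subset fun m hm => by
    simp only [Finset.mem_Ico, Finset.mem_range] at hm ⊢; omega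

lemma chainSup_sum_le (n : ℕ) (w : ℕ → ℝ≥0∞) :
    chainSup n (fun s t => ∑ m ∈ Finset.Ico s t, w m) ≤ ∑ m ∈ Finset.range n, w m :=
  chainSup_le fun k t ht hk => by
    rw [sum_sum_Ico_chain w ht]; exact sum_Ico_le_sum_range w hk

lemma sum_rpow_le_rpow_sum_of_one_le {ι : Type*} (s : Finset ι) (a : ι → ℝ≥0∞) {p : ℝ}
    (hp : 1 ≤ p) : ∑ i ∈ s, a i ^ p ≤ (∑ i ∈ s, a i) ^ p := by
  classical
  induction s using Finset.induction_on with
  | empty => simp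
  | insert i s hi ih =>
    rw [Finset.sum_insert hi, Finset.sum_insert hi]
    exact (add_le_add le_rfl ih).trans (ENNReal.add_rpow_le_rpow_add _ _ hp)

lemma chainSup_sum_rpow_le (n : ℕ) (w : ℕ → ℝ≥0∞) {p : ℝ} (hp : 1 ≤ p) :
    chainSup n (fun s t => (∑ m ∈ Finset.Ico s t, w m) ^ p) ≤
      (∑ m ∈ Finset.range n, w m) ^ p :=
  chainSup_le fun k t ht hk => by
    refine (sum_rpow_le_rpow_sum_of_one_le _ _ hp).trans ?_
    rw [sum_sum_Ico_chain w ht]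
    exact ENNReal.rpow_le_rpow (sum_Ico_le_sum_range w hk) (by linarith)

/-- A partition of `[0, 1]` induces a chain of indices `⌊n * t_j⌋ ≤ n`. -/
lemma pVariation_le_discreteVar {E : Type*} [PseudoEMetricSpace E] {p : ℝ} (hp : 0 < p) (n : ℕ)
    (x : ℕ → E) :
    pVariation p (fun t => x ⌊(n : ℝ) * t⌋₊) ≤ discreteVar p n x ^ (1 / p) := by
  refine iSup_le fun k => iSup_le fun t => iSup_le fun ⟨_, h1, hlt⟩ => ?_
  refine ENNReal.rpow_le_rpow ?_ (by positivity)
  have hmono : ∀ i j, i ≤ j → j ≤ k → t i ≤ t j := by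
    intro i j hij
    induction j, hij using Nat.le_induction with
    | base => exact fun _ => le_rfl
    | succ j _ ih => exact fun hj => (ih (by omega)).trans (hlt j (by omega)).le
  have ht : Monotone fun j => ⌊(n : ℝ) * t (min j k)⌋₊ := fun i j hij =>
    Nat.floor_le_floor (mul_le_mul_of_nonneg_left
      (hmono _ _ (min_le_min_right k hij) (min_le_right _ _)) n.cast_nonneg)
  refine le_trans (le_of_eq ?_) (le_chainSup (fun s t => edist (x t) (x s) ^ p) ht (k := k)
    (by simp [h1]))
  refine Finset.sum_congr rfl fun j hj => ?_
  have hj := Finset.mem_range.1 hj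
  simp [min_eq_left hj.le, min_eq_left (Nat.succ_le_of_lt hj)]

lemma discreteVar_add_le {E : Type*} [SeminormedAddCommGroup E] {p : ℝ} (hp : 1 ≤ p) (n : ℕ)
    (x y : ℕ → E) :
    discreteVar p n (fun m => x m + y m) ≤
      2 ^ (p - 1) * (discreteVar p n x + discreteVar p n y) := by
  refine (chainSup_mono (ω' := fun s t => 2 ^ (p - 1) *
    (edist (x t) (x s) ^ p + edist (y t) (y s) ^ p)) fun s t _ _ => ?_).trans
    ((chainSup_const_mul_le _ _ _).trans (mul_le_mul_right (chainSup_add_le _ _ _) _))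
  exact (ENNReal.rpow_le_rpow (edist_add_add_le _ _ _ _) (by linarith)).trans
    (ENNReal.rpow_add_le_mul_rpow_add_rpow _ _ hp)

/-- A path with small values has small variation, whatever its increments. -/
lemma discreteVar_le_sum_enorm {E : Type*} [SeminormedAddCommGroup E] {p : ℝ} (hp : 1 ≤ p) (n : ℕ)
    (x : ℕ → E) :
    discreteVar p n x ≤ 2 ^ p * ∑ m ∈ Finset.range (n + 1), ‖x m‖ₑ ^ p := by
  have hp0 : 0 < p := by linarith
  refine (chainSup_mono (ω' := fun s t => 2 ^ (p - 1) *
    ∑ m ∈ Finset.Ico s t, (‖x m‖ₑ ^ p + ‖x (m + 1)‖ₑ ^ p)) fun s t hst _ => ?_).trans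
    ((chainSup_const_mul_le _ _ _).trans (mul_le_mul_right (chainSup_sum_le _ _) _)|>.trans ?_)
  · rcases hst.eq_or_lt with rfl | hlt
    · simp [hp0]
    · rw [edist_eq_enorm_sub]
      refine (ENNReal.rpow_le_rpow (enorm_sub_le) hp0.le).trans
        ((ENNReal.rpow_add_le_mul_rpow_add_rpow _ _ hp).trans (mul_le_mul_right ?_ _))
      rw [Finset.sum_add_distrib, add_comm]
      refine add_le_add ?_ ?_
      · exact Finset.single_le_sum (f := fun m => ‖x m‖ₑ ^ p) (fun _ _ => zero_le)
          (Finset.mem_Ico.2 ⟨le_rfl, hlt⟩)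
      · have := Finset.single_le_sum (f := fun m => ‖x (m + 1)‖ₑ ^ p) (s := Finset.Ico s t)
          (fun _ _ => zero_le) (Finset.mem_Ico.2 ⟨Nat.le_sub_one_of_lt hlt, by omega⟩)
        simpa [Nat.sub_add_cancel (show 1 ≤ t by omega)] using this
  · rw [Finset.sum_add_distrib]
    have h1 : ∑ m ∈ Finset.range n, ‖x m‖ₑ ^ p ≤ ∑ m ∈ Finset.range (n + 1), ‖x m‖ₑ ^ p := by
      rw [Finset.sum_range_succ]; exact le_self_add
    have h2 : ∑ m ∈ Finset.range n, ‖x (m + 1)‖ₑ ^ p ≤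
        ∑ m ∈ Finset.range (n + 1), ‖x m‖ₑ ^ p := by
      rw [Finset.sum_range_succ']; exact le_self_add
    calc (2 : ℝ≥0∞) ^ (p - 1) * _ ≤ 2 ^ (p - 1) * (2 * ∑ m ∈ Finset.range (n + 1), ‖x m‖ₑ ^ p) := by
          rw [two_mul]; exact mul_le_mul_right (add_le_add h1 h2) _
      _ = _ := by
          rw [← mul_assoc]
          congr 1
          rw [ENNReal.rpow_sub _ _ two_ne_zero ENNReal.ofNat_ne_top, ENNReal.rpow_one,
            ENNReal.div_mul_cancel two_ne_zero ENNReal.ofNat_ne_top]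

/-- The `p`-variation is at most the total variation. -/
lemma discreteVar_le_rpow_sum {E : Type*} [PseudoEMetricSpace E] {p : ℝ} (hp : 1 ≤ p) (n : ℕ)
    (x : ℕ → E) (w : ℕ → ℝ≥0∞) (hw : ∀ m < n, edist (x (m + 1)) (x m) ≤ w m) :
    discreteVar p n x ≤ (∑ m ∈ Finset.range n, w m) ^ p := by
  refine (chainSup_mono fun s t hst htn => ENNReal.rpow_le_rpow ?_ (by linarith)).trans
    (chainSup_sum_rpow_le n w hp)
  rw [edist_comm]
  refine (edist_le_Ico_sum_edist x hst).trans (Finset.sum_le_sum fun m hm => ?_)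
  rw [edist_comm]
  exact hw m (by have := Finset.mem_Ico.1 hm; omega)

/-- The variation after a time shift by `k` costs at most the variation up to time `k`. -/
lemma discreteVar_le_shift {E : Type*} [SeminormedAddCommGroup E] {p : ℝ} (hp : 1 ≤ p) (n k : ℕ)
    (x : ℕ → E) (w : ℕ → ℝ≥0∞) (hw : ∀ m, edist (x (m + 1)) (x m) ≤ w m) :
    discreteVar p n x ≤ 2 ^ (p - 1) * ((∑ m ∈ Finset.range k, w m) ^ p +
      discreteVar p n (fun m => x (m + k) - x k)) := by
  have h1 : discreteVar p n (fun m => x (min m k)) ≤ (∑ m ∈ Finset.range k, w m) ^ p :=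
    (chainSup_comp_le (κ := fun m => min m k) (fun a b h => min_le_min_right k h)
      (min_le_right n k) (fun s t => edist (x t) (x s) ^ p)).trans
      (discreteVar_le_rpow_sum hp k x w fun m _ => hw m)
  have h2 : discreteVar p n (fun m => x (m - k + k) - x k) ≤
      discreteVar p n (fun m => x (m + k) - x k) :=
    chainSup_comp_le (κ := fun m => m - k) (fun a b h => Nat.sub_le_sub_right h k)
      (Nat.sub_le n k) (fun s t => edist (x (t + k) - x k) (x (s + k) - x k) ^ p)
  have h3 : x = fun m => x (min m k) + (x (m - k + k) - x k) := by
    funext m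
    rcases le_total m k with h | h
    · simp [h, Nat.sub_eq_zero_of_le h]
    · simp [h, Nat.sub_add_cancel h]
  calc discreteVar p n x = discreteVar p n (fun m => x (min m k) + (x (m - k + k) - x k)) := by
        rw [← h3]
    _ ≤ _ := (discreteVar_add_le hp n _ _).trans (mul_le_mul_right (add_le_add h1 h2) _)

lemma discreteVar_euclideanSpace_le {d : ℕ} {p : ℝ} (hp : 1 ≤ p) (n : ℕ)
    (x : ℕ → EuclideanSpace ℝ (Fin d)) :
    discreteVar p n x ≤ (d : ℝ≥0∞) ^ (p - 1) * ∑ i, discreteVar p n (fun m => x m i) := by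
  have key : ∀ y z : EuclideanSpace ℝ (Fin d), edist y z ≤ ∑ i, edist (y i) (z i) := by
    intro y z
    have h1 : dist y z ≤ ∑ i, dist (y i) (z i) := by
      rw [EuclideanSpace.dist_eq]
      refine Real.sqrt_le_iff.2 ⟨Finset.sum_nonneg fun _ _ => dist_nonneg, ?_⟩
      exact Finset.sum_sq_le_sq_sum_of_nonneg fun _ _ => dist_nonneg
    simp only [edist_dist]
    rw [← ENNReal.ofReal_sum_of_nonneg fun _ _ => dist_nonneg]
    exact ENNReal.ofReal_le_ofReal h1
  refine (chainSup_mono (ω' := fun s t => (d : ℝ≥0∞) ^ (p - 1) *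
    ∑ i, edist (x t i) (x s i) ^ p) fun s t _ _ => ?_).trans
    ((chainSup_const_mul_le _ _ _).trans (mul_le_mul_right ?_ _))
  · refine (ENNReal.rpow_le_rpow (key _ _) (by linarith)).trans ?_
    simpa using ENNReal.rpow_sum_le_const_mul_sum_rpow Finset.univ
      (fun i => edist (x t i) (x s i)) hp
  · refine chainSup_le fun k t ht hk => ?_
    rw [Finset.sum_comm]
    exact Finset.sum_le_sum fun i _ =>
      le_chainSup (fun s t => edist (x t i) (x s i) ^ p) ht hk

/-! ### Counting large moves of a path -/

/-- Greedy detection of the moves larger than `lam` of the path `x`. The first component is the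
current anchor, the second one the number of moves so far; as soon as the path is at distance more
than `lam` from the anchor, a move is recorded and the anchor is reset. -/
noncomputable def greedy (lam : ℝ) (x : ℕ → ℝ) : ℕ → ℝ × ℕ
  | 0 => (x 0, 0)
  | m + 1 => if lam < |x (m + 1) - (greedy lam x m).1| then (x (m + 1), (greedy lam x m).2 + 1)
      else greedy lam x m

lemma abs_sub_greedy_le {lam : ℝ} (hl : 0 ≤ lam) (x : ℕ → ℝ) (m : ℕ) :
    |x m - (greedy lam x m).1| ≤ lam := by
  cases m with
  | zero => simpa [greedy] using hl
  | succ m =>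
    rw [greedy]
    split_ifs with h
    · simpa using hl
    · exact not_lt.1 h

lemma greedy_count_mono (lam : ℝ) (x : ℕ → ℝ) : Monotone fun m => (greedy lam x m).2 := by
  refine monotone_nat_of_le_succ fun m => ?_
  rw [greedy]
  split_ifs <;> simp

lemma greedy_eq_of_count_eq {lam : ℝ} {x : ℕ → ℝ} {s t : ℕ} (hst : s ≤ t)
    (h : (greedy lam x t).2 ≤ (greedy lam x s).2) : greedy lam x t = greedy lam x s := by
  induction t, hst using Nat.le_induction with
  | base => rfl
  | succ t hst ih =>
    have h1 := greedy_count_mono lam x hst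
    rw [greedy] at h ⊢
    simp only at h1
    split_ifs with hc
    · rw [if_pos hc] at h; simp at h; omega
    · rw [if_neg hc] at h; exact ih h

lemma count_lt_of_move {lam : ℝ} (hl : 0 ≤ lam) {x : ℕ → ℝ} {s t : ℕ} (hst : s ≤ t)
    (h : 2 * lam < |x t - x s|) : (greedy lam x s).2 + 1 ≤ (greedy lam x t).2 := by
  by_contra hc
  have he := greedy_eq_of_count_eq (lam := lam) (x := x) hst (by omega)
  have h1 := abs_sub_greedy_le hl x t
  have h2 := abs_sub_greedy_le hl x s
  rw [he] at h1
  rw [abs_le] at h1 h2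
  rcases lt_abs.1 h with h | h <;> linarith

/-- Any chain up to time `n` has at most as many moves larger than `2 * lam` as the greedy
detection at level `lam`. -/
lemma chain_moves_le_greedy {lam : ℝ} (hl : 0 ≤ lam) (x : ℕ → ℝ) {n k : ℕ} {t : ℕ → ℕ}
    (ht : Monotone t) (hk : t k ≤ n) :
    ∑ j ∈ Finset.range k, (if 2 * lam < |x (t (j + 1)) - x (t j)| then (1 : ℝ≥0∞) else 0) ≤
      ((greedy lam x n).2 : ℝ≥0∞) := by
  have key : ∑ j ∈ Finset.range k, (if 2 * lam < |x (t (j + 1)) - x (t j)| then (1 : ℝ≥0∞) else 0)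
      + ((greedy lam x (t 0)).2 : ℝ≥0∞) ≤ ((greedy lam x (t k)).2 : ℝ≥0∞) := by
    clear hk
    induction k with
    | zero => simp
    | succ k ih =>
      rw [Finset.sum_range_succ, add_right_comm]
      refine (add_le_add ih le_rfl).trans ?_
      split_ifs with h
      · exact_mod_cast count_lt_of_move hl (ht k.le_succ) h
      · simpa using greedy_count_mono lam x (ht k.le_succ)
  exact (le_self_add.trans key).trans (by exact_mod_cast greedy_count_mono lam x hk)

lemma exists_dyadic_scale {L u : ℝ} (hu : 0 < u) (huL : u ≤ 2 * L) :
    ∃ i : ℕ, 2 * (L * (1 / 2) ^ (i + 1)) < u ∧ u ≤ 2 * (L * (1 / 2) ^ i) := by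
  have hL : 0 < L := by linarith
  have hex : ∃ i : ℕ, 2 * (L * (1 / 2) ^ (i + 1)) < u := by
    obtain ⟨i, hi⟩ := exists_pow_lt_of_lt_one (show 0 < u / (2 * L) by positivity)
      (show (1 / 2 : ℝ) < 1 by norm_num)
    refine ⟨i, ?_⟩
    rw [lt_div_iff₀ (by positivity)] at hi
    have : L * (1 / 2 : ℝ) ^ (i + 1) ≤ L * (1 / 2) ^ i := by
      gcongr ?_ * ?_
      exact pow_le_pow_of_le_one (by norm_num) (by norm_num) i.le_succ
    linarith
  classical
  refine ⟨Nat.find hex, Nat.find_spec hex, ?_⟩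
  rcases h : Nat.find hex with _ | i
  · simpa using huL
  · exact not_lt.1 (Nat.find_min hex (m := i) (by omega))

/-- A path without moves larger than `L` has `p`-variation controlled by the numbers of its moves
at the dyadic scales below `L`. -/
lemma discreteVar_le_tsum_greedy {p : ℝ} (hp : 0 < p) {L : ℝ} (hL : 0 < L) (x : ℕ → ℝ) (n : ℕ)
    (h0 : (greedy L x n).2 = 0) :
    discreteVar p n x ≤ ∑' i : ℕ, ENNReal.ofReal (2 * (L * (1 / 2) ^ i)) ^ p *
      ((greedy (L * (1 / 2) ^ (i + 1)) x n).2 : ℝ≥0∞) := by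
  refine chainSup_le fun k t ht hk => ?_
  have hterm : ∀ j ∈ Finset.range k, edist (x (t (j + 1))) (x (t j)) ^ p ≤
      ∑' i : ℕ, ENNReal.ofReal (2 * (L * (1 / 2) ^ i)) ^ p *
        (if 2 * (L * (1 / 2) ^ (i + 1)) < |x (t (j + 1)) - x (t j)| then (1 : ℝ≥0∞) else 0) := by
    intro j hj
    have hjk := Finset.mem_range.1 hj
    rcases (abs_nonneg (x (t (j + 1)) - x (t j))).eq_or_lt with hz | hpos
    · rw [edist_dist, Real.dist_eq, ← hz]; simp [hp]
    have huL : |x (t (j + 1)) - x (t j)| ≤ 2 * L := by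
      by_contra hc
      have h1 := count_lt_of_move hL.le (ht j.le_succ) (not_le.1 hc)
      have h2 := greedy_count_mono L x ((ht hjk).trans hk)
      simp only [Nat.succ_eq_add_one] at h1 h2
      omega
    obtain ⟨i, hi1, hi2⟩ := exists_dyadic_scale hpos huL
    refine le_trans ?_ (ENNReal.le_tsum i)
    rw [if_pos hi1, mul_one, edist_dist, Real.dist_eq]
    exact ENNReal.rpow_le_rpow (ENNReal.ofReal_le_ofReal hi2) hp.le
  refine (Finset.sum_le_sum hterm).trans ?_
  rw [← Summable.tsum_finsetSum fun _ _ => ENNReal.summable]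
  refine ENNReal.tsum_le_tsum fun i => ?_
  rw [← Finset.mul_sum]
  exact mul_le_mul_right (chain_moves_le_greedy (by positivity) x ht hk) _

/-! ### Large moves of martingales -/

/-- The odd function `sign x * |x| ^ r`. -/
noncomputable def signedRpow (r x : ℝ) : ℝ := Real.sign x * |x| ^ r

lemma abs_signedRpow_le (r x : ℝ) : |signedRpow r x| ≤ |x| ^ r := by
  rw [signedRpow, abs_mul, abs_of_nonneg (Real.rpow_nonneg (abs_nonneg x) r)]
  refine mul_le_of_le_one_left (Real.rpow_nonneg (abs_nonneg x) r) ?_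
  rcases Real.sign_apply_eq x with h | h | h <;> simp [h]

lemma measurable_signedRpow (r : ℝ) : Measurable (signedRpow r) := by
  have : Measurable Real.sign := by
    unfold Real.sign
    exact Measurable.ite measurableSet_Iio measurable_const
      (Measurable.ite measurableSet_Ioi measurable_const measurable_const)
  exact this.mul (measurable_id.abs.pow_const r)

lemma signedRpow_neg (r x : ℝ) : signedRpow r (-x) = -signedRpow r x := by
  simp [signedRpow, Real.sign_neg]

lemma signedRpow_of_nonneg {r x : ℝ} (hr : r ≠ 0) (hx : 0 ≤ x) : signedRpow r x = x ^ r := by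
  rcases hx.eq_or_lt with rfl | h
  · simp [signedRpow, hr]
  · simp [signedRpow, Real.sign_of_pos h, abs_of_pos h]

lemma rpow_sub_rpow_le {r a b : ℝ} (hr : 0 < r) (hr1 : r ≤ 1) (hb : 0 ≤ b) (hab : b ≤ a) :
    a ^ r - b ^ r ≤ (a - b) ^ r := by
  have := Real.rpow_add_le_add_rpow hb (sub_nonneg.2 hab) hr.le hr1
  rw [add_sub_cancel] at this
  linarith

lemma abs_signedRpow_sub_le {r : ℝ} (hr : 0 < r) (hr1 : r ≤ 1) (a b : ℝ) :
    |signedRpow r a - signedRpow r b| ≤ 2 * |a - b| ^ r := by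
  wlog hab : b ≤ a generalizing a b
  · rw [abs_sub_comm, abs_sub_comm a b]; exact this b a (le_of_not_ge hab)
  have pos : ∀ a b : ℝ, 0 ≤ b → b ≤ a →
      |signedRpow r a - signedRpow r b| ≤ 2 * |a - b| ^ r := by
    intro a b hb hab
    rw [signedRpow_of_nonneg hr.ne' hb, signedRpow_of_nonneg hr.ne' (hb.trans hab),
      abs_of_nonneg (sub_nonneg.2 (Real.rpow_le_rpow hb hab hr.le)),
      abs_of_nonneg (sub_nonneg.2 hab)]
    have := rpow_sub_rpow_le hr hr1 hb hab
    have h2 : 0 ≤ (a - b) ^ r := Real.rpow_nonneg (sub_nonneg.2 hab) r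
    linarith
  rcases le_total 0 b with hb | hb
  · exact pos a b hb hab
  rcases le_total 0 a with ha | ha
  · have h1 : signedRpow r b = -(-b) ^ r := by
      rw [← signedRpow_of_nonneg hr.ne' (neg_nonneg.2 hb), signedRpow_neg, neg_neg]
    rw [h1, signedRpow_of_nonneg hr.ne' ha, sub_neg_eq_add,
      abs_of_nonneg (add_nonneg (Real.rpow_nonneg ha r) (Real.rpow_nonneg (neg_nonneg.2 hb) r)),
      abs_of_nonneg (sub_nonneg.2 hab), two_mul]
    exact add_le_add (Real.rpow_le_rpow ha (by linarith) hr.le)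
      (Real.rpow_le_rpow (by linarith) (by linarith) hr.le)
  · have := pos (-b) (-a) (by linarith) (by linarith)
    rw [signedRpow_neg, signedRpow_neg] at this
    rw [show a - b = -b - -a by ring,
      show signedRpow r a - signedRpow r b = -signedRpow r b - -signedRpow r a by ring]
    exact this

/-- The elementary inequality behind the von Bahr–Esseen inequality. -/
lemma abs_add_rpow_le {q : ℝ} (hq : 1 < q) (hq2 : q ≤ 2) (x y : ℝ) :
    |x + y| ^ q ≤ |x| ^ q + q * signedRpow (q - 1) x * y + 2 * q * |y| ^ q := by
  set u := x + y with hu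
  have hq0 : 0 < q := by linarith
  have hr : 0 < q - 1 := by linarith
  have hself : signedRpow (q - 1) u * u = |u| ^ q := by
    have hs : Real.sign u * u = |u| := by
      rcases lt_trichotomy u 0 with h | h | h
      · simp [Real.sign_of_neg h, abs_of_neg h]
      · simp [h]
      · simp [Real.sign_of_pos h, abs_of_pos h]
    rw [signedRpow, mul_right_comm, hs, mul_comm]
    rcases (abs_nonneg u).eq_or_lt with h | h
    · rw [← h, Real.zero_rpow hq0.ne']; simp
    · rw [← Real.rpow_add_one h.ne']; simp
  -- Young's inequality gives the tangent inequality for `|·| ^ q` at `u`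
  have young : signedRpow (q - 1) u * x ≤ |x| ^ q / q + |u| ^ q * ((q - 1) / q) := by
    have hconj : q.HolderConjugate (q / (q - 1)) := Real.HolderConjugate.conjExponent hq
    have h1 := Real.young_inequality_of_nonneg (abs_nonneg x)
      (Real.rpow_nonneg (abs_nonneg u) (q - 1)) hconj
    rw [← Real.rpow_mul (abs_nonneg u), mul_div_cancel₀ _ hr.ne'] at h1
    calc signedRpow (q - 1) u * x ≤ |signedRpow (q - 1) u * x| := le_abs_self _
      _ ≤ |x| * |u| ^ (q - 1) := by
        rw [abs_mul, mul_comm]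
        exact mul_le_mul_of_nonneg_left (abs_signedRpow_le _ _) (abs_nonneg _)
      _ ≤ |x| ^ q / q + |u| ^ q / (q / (q - 1)) := h1
      _ = _ := by rw [div_div_eq_mul_div, mul_div_assoc]
  have h1 : q * (signedRpow (q - 1) u * x) ≤ |x| ^ q + |u| ^ q * (q - 1) := by
    have := mul_le_mul_of_nonneg_left young hq0.le
    have e : q * (|x| ^ q / q + |u| ^ q * ((q - 1) / q)) = |x| ^ q + |u| ^ q * (q - 1) := by
      field_simp
    rwa [e] at this
  have h2 : (signedRpow (q - 1) u - signedRpow (q - 1) x) * y ≤ 2 * |y| ^ q := by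
    refine (le_abs_self _).trans ?_
    rw [abs_mul]
    have h3 := abs_signedRpow_sub_le hr (by linarith) u x
    rw [hu, add_sub_cancel_left] at h3
    refine (mul_le_mul_of_nonneg_right h3 (abs_nonneg y)).trans (le_of_eq ?_)
    rcases (abs_nonneg y).eq_or_lt with h | h
    · rw [← h, Real.zero_rpow hq0.ne']; simp
    · rw [mul_assoc, ← Real.rpow_add_one h.ne']; simp
  have h3 : signedRpow (q - 1) u * x = |u| ^ q - signedRpow (q - 1) u * y := by
    rw [← hself, hu]; ring
  rw [h3] at h1
  nlinarith [mul_le_mul_of_nonneg_left h2 hq0.le]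

section Martingale

variable {Ω : Type*} {mΩ : MeasurableSpace Ω} {μ : Measure Ω} {ℱ : Filtration ℕ mΩ}
  {M : ℕ → Ω → ℝ}

lemma measurable_greedy (hM : ∀ m, Measurable[ℱ m] (M m)) (lam : ℝ) (m : ℕ) :
    Measurable[ℱ m] fun ω => greedy lam (fun i => M i ω) m := by
  induction m with
  | zero => exact (hM 0).prodMk measurable_const
  | succ m ih =>
    have ih' := ih.mono (ℱ.mono m.le_succ) le_rfl
    simp only [greedy]
    refine Measurable.ite (measurableSet_lt measurable_const ?_) ?_ ih'
    · exact continuous_abs.measurable.comp ((hM (m + 1)).sub ih'.fst)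
    · exact (hM (m + 1)).prodMk (ih'.snd.add_const 1)

lemma greedy_count_le (lam : ℝ) (x : ℕ → ℝ) (m : ℕ) : (greedy lam x m).2 ≤ m := by
  induction m with
  | zero => simp [greedy]
  | succ m ih =>
    rw [greedy]
    split_ifs
    · simpa using ih
    · omega

/-- The expected number of moves larger than `lam` of a martingale with increments in `L^q`,
`1 < q ≤ 2`. The quantity `lam ^ q * count + |distance to the anchor| ^ q` grows in each step by at
most the tangent term of `abs_add_rpow_le`, which is centred, plus `2 * q * |increment| ^ q`. -/
lemma integral_greedy_count_le [IsProbabilityMeasure μ] (hM : Martingale M ℱ μ) {q : ℝ}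
    (hq : 1 < q) (hq2 : q ≤ 2) (hd : ∀ j, Integrable (fun ω => |M (j + 1) ω - M j ω| ^ q) μ)
    {lam : ℝ} (hl : 0 < lam) (n : ℕ) :
    ∫ ω, lam ^ q * ((greedy lam (fun i => M i ω) n).2 : ℝ) ∂μ ≤
      2 * q * ∑ j ∈ Finset.range n, ∫ ω, |M (j + 1) ω - M j ω| ^ q ∂μ := by
  have hq0 : 0 < q := by linarith
  set N : ℕ → Ω → ℝ := fun m ω => ((greedy lam (fun i => M i ω) m).2 : ℝ) with hN
  set D : ℕ → Ω → ℝ := fun m ω => M m ω - (greedy lam (fun i => M i ω) m).1 with hD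
  have hadM : ∀ m, Measurable[ℱ m] (M m) := fun m => (hM.1 m).measurable
  have hDF : ∀ m, Measurable[ℱ m] (D m) := fun m =>
    (hadM m).sub (measurable_fst.comp (measurable_greedy hadM lam m))
  have hDm : ∀ m, Measurable (D m) := fun m => (hDF m).mono (ℱ.le m) le_rfl
  have hNm : ∀ m, Measurable (N m) := fun m =>
    (measurable_from_top (f := fun k : ℕ => (k : ℝ))).comp
      (measurable_snd.comp ((measurable_greedy hadM lam m).mono (ℱ.le m) le_rfl))
  have hDb : ∀ m ω, |D m ω| ≤ lam := fun m ω => abs_sub_greedy_le hl.le (fun i => M i ω) m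
  have hNi : ∀ m, Integrable (fun ω => lam ^ q * N m ω) μ := fun m =>
    (Integrable.of_bound (hNm m).aestronglyMeasurable m (ae_of_all _ fun ω => by
      simpa [hN] using greedy_count_le lam (fun i => M i ω) m)).const_mul _
  have hDi : ∀ m, Integrable (fun ω => |D m ω| ^ q) μ := fun m =>
    Integrable.of_bound ((hDm m).abs.pow_const q).aestronglyMeasurable (lam ^ q)
      (ae_of_all _ fun ω => by
        rw [Real.norm_of_nonneg (Real.rpow_nonneg (abs_nonneg _) q)]
        exact Real.rpow_le_rpow (abs_nonneg _) (hDb m ω) hq0.le)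
  have hΔi : ∀ m, Integrable (fun ω => M (m + 1) ω - M m ω) μ := fun m =>
    (hM.integrable (m + 1)).sub (hM.integrable m)
  have hcen : ∀ m, Integrable (fun ω => signedRpow (q - 1) (D m ω) * (M (m + 1) ω - M m ω)) μ ∧
      ∫ ω, signedRpow (q - 1) (D m ω) * (M (m + 1) ω - M m ω) ∂μ = 0 := by
    intro m
    have hgF : StronglyMeasurable[ℱ m] fun ω => signedRpow (q - 1) (D m ω) :=
      ((measurable_signedRpow (q - 1)).comp (hDF m)).stronglyMeasurable
    have hint : Integrable (fun ω => signedRpow (q - 1) (D m ω) * (M (m + 1) ω - M m ω)) μ :=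
      (hΔi m).bdd_mul (c := lam ^ (q - 1)) (hgF.mono (ℱ.le m)).aestronglyMeasurable
        (ae_of_all _ fun ω => (abs_signedRpow_le _ _).trans
          (Real.rpow_le_rpow (abs_nonneg _) (hDb m ω) (by linarith)))
    refine ⟨hint, ?_⟩
    have h1 := condExp_mul_of_stronglyMeasurable_left (m := ℱ m) (μ := μ) hgF hint (hΔi m)
    have h2 : μ[fun ω => M (m + 1) ω - M m ω | ℱ m] =ᵐ[μ] 0 := by
      have h3 := condExp_sub (hM.integrable (m + 1)) (hM.integrable m) (ℱ m)
      filter_upwards [h3, hM.2 m (m + 1) m.le_succ, hM.2 m m le_rfl] with ω h3 h4 h5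
      have h6 : (μ[M (m + 1) - M m | ℱ m]) ω = 0 := by
        rw [h3, Pi.sub_apply, h4, h5, sub_self]
      exact h6
    rw [← integral_condExp (ℱ.le m)]
    refine integral_eq_zero_of_ae ?_
    filter_upwards [h1, h2] with ω h1 h2
    have h3 : (μ[(fun ω => signedRpow (q - 1) (D m ω)) * fun ω => M (m + 1) ω - M m ω | ℱ m]) ω
      = 0 := by rw [h1, Pi.mul_apply, h2]; simp
    exact h3
  have hstep : ∀ m ω, lam ^ q * N (m + 1) ω + |D (m + 1) ω| ^ q ≤ lam ^ q * N m ω + |D m ω| ^ q +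
      q * (signedRpow (q - 1) (D m ω) * (M (m + 1) ω - M m ω)) +
        2 * q * |M (m + 1) ω - M m ω| ^ q := by
    intro m ω
    have h1 := abs_add_rpow_le hq hq2 (D m ω) (M (m + 1) ω - M m ω)
    have h2 : lam ^ q * N (m + 1) ω + |D (m + 1) ω| ^ q ≤
        lam ^ q * N m ω + |D m ω + (M (m + 1) ω - M m ω)| ^ q := by
      have e : D m ω + (M (m + 1) ω - M m ω) =
          M (m + 1) ω - (greedy lam (fun i => M i ω) m).1 := by simp only [hD]; ring
      rw [e]
      simp only [hN, hD, greedy]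
      split_ifs with hc
      · have := Real.rpow_le_rpow hl.le hc.le hq0.le
        simp only [sub_self, abs_zero, Real.zero_rpow hq0.ne']
        push_cast
        linarith
      · exact le_rfl
    linarith
  have main : ∀ m, ∫ ω, (lam ^ q * N m ω + |D m ω| ^ q) ∂μ ≤
      2 * q * ∑ j ∈ Finset.range m, ∫ ω, |M (j + 1) ω - M j ω| ^ q ∂μ := by
    intro m
    induction m with
    | zero => simp [hN, hD, greedy, Real.zero_rpow hq0.ne']
    | succ m ih =>
      have hb1 : Integrable (fun ω => lam ^ q * N m ω + |D m ω| ^ q) μ := (hNi m).add (hDi m)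
      have hb2 : Integrable (fun ω =>
        q * (signedRpow (q - 1) (D m ω) * (M (m + 1) ω - M m ω))) μ := (hcen m).1.const_mul q
      have hb3 : Integrable (fun ω => 2 * q * |M (m + 1) ω - M m ω| ^ q) μ := (hd m).const_mul _
      have hb12 : Integrable (fun ω => lam ^ q * N m ω + |D m ω| ^ q +
        q * (signedRpow (q - 1) (D m ω) * (M (m + 1) ω - M m ω))) μ := hb1.add hb2
      refine (integral_mono ((hNi (m + 1)).add (hDi (m + 1))) (hb12.add hb3) (hstep m)).trans ?_
      simp only [Pi.add_apply]
      rw [integral_add hb12 hb3, integral_add hb1 hb2, integral_const_mul,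
        integral_const_mul, (hcen m).2, Finset.sum_range_succ, mul_add]
      linarith
  refine le_trans (integral_mono (hNi n) ((hNi n).add (hDi n)) fun ω => ?_) (main n)
  exact le_add_of_nonneg_right (Real.rpow_nonneg (abs_nonneg _) q)

end Martingale

/-! ### Tightness -/

section Tightness

variable {Ω : Type*} [MeasurableSpace Ω] {P : Measure Ω} {X X' : ℕ → Ω → ℝ≥0∞}

lemma IsTightSeq.mono (hX' : IsTightSeq P X') (h : ∀ n, 1 ≤ n → ∀ᵐ ω ∂P, X n ω ≤ X' n ω) :
    IsTightSeq P X := fun ε hε => by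
  obtain ⟨M, hM⟩ := hX' ε hε
  refine ⟨M, fun n hn => (measure_mono_ae ?_).trans (hM n hn)⟩
  filter_upwards [h n hn] with ω hω (hlt : _ < _)
  exact hlt.trans_le hω

lemma IsTightSeq.add (hX : IsTightSeq P X) (hX' : IsTightSeq P X') :
    IsTightSeq P (fun n ω => X n ω + X' n ω) := fun ε hε => by
  obtain ⟨M, hM⟩ := hX (ε / 2) (ENNReal.half_pos hε.ne')
  obtain ⟨M', hM'⟩ := hX' (ε / 2) (ENNReal.half_pos hε.ne')
  refine ⟨M + M', fun n hn => ?_⟩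
  calc _ ≤ P ({ω | (M : ℝ≥0∞) < X n ω} ∪ {ω | (M' : ℝ≥0∞) < X' n ω}) := by
        refine measure_mono fun ω hω => ?_
        simp only [mem_ofPred_eq, mem_union, ENNReal.coe_add] at hω ⊢
        by_contra! hc
        exact absurd hω (not_lt.2 (add_le_add hc.1 hc.2))
    _ ≤ ε / 2 + ε / 2 := (measure_union_le _ _).trans (add_le_add (hM n hn) (hM' n hn))
    _ = ε := ENNReal.add_halves ε

lemma IsTightSeq.const_mul (hX : IsTightSeq P X) {c : ℝ≥0∞} (hc : c ≠ ∞) :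
    IsTightSeq P (fun n ω => c * X n ω) := fun ε hε => by
  obtain ⟨M, hM⟩ := hX ε hε
  refine ⟨c.toNNReal * M, fun n hn => (measure_mono fun ω hω => ?_).trans (hM n hn)⟩
  simp only [mem_ofPred_eq, ENNReal.coe_mul, ENNReal.coe_toNNReal hc] at hω ⊢
  by_contra hle
  exact absurd hω (not_lt.2 (mul_le_mul_right (not_lt.1 hle) c))

lemma IsTightSeq.rpow_const (hX : IsTightSeq P X) {s : ℝ} (hs : 0 < s) :
    IsTightSeq P (fun n ω => X n ω ^ s) := fun ε hε => by
  obtain ⟨M, hM⟩ := hX ε hε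
  refine ⟨M ^ s, fun n hn => (measure_mono fun ω hω => ?_).trans (hM n hn)⟩
  simp only [mem_ofPred_eq] at hω ⊢
  rw [ENNReal.coe_rpow_of_nonneg _ hs.le] at hω
  exact (ENNReal.rpow_lt_rpow_iff hs).1 hω

lemma IsTightSeq.finset_sum {ι : Type*} (s : Finset ι) {X : ι → ℕ → Ω → ℝ≥0∞}
    (hX : ∀ i ∈ s, IsTightSeq P (X i)) : IsTightSeq P (fun n ω => ∑ i ∈ s, X i n ω) := by
  classical
  induction s using Finset.induction_on with
  | empty => exact fun ε _ => ⟨0, by simp⟩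
  | insert i s hi ih =>
    simp only [Finset.sum_insert hi]
    exact (hX i (Finset.mem_insert_self _ _)).add
      (ih fun j hj => hX j (Finset.mem_insert_of_mem hj))

lemma isTightSeq_of_lintegral_le {C : ℝ≥0∞} (hC : C ≠ ∞)
    (hm : ∀ n, 1 ≤ n → AEMeasurable (X n) P) (h : ∀ n, 1 ≤ n → ∫⁻ ω, X n ω ∂P ≤ C) :
    IsTightSeq P X := fun ε hε => by
  rcases eq_or_ne ε ∞ with rfl | hεt
  · exact ⟨0, fun _ _ => le_top⟩
  have hfin : C / ε + 1 ≠ ∞ := ENNReal.add_ne_top.2 ⟨ENNReal.div_ne_top hC hε.ne', by simp⟩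
  refine ⟨(C / ε + 1).toNNReal, fun n hn => ?_⟩
  rw [ENNReal.coe_toNNReal hfin]
  calc P {ω | C / ε + 1 < X n ω} ≤ P {ω | C / ε + 1 ≤ X n ω} :=
        measure_mono fun ω hω => by
          simp only [mem_ofPred_eq] at hω ⊢; exact hω.le
    _ ≤ (∫⁻ ω, X n ω ∂P) / (C / ε + 1) := meas_ge_le_lintegral_div (hm n hn) (by simp) hfin
    _ ≤ C / (C / ε + 1) := ENNReal.div_le_div_right (h n hn) _
    _ ≤ ε := by
      refine ENNReal.div_le_of_le_mul ?_
      rw [mul_add, ENNReal.mul_div_cancel hε.ne' hεt]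
      exact le_self_add

lemma isTightSeq_const {g : Ω → ℝ≥0∞} [IsFiniteMeasure P] (hg : Measurable g)
    (hfin : ∀ ω, g ω ≠ ∞) : IsTightSeq P (fun _ ω => g ω) := fun ε hε => by
  have hlim : Tendsto (fun k : ℕ => P {ω | (k : ℝ≥0∞) < g ω}) atTop (𝓝 0) := by
    have h1 : ⋂ k : ℕ, {ω | (k : ℝ≥0∞) < g ω} = ∅ := by
      ext ω
      simp only [mem_iInter, mem_ofPred_eq, mem_empty_iff_false, iff_false, not_forall, not_lt]
      exact (ENNReal.exists_nat_gt (hfin ω)).imp fun _ h => h.le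
    rw [← measure_empty (μ := P), ← h1]
    refine tendsto_measure_iInter_atTop
      (fun k => (measurableSet_lt measurable_const hg).nullMeasurableSet) ?_
      ⟨0, measure_ne_top _ _⟩
    intro i j hij ω hω
    simp only [mem_ofPred_eq] at hω ⊢
    exact lt_of_le_of_lt (by exact_mod_cast hij) hω
  obtain ⟨k, hk⟩ := (hlim.eventually (gt_mem_nhds hε)).exists
  exact ⟨k, fun _ _ => by simpa using hk.le⟩

lemma IsTightSeq.of_absolutelyContinuous {Q : Measure Ω} [IsFiniteMeasure Q] [SigmaFinite P]
    (hX : IsTightSeq P X) (hQ : Q ≪ P) : IsTightSeq Q X := fun ε hε => by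
  have hfin : ∫⁻ ω, Q.rnDeriv P ω ∂P ≠ ∞ := (Measure.lintegral_rnDeriv_lt_top Q P).ne
  obtain ⟨δ, hδ, h⟩ := exists_pos_setLIntegral_lt_of_measure_lt hfin hε.ne'
  obtain ⟨δ', hδ', hlt⟩ := exists_between hδ
  obtain ⟨M, hM⟩ := hX δ' hδ'
  refine ⟨M, fun n hn => ?_⟩
  set s := {ω | (M : ℝ≥0∞) < X n ω}
  calc Q s ≤ Q (toMeasurable P s) := measure_mono (subset_toMeasurable _ _)
    _ = ∫⁻ ω in toMeasurable P s, Q.rnDeriv P ω ∂P := by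
      rw [Measure.setLIntegral_rnDeriv hQ]
    _ ≤ ε := (h _ (by rw [measure_toMeasurable]; exact (hM n hn).trans_lt hlt)).le

lemma IsTightSeq.comp_map {Ω' : Type*} [MeasurableSpace Ω'] {g : Ω → Ω'} (hg : AEMeasurable g P)
    {X : ℕ → Ω' → ℝ≥0∞} (hX : IsTightSeq (P.map g) X) : IsTightSeq P (fun n ω => X n (g ω)) :=
  fun ε hε => (hX ε hε).imp fun _ hM n hn =>
    (Measure.le_map_apply hg {y | _ < X n y}).trans (hM n hn)

end Tightness

/-- Tightness of the `p`-variation of a triangular array of martingales whose increments have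
`q`-th moments with bounded sums, `1 < q ≤ 2`, `q < p`. With high probability there is no move
above a large scale `L`, and the expected numbers of moves at the dyadic scales below `L` are summable
against the `p`-th powers of these scales. -/
lemma isTightSeq_discreteVar_martingale {Ω : Type*} {mΩ : MeasurableSpace Ω} {μ : Measure Ω}
    [IsProbabilityMeasure μ] (ℱ : ℕ → Filtration ℕ mΩ) (M : ℕ → ℕ → Ω → ℝ) {p q A : ℝ}
    (hq : 1 < q) (hq2 : q ≤ 2) (hqp : q < p)
    (hM : ∀ n, 1 ≤ n → Martingale (M n) (ℱ n) μ)
    (hd : ∀ n, 1 ≤ n → ∀ j, Integrable (fun ω => |M n (j + 1) ω - M n j ω| ^ q) μ)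
    (hA : ∀ n, 1 ≤ n →
      ∑ j ∈ Finset.range n, ∫ ω, |M n (j + 1) ω - M n j ω| ^ q ∂μ ≤ A) :
    IsTightSeq μ (fun n ω => discreteVar p n (fun m => M n m ω)) := by
  have hq0 : 0 < q := by linarith
  have hp0 : 0 < p := by linarith
  have hA0 : 0 ≤ A := le_trans (Finset.sum_nonneg fun j _ => integral_nonneg fun ω =>
    Real.rpow_nonneg (abs_nonneg _) q) (hA 1 le_rfl)
  have hmeas : ∀ n, 1 ≤ n → ∀ lam : ℝ,
      Measurable fun ω => ((greedy lam (fun i => M n i ω) n).2 : ℝ≥0∞) := fun n hn lam =>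
    (measurable_from_top (f := fun k : ℕ => (k : ℝ≥0∞))).comp (measurable_snd.comp
      ((measurable_greedy (fun m => ((hM n hn).1 m).measurable) lam n).mono ((ℱ n).le n) le_rfl))
  -- the expected number of moves at each scale
  have hN : ∀ n, 1 ≤ n → ∀ lam : ℝ, 0 < lam →
      ∫⁻ ω, ((greedy lam (fun i => M n i ω) n).2 : ℝ≥0∞) ∂μ ≤
        ENNReal.ofReal (2 * q * A * lam ^ (-q)) := by
    intro n hn lam hl
    have h1 := integral_greedy_count_le (hM n hn) hq hq2 (hd n hn) hl n
    rw [integral_const_mul] at h1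
    have hlq : 0 < lam ^ q := Real.rpow_pos_of_pos hl q
    have h2 : ∫ ω, ((greedy lam (fun i => M n i ω) n).2 : ℝ) ∂μ ≤ 2 * q * A * lam ^ (-q) := by
      rw [Real.rpow_neg hl.le, ← div_eq_mul_inv, le_div_iff₀ hlq, mul_comm]
      exact h1.trans (mul_le_mul_of_nonneg_left (hA n hn) (by positivity))
    refine le_trans (le_of_eq ?_) (ENNReal.ofReal_le_ofReal h2)
    rw [ofReal_integral_eq_lintegral_ofReal]
    · simp
    · have h3 := (hmeas n hn lam).ennreal_toReal
      simp only [ENNReal.toReal_natCast] at h3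
      exact Integrable.of_bound h3.aestronglyMeasurable n (ae_of_all _ fun ω => by
        simpa using greedy_count_le lam (fun i => M n i ω) n)
    · exact ae_of_all _ fun ω => Nat.cast_nonneg _
  intro ε hε
  rcases eq_or_ne ε ∞ with rfl | hεt
  · exact ⟨0, fun _ _ => le_top⟩
  -- a scale `L` that is rarely exceeded
  obtain ⟨L, hL, hLε⟩ : ∃ L : ℝ, 0 < L ∧ ENNReal.ofReal (2 * q * A * L ^ (-q)) ≤ ε / 2 := by
    have h1 : Tendsto (fun L : ℝ => ENNReal.ofReal (2 * q * A * L ^ (-q))) atTop (𝓝 0) := by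
      have := ENNReal.tendsto_ofReal ((tendsto_rpow_neg_atTop hq0).const_mul (2 * q * A))
      simpa using this
    obtain ⟨L, hL1, hL2⟩ := ((h1.eventually (ge_mem_nhds (ENNReal.half_pos hε.ne'))).and
      (eventually_gt_atTop 0)).exists
    exact ⟨L, hL2, hL1⟩
  set U : ℕ → Ω → ℝ≥0∞ := fun n ω => ∑' i : ℕ, ENNReal.ofReal (2 * (L * (1 / 2) ^ i)) ^ p *
      ((greedy (L * (1 / 2) ^ (i + 1)) (fun m => M n m ω) n).2 : ℝ≥0∞) with hU
  have hUm : ∀ n, 1 ≤ n → Measurable (U n) := fun n hn =>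
    Measurable.tsum fun i => (hmeas n hn _).const_mul _
  set r : ℝ := (1 / 2) ^ (p - q) with hr
  have hr0 : 0 ≤ r := by positivity
  have hr1 : r < 1 := Real.rpow_lt_one (by norm_num) (by norm_num) (by linarith)
  set C : ℝ≥0∞ := ∑' i : ℕ, ENNReal.ofReal (2 ^ p * (2 * q * A) * 2 ^ q * L ^ (p - q) * r ^ i)
    with hCdef
  have hC : C ≠ ∞ := by
    have hs : Summable fun i : ℕ => 2 ^ p * (2 * q * A) * 2 ^ q * L ^ (p - q) * r ^ i :=
      (summable_geometric_of_lt_one hr0 hr1).mul_left _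
    exact hs.tsum_ofReal_ne_top
  have hUC : ∀ n, 1 ≤ n → ∫⁻ ω, U n ω ∂μ ≤ C := by
    intro n hn
    rw [lintegral_tsum fun i => ((hmeas n hn _).const_mul _).aemeasurable]
    refine ENNReal.tsum_le_tsum fun i => ?_
    rw [lintegral_const_mul _ (hmeas n hn _)]
    refine (mul_le_mul_right (hN n hn _ (by positivity)) _).trans (le_of_eq ?_)
    rw [ENNReal.ofReal_rpow_of_nonneg (by positivity) hp0.le,
      ← ENNReal.ofReal_mul (by positivity)]
    congr 1
    have e1 : r ^ i = ((1 / 2 : ℝ) ^ i) ^ (p - q) := by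
      rw [hr, ← Real.rpow_natCast, ← Real.rpow_natCast, ← Real.rpow_mul (by norm_num),
        ← Real.rpow_mul (by norm_num), mul_comm]
    rw [e1, pow_succ, ← mul_assoc L, mul_assoc (2 ^ p * (2 * q * A) * 2 ^ q),
      ← Real.mul_rpow hL.le (by positivity)]
    set z := L * (1 / 2 : ℝ) ^ i with hz
    have hz0 : 0 < z := by positivity
    rw [Real.mul_rpow (by norm_num) hz0.le, Real.mul_rpow hz0.le (by norm_num),
      Real.rpow_sub hz0, Real.rpow_neg hz0.le, Real.rpow_neg (by norm_num : (0:ℝ) ≤ 1 / 2),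
      one_div, Real.inv_rpow (by norm_num : (0:ℝ) ≤ 2), inv_inv]
    ring
  obtain ⟨K, hK⟩ := isTightSeq_of_lintegral_le hC (fun n hn => (hUm n hn).aemeasurable) hUC
    (ε / 2) (ENNReal.half_pos hε.ne')
  refine ⟨K, fun n hn => ?_⟩
  have hsub : {ω | (K : ℝ≥0∞) < discreteVar p n (fun m => M n m ω)} ⊆
      {ω | 1 ≤ ((greedy L (fun i => M n i ω) n).2 : ℝ≥0∞)} ∪ {ω | (K : ℝ≥0∞) < U n ω} := by
    intro ω hω
    by_cases h0 : (greedy L (fun i => M n i ω) n).2 = 0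
    · exact Or.inr (lt_of_lt_of_le hω (discreteVar_le_tsum_greedy hp0 hL _ n h0))
    · exact Or.inl (by
        have : 1 ≤ (greedy L (fun i => M n i ω) n).2 := Nat.one_le_iff_ne_zero.2 h0
        exact_mod_cast this)
  calc _ ≤ μ {ω | 1 ≤ ((greedy L (fun i => M n i ω) n).2 : ℝ≥0∞)} + μ {ω | (K : ℝ≥0∞) < U n ω} :=
        (measure_mono hsub).trans (measure_union_le _ _)
    _ ≤ ε / 2 + ε / 2 := by
      refine add_le_add ?_ (hK n hn)
      have := meas_ge_le_lintegral_div (μ := μ) (hmeas n hn L).aemeasurable one_ne_zero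
        ENNReal.one_ne_top
      rw [div_one] at this
      exact this.trans ((hN n hn L hL).trans hLε)
    _ = ε := ENNReal.add_halves ε

/-! ### Truncated moments of regularly varying random variables -/

section RegularVariation

variable {Ω : Type*} [MeasurableSpace Ω] {μ : Measure Ω} {ξ : Ω → ℝ} {α : ℝ}

lemma IsRegularlyVarying.tendsto_tail_ratio (h : IsRegularlyVarying μ ξ α) (hξ : ∀ ω, 0 < ξ ω)
    {r : ℝ} (hr : 0 < r) :
    Tendsto (fun t => μ.real {ω | r * t < ξ ω} / μ.real {ω | t < ξ ω}) atTop (𝓝 (r ^ (-α))) := by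
  obtain ⟨σ, hσ, h⟩ := h
  have := h r hr univ MeasurableSet.univ (by simp)
  simp only [probReal_univ, mul_one] at this
  refine this.congr fun t => ?_
  have hn : ∀ ω, ‖ξ ω‖ = ξ ω := fun ω => Real.norm_of_nonneg (hξ ω).le
  have hs : ∀ ω, (ξ ω)⁻¹ • ξ ω = 1 := fun ω => by
    rw [smul_eq_mul, inv_mul_cancel₀ (hξ ω).ne']
  have h1 : (1 : ℝ) ∈ (Subtype.val '' (univ : Set (Metric.sphere (0 : ℝ) 1))) := by simp
  simp only [hn, hs, h1, and_true]

variable [IsFiniteMeasure μ]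

lemma tail_antitone : Antitone fun t : ℝ => μ.real {ω | t < ξ ω} := fun _ _ hst =>
  measureReal_mono fun _ hω => by
    simp only [mem_ofPred_eq] at hω ⊢; exact hst.trans_lt hω

lemma tail_pos (h2 : Tendsto
    (fun t => μ.real {ω | 2 * t < ξ ω} / μ.real {ω | t < ξ ω}) atTop (𝓝 ((2 : ℝ) ^ (-α))))
    (t : ℝ) : 0 < μ.real {ω | t < ξ ω} := by
  have hev := h2.eventually (lt_mem_nhds (Real.rpow_pos_of_pos two_pos (-α)))
  obtain ⟨s, hs, hts⟩ := (hev.and (eventually_ge_atTop t)).exists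
  refine lt_of_lt_of_le (measureReal_nonneg.lt_of_ne fun h0 => ?_) (tail_antitone hts)
  rw [← h0, div_zero] at hs
  exact lt_irrefl _ hs

/-- Potter bound: along doublings the tail decays at least like `2 ^ (-β)`, for any `β < α`. -/
lemma tail_upper (h2 : Tendsto
    (fun t => μ.real {ω | 2 * t < ξ ω} / μ.real {ω | t < ξ ω}) atTop (𝓝 ((2 : ℝ) ^ (-α))))
    {β : ℝ} (hβ : β < α) :
    ∃ t₀ : ℝ, 0 < t₀ ∧ ∀ t, t₀ ≤ t → ∀ k : ℕ,
      μ.real {ω | 2 ^ k * t < ξ ω} ≤ ((2 : ℝ) ^ (-β)) ^ k * μ.real {ω | t < ξ ω} := by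
  have hlt : (2 : ℝ) ^ (-α) < 2 ^ (-β) := Real.rpow_lt_rpow_of_exponent_lt one_lt_two (by linarith)
  obtain ⟨t₁, ht₁⟩ := eventually_atTop.1 (h2.eventually (gt_mem_nhds hlt))
  refine ⟨max t₁ 1, by positivity, fun t ht k => ?_⟩
  have ht0 : 0 < t := lt_of_lt_of_le (by positivity) ht
  induction k with
  | zero => simp
  | succ k ih =>
    have hk : t₁ ≤ 2 ^ k * t := (le_max_left _ _).trans (ht.trans
      (le_mul_of_one_le_left ht0.le (one_le_pow₀ one_le_two)))
    have := (div_le_iff₀ (tail_pos h2 _)).1 (ht₁ _ hk).le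
    rw [pow_succ', mul_assoc, pow_succ', mul_assoc]
    exact this.trans (mul_le_mul_of_nonneg_left ih (by positivity))

/-- Potter bound: along halvings, as long as the level stays above `t₀`, the tail grows at most like
`2 ^ β`, for any `β > α`. -/
lemma tail_lower (h2 : Tendsto
    (fun t => μ.real {ω | 2 * t < ξ ω} / μ.real {ω | t < ξ ω}) atTop (𝓝 ((2 : ℝ) ^ (-α))))
    {β : ℝ} (hβ : α < β) :
    ∃ t₀ : ℝ, 0 < t₀ ∧ ∀ (k : ℕ) (b : ℝ), t₀ ≤ b * (1 / 2) ^ k →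
      μ.real {ω | b * (1 / 2) ^ k < ξ ω} ≤ ((2 : ℝ) ^ β) ^ k * μ.real {ω | b < ξ ω} := by
  have hlt : (2 : ℝ) ^ (-β) < 2 ^ (-α) := Real.rpow_lt_rpow_of_exponent_lt one_lt_two (by linarith)
  obtain ⟨t₁, ht₁⟩ := eventually_atTop.1 (h2.eventually (lt_mem_nhds hlt))
  refine ⟨max t₁ 1, by positivity, fun k => ?_⟩
  induction k with
  | zero => simp
  | succ k ih =>
    intro b hb
    have hpos : 0 < b * (1 / 2 : ℝ) ^ (k + 1) := lt_of_lt_of_le (by positivity) hb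
    have he : 2 * (b * (1 / 2 : ℝ) ^ (k + 1)) = b * (1 / 2) ^ k := by ring
    have h3 := (lt_div_iff₀ (tail_pos h2 _)).1 (ht₁ _ ((le_max_left _ _).trans hb))
    rw [he, Real.rpow_neg two_pos.le, inv_mul_lt_iff₀ (by positivity)] at h3
    rw [pow_succ' ((2 : ℝ) ^ β), mul_assoc]
    refine h3.le.trans (mul_le_mul_of_nonneg_left (ih b (hb.trans ?_)) (by positivity))
    linarith

/-- For tail index `α > 1`, the mean of the part above a level `b` is of order `b` times the tail
at `b`. -/
lemma lintegral_above_le (h2 : Tendsto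
    (fun t => μ.real {ω | 2 * t < ξ ω} / μ.real {ω | t < ξ ω}) atTop (𝓝 ((2 : ℝ) ^ (-α))))
    (hα : 1 < α) (hξ : Measurable ξ) :
    ∃ C t₀ : ℝ, 0 ≤ C ∧ 0 < t₀ ∧ ∀ b, t₀ ≤ b →
      ∫⁻ ω in {ω | b < ξ ω}, ENNReal.ofReal (ξ ω) ∂μ ≤
        ENNReal.ofReal (C * b * μ.real {ω | b < ξ ω}) := by
  obtain ⟨β, hβ1, hβα⟩ := exists_between hα
  obtain ⟨t₀, ht₀, ht⟩ := tail_upper h2 hβα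
  set r : ℝ := 2 * 2 ^ (-β) with hr
  have hr0 : 0 ≤ r := by positivity
  have hr1 : r < 1 := by
    rw [hr, ← Real.rpow_one_add' two_pos.le (by linarith)]
    exact Real.rpow_lt_one_of_one_lt_of_neg one_lt_two (by linarith)
  have hsum : Summable fun k : ℕ => 2 * r ^ k :=
    (summable_geometric_of_lt_one hr0 hr1).mul_left _
  refine ⟨∑' k : ℕ, 2 * r ^ k, t₀, tsum_nonneg fun k => by positivity, ht₀, fun b hb => ?_⟩
  have hb0 : 0 < b := ht₀.trans_le hb
  have hms : ∀ t : ℝ, MeasurableSet {ω | t < ξ ω} := fun t => measurableSet_lt measurable_const hξ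
  calc ∫⁻ ω in {ω | b < ξ ω}, ENNReal.ofReal (ξ ω) ∂μ
      ≤ ∫⁻ ω, ∑' k : ℕ, {ω | 2 ^ k * b < ξ ω}.indicator
          (fun _ => ENNReal.ofReal (2 * 2 ^ k * b)) ω ∂μ := by
        rw [← lintegral_indicator (hms b)]
        refine lintegral_mono fun ω => ?_
        by_cases hω : b < ξ ω
        · rw [indicator_of_mem (by exact hω)]
          -- the last dyadic multiple of `b` below `ξ ω`
          obtain ⟨k, hk1, hk2⟩ : ∃ k : ℕ, 2 ^ k * b < ξ ω ∧ ξ ω ≤ 2 * 2 ^ k * b := by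
            have hex : ∃ k : ℕ, ξ ω ≤ 2 ^ (k + 1) * b := by
              obtain ⟨k, hk⟩ := pow_unbounded_of_one_lt (ξ ω / b) (one_lt_two (α := ℝ))
              refine ⟨k, ?_⟩
              rw [div_lt_iff₀ hb0] at hk
              refine hk.le.trans (mul_le_mul_of_nonneg_right ?_ hb0.le)
              exact pow_le_pow_right₀ one_le_two k.le_succ
            classical
            refine ⟨Nat.find hex, ?_, by rw [← pow_succ']; exact Nat.find_spec hex⟩
            rcases hf : Nat.find hex with _ | k
            · simpa using hω
            · exact not_le.1 (Nat.find_min hex (m := k) (by omega))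
          refine le_trans ?_ (ENNReal.le_tsum k)
          rw [indicator_of_mem (by exact hk1)]
          exact ENNReal.ofReal_le_ofReal hk2
        · rw [indicator_of_notMem (by exact hω)]; exact zero_le
    _ = ∑' k : ℕ, ENNReal.ofReal (2 * 2 ^ k * b) * μ {ω | 2 ^ k * b < ξ ω} := by
        rw [lintegral_tsum fun k => (measurable_const.indicator (hms _)).aemeasurable]
        simp_rw [lintegral_indicator_const (hms _)]
    _ ≤ ∑' k : ℕ, ENNReal.ofReal (2 * r ^ k * (b * μ.real {ω | b < ξ ω})) := by
        refine ENNReal.tsum_le_tsum fun k => ?_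
        rw [← ofReal_measureReal (by finiteness), ← ENNReal.ofReal_mul (by positivity)]
        refine ENNReal.ofReal_le_ofReal ?_
        refine (mul_le_mul_of_nonneg_left (ht b hb k) (by positivity)).trans (le_of_eq ?_)
        rw [hr, mul_pow]; ring
    _ = _ := by
        rw [← ENNReal.ofReal_tsum_of_nonneg (fun k => by positivity) (hsum.mul_right _),
          tsum_mul_right, mul_assoc]

/-- Above the tail index `α`, the truncated moment of order `q` at level `b` is of order `b ^ q`
times the tail at `b`. -/
lemma lintegral_below_le (h2 : Tendsto
    (fun t => μ.real {ω | 2 * t < ξ ω} / μ.real {ω | t < ξ ω}) atTop (𝓝 ((2 : ℝ) ^ (-α))))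
    {q : ℝ} (hα0 : 0 < α) (hq : α < q) (hξ : Measurable ξ)
    (hξ0 : ∀ ω, 0 < ξ ω) [IsProbabilityMeasure μ] :
    ∃ C t₀ : ℝ, 0 ≤ C ∧ 0 < t₀ ∧ ∀ b, t₀ ≤ b →
      ∫⁻ ω in {ω | ξ ω ≤ b}, ENNReal.ofReal (ξ ω ^ q) ∂μ ≤
        ENNReal.ofReal (C * b ^ q * μ.real {ω | b < ξ ω}) := by
  obtain ⟨β, hβα, hβq⟩ := exists_between hq
  obtain ⟨t₀, ht₀, ht⟩ := tail_lower h2 hβα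
  have hq0 : 0 < q := hα0.trans hq
  set r : ℝ := (1 / 2) ^ q * 2 ^ β with hr
  have hr0 : 0 ≤ r := by positivity
  have hr1 : r < 1 := by
    rw [hr, one_div, Real.inv_rpow two_pos.le, ← Real.rpow_neg two_pos.le,
      ← Real.rpow_add two_pos]
    exact Real.rpow_lt_one_of_one_lt_of_neg one_lt_two (by linarith)
  have hsum : Summable fun k : ℕ => 2 ^ β * r ^ k :=
    (summable_geometric_of_lt_one hr0 hr1).mul_left _
  set S : ℝ := ∑' k : ℕ, 2 ^ β * r ^ k with hS
  have hS0 : 0 ≤ S := tsum_nonneg fun k => by positivity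
  set g₀ := μ.real {ω | 2 * t₀ < ξ ω} with hg₀
  have hg₀pos : 0 < g₀ := tail_pos h2 _
  refine ⟨S + 2 ^ q / g₀, t₀, by positivity, ht₀, fun b hb => ?_⟩
  have hb0 : 0 < b := ht₀.trans_le hb
  have hms : ∀ t : ℝ, MeasurableSet {ω | t < ξ ω} := fun t => measurableSet_lt measurable_const hξ
  set G := μ.real {ω | b < ξ ω} with hG
  have hpowk : ∀ k : ℕ, (b * (1 / 2 : ℝ) ^ k) ^ q = b ^ q * ((1 / 2 : ℝ) ^ q) ^ k := fun k => by
    rw [Real.mul_rpow hb0.le (by positivity), ← Real.rpow_natCast, ← Real.rpow_natCast,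
      ← Real.rpow_mul (by norm_num), ← Real.rpow_mul (by norm_num), mul_comm (k : ℝ)]
  -- a lower bound for the tail at `b`, needed to absorb the contribution of small values
  have hlow : (2 * t₀) ^ q ≤ 2 ^ q / g₀ * b ^ q * G := by
    obtain ⟨k, hk1, hk2⟩ := exists_dyadic_scale (L := b) (u := 2 * t₀) (by positivity)
      (by linarith)
    have hk2' : t₀ ≤ b * (1 / 2) ^ k := by linarith
    have hk1' : b * (1 / 2 : ℝ) ^ k ≤ 2 * t₀ := by
      have : 2 * (b * (1 / 2 : ℝ) ^ (k + 1)) = b * (1 / 2) ^ k := by ring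
      linarith
    have h4 : g₀ ≤ ((2 : ℝ) ^ β) ^ k * G := (tail_antitone hk1').trans (ht k b hk2')
    have h5 : t₀ ^ q ≤ b ^ q * ((1 / 2 : ℝ) ^ q) ^ k := by
      rw [← hpowk]; exact Real.rpow_le_rpow ht₀.le hk2' hq0.le
    have h6 : t₀ ^ q * g₀ ≤ b ^ q * G := by
      calc t₀ ^ q * g₀ ≤ (b ^ q * ((1 / 2 : ℝ) ^ q) ^ k) * (((2 : ℝ) ^ β) ^ k * G) :=
            mul_le_mul h5 h4 hg₀pos.le (by positivity)
        _ = b ^ q * G * r ^ k := by rw [hr, mul_pow]; ring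
        _ ≤ b ^ q * G := mul_le_of_le_one_right (by positivity) (pow_le_one₀ hr0 hr1.le)
    rw [Real.mul_rpow two_pos.le ht₀.le, div_mul_eq_mul_div, div_mul_eq_mul_div,
      le_div_iff₀ hg₀pos, mul_assoc, mul_assoc]
    exact mul_le_mul_of_nonneg_left h6 (by positivity)
  calc ∫⁻ ω in {ω | ξ ω ≤ b}, ENNReal.ofReal (ξ ω ^ q) ∂μ
      ≤ ∫⁻ ω, ((∑' k : ℕ, if t₀ ≤ b * (1 / 2) ^ (k + 1) then
          {ω | b * (1 / 2) ^ (k + 1) < ξ ω}.indicator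
          (fun _ => ENNReal.ofReal ((b * (1 / 2) ^ k) ^ q)) ω else 0) +
          ENNReal.ofReal ((2 * t₀) ^ q)) ∂μ := by
        rw [← lintegral_indicator (measurableSet_le hξ measurable_const)]
        refine lintegral_mono fun ω => ?_
        by_cases hω : ξ ω ≤ b
        · rw [indicator_of_mem (by exact hω)]
          obtain ⟨k, hk1, hk2⟩ := exists_dyadic_scale (L := b) (u := 2 * ξ ω)
            (by have := hξ0 ω; positivity) (by linarith)
          have hk1' : b * (1 / 2) ^ (k + 1) < ξ ω := by linarith
          have hk2' : ξ ω ≤ b * (1 / 2) ^ k := by linarith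
          by_cases hc : t₀ ≤ b * (1 / 2) ^ (k + 1)
          · refine le_trans ?_ (le_add_right (ENNReal.le_tsum k))
            rw [if_pos hc, indicator_of_mem (by exact hk1')]
            exact ENNReal.ofReal_le_ofReal (Real.rpow_le_rpow (hξ0 ω).le hk2' hq0.le)
          · refine le_trans (ENNReal.ofReal_le_ofReal
              (Real.rpow_le_rpow (hξ0 ω).le ?_ hq0.le)) le_add_self
            have : 2 * (b * (1 / 2 : ℝ) ^ (k + 1)) = b * (1 / 2) ^ k := by ring
            linarith [not_le.1 hc]
        · rw [indicator_of_notMem (by exact hω)]; exact zero_le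
    _ = (∑' k : ℕ, if t₀ ≤ b * (1 / 2) ^ (k + 1) then
          ENNReal.ofReal ((b * (1 / 2) ^ k) ^ q) * μ {ω | b * (1 / 2) ^ (k + 1) < ξ ω} else 0) +
          ENNReal.ofReal ((2 * t₀) ^ q) := by
        rw [lintegral_add_right _ measurable_const, lintegral_const, measure_univ, mul_one,
          lintegral_tsum]
        · congr 1
          refine tsum_congr fun k => ?_
          split_ifs
          · rw [lintegral_indicator_const (hms _)]
          · simp
        · intro k
          split_ifs
          · exact (measurable_const.indicator (hms _)).aemeasurable
          · exact aemeasurable_const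
    _ ≤ (∑' k : ℕ, ENNReal.ofReal (2 ^ β * r ^ k * (b ^ q * G))) +
          ENNReal.ofReal (2 ^ q / g₀ * b ^ q * G) := by
        refine add_le_add (ENNReal.tsum_le_tsum fun k => ?_) (ENNReal.ofReal_le_ofReal hlow)
        split_ifs with hc
        · rw [← ofReal_measureReal (by finiteness), ← ENNReal.ofReal_mul (by positivity)]
          refine ENNReal.ofReal_le_ofReal ?_
          refine (mul_le_mul_of_nonneg_left (ht (k + 1) b hc) (by positivity)).trans (le_of_eq ?_)
          rw [hpowk, hr, mul_pow]; ring
        · exact zero_le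
    _ = _ := by
        rw [← ENNReal.ofReal_tsum_of_nonneg (fun k => by positivity) (hsum.mul_right _),
          tsum_mul_right, ← ENNReal.ofReal_add (by positivity) (by positivity)]
        congr 1; ring

lemma tendsto_atTop_of_tail (hpos : ∀ t : ℝ, 0 < μ.real {ω | t < ξ ω}) {b : ℕ → ℝ}
    (hb : Tendsto (fun n : ℕ => (n : ℝ) * μ.real {ω | b n < ξ ω}) atTop (𝓝 1)) :
    Tendsto b atTop atTop := by
  refine tendsto_atTop.2 fun T => ?_
  have h1 := hb.eventually (gt_mem_nhds (one_lt_two (α := ℝ)))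
  have h3 := tendsto_natCast_atTop_atTop (R := ℝ) |>.eventually
    (eventually_ge_atTop (2 / μ.real {ω | T < ξ ω}))
  filter_upwards [h1, h3] with n h1 h3
  by_contra hc
  have h4 : μ.real {ω | T < ξ ω} ≤ μ.real {ω | b n < ξ ω} := tail_antitone (not_le.1 hc).le
  rw [div_le_iff₀ (hpos T)] at h3
  have := mul_le_mul_of_nonneg_left h4 (Nat.cast_nonneg (α := ℝ) n)
  linarith

end RegularVariation

/-! ### Decomposing a path into excursions -/

section Excursions

variable {T : ℕ → ℕ}

/-- The index of the excursion `[T k, T (k + 1))` that contains the time `m`. -/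
def excursionIndex (T : ℕ → ℕ) (m : ℕ) : ℕ := Nat.findGreatest (fun k => T k ≤ m) m

lemma excursionIndex_le (m : ℕ) : excursionIndex T m ≤ m := Nat.findGreatest_le m

lemma apply_excursionIndex_le (h0 : T 0 = 0) (m : ℕ) : T (excursionIndex T m) ≤ m :=
  Nat.findGreatest_spec (P := fun k => T k ≤ m) m.zero_le (by simp [h0])

lemma lt_apply_excursionIndex_succ (hT : StrictMono T) (m : ℕ) :
    m < T (excursionIndex T m + 1) := by
  by_contra hc
  have h1 : excursionIndex T m + 1 ≤ m := (hT.le_apply).trans (not_lt.1 hc)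
  exact Nat.findGreatest_is_greatest (P := fun k => T k ≤ m) (Nat.lt_succ_self _) h1 (not_lt.1 hc)

lemma excursionIndex_eq (h0 : T 0 = 0) (hT : StrictMono T) {k m : ℕ} (h1 : T k ≤ m)
    (h2 : m < T (k + 1)) : excursionIndex T m = k := by
  have h3 := hT.lt_iff_lt.1 (h1.trans_lt (lt_apply_excursionIndex_succ hT m))
  have h4 := hT.lt_iff_lt.1 ((apply_excursionIndex_le h0 m).trans_lt h2)
  omega

lemma excursionIndex_mono (h0 : T 0 = 0) (hT : StrictMono T) : Monotone (excursionIndex T) :=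
  fun s t hst => by
    have := hT.lt_iff_lt.1 (((apply_excursionIndex_le h0 s).trans hst).trans_lt
      (lt_apply_excursionIndex_succ hT t))
    omega

lemma edist_le_mul_of_step {E : Type*} [PseudoEMetricSpace E] {x : ℕ → E} {B : ℝ≥0∞}
    (hB : ∀ m, edist (x (m + 1)) (x m) ≤ B) {s t : ℕ} (hst : s ≤ t) :
    edist (x t) (x s) ≤ ((t - s : ℕ) : ℝ≥0∞) * B := by
  rw [edist_comm]
  refine (edist_le_Ico_sum_edist x hst).trans ((Finset.sum_le_card_nsmul _ _ B fun m _ => ?_).trans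
    (le_of_eq (by simp [nsmul_eq_mul])))
  rw [edist_comm]; exact hB m

/-- The `p`-variation of a path with steps bounded by `B` is controlled by the `p`-variation of
the path sampled at the times `T k` and by the lengths of the excursions in between. -/
lemma discreteVar_le_sampled {E : Type*} [PseudoEMetricSpace E] {p : ℝ} (hp : 1 ≤ p)
    (h0 : T 0 = 0) (hT : StrictMono T) {x : ℕ → E} {B : ℝ≥0∞}
    (hB : ∀ m, edist (x (m + 1)) (x m) ≤ B) (n : ℕ) :
    discreteVar p n x ≤ 3 ^ (p - 1) * (discreteVar p n (fun k => x (T k)) +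
      2 * B ^ p * ∑ k ∈ Finset.range n, ((T (k + 1) - T k : ℕ) : ℝ≥0∞) ^ p) := by
  have hp0 : 0 < p := by linarith
  set κ := excursionIndex T with hκ
  set ℓ : ℕ → ℝ≥0∞ := fun k => ((T (k + 1) - T k : ℕ) : ℝ≥0∞) with hℓ
  -- the second summand pays for the loss incurred when the excursion is left
  set w : ℕ → ℝ≥0∞ := fun m => B ^ p * ℓ (κ m) ^ (p - 1) +
    (if m + 1 = T (κ m + 1) then B ^ p * ℓ (κ m) ^ p else 0) with hw
  have hpp : ∀ a : ℝ≥0∞, a ≠ ∞ → a * a ^ (p - 1) = a ^ p := fun a ha => by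
    rcases eq_or_ne a 0 with rfl | h
    · simp [hp0]
    · nth_rw 1 [← ENNReal.rpow_one a]
      rw [← ENNReal.rpow_add _ _ h ha]; congr 1; ring
  have hinside : ∀ k s t, T k ≤ s → s ≤ t → t ≤ T (k + 1) →
      edist (x t) (x s) ^ p ≤ ∑ m ∈ Finset.Ico s t, w m := by
    intro k s t hs hst ht
    calc edist (x t) (x s) ^ p ≤ (((t - s : ℕ) : ℝ≥0∞) * B) ^ p :=
          ENNReal.rpow_le_rpow (edist_le_mul_of_step hB hst) hp0.le
      _ = ((t - s : ℕ) : ℝ≥0∞) * (B ^ p * ((t - s : ℕ) : ℝ≥0∞) ^ (p - 1)) := by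
          rw [ENNReal.mul_rpow_of_nonneg _ _ hp0.le, ← hpp _ (ENNReal.natCast_ne_top _)]; ring
      _ ≤ ((t - s : ℕ) : ℝ≥0∞) * (B ^ p * ℓ k ^ (p - 1)) := by
          gcongr
          exact Nat.cast_le.2 (show t - s ≤ T (k + 1) - T k by omega)
      _ = ∑ m ∈ Finset.Ico s t, B ^ p * ℓ k ^ (p - 1) := by simp [nsmul_eq_mul]
      _ ≤ _ := Finset.sum_le_sum fun m hm => by
          have hm := Finset.mem_Ico.1 hm
          have : κ m = k := excursionIndex_eq h0 hT (by omega) (by omega)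
          simp only [hw, this]
          exact le_self_add
  have hpair : ∀ s t, s ≤ t → t ≤ n → edist (x t) (x s) ^ p ≤ 3 ^ (p - 1) *
      (edist (x (T (κ t))) (x (T (κ s))) ^ p + ∑ m ∈ Finset.Ico s t, w m) := by
    intro s t hst _
    have hs1 : T (κ s) ≤ s := apply_excursionIndex_le h0 s
    have hs2 : s < T (κ s + 1) := lt_apply_excursionIndex_succ hT s
    have ht1 : T (κ t) ≤ t := apply_excursionIndex_le h0 t
    have ht2 : t < T (κ t + 1) := lt_apply_excursionIndex_succ hT t
    rcases (excursionIndex_mono h0 hT hst).eq_or_lt with he | hlt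
    · have h1 := hinside (κ s) s t hs1 hst (by rw [← hκ] at he; rw [he]; exact ht2.le)
      refine h1.trans (le_add_self.trans (le_mul_of_one_le_left zero_le ?_))
      simpa using ENNReal.rpow_le_rpow (show (1 : ℝ≥0∞) ≤ 3 by norm_num)
        (show 0 ≤ p - 1 by linarith)
    · have hle : T (κ s + 1) ≤ T (κ t) := hT.monotone hlt
      have hA : edist (x t) (x (T (κ t))) ^ p ≤ ∑ m ∈ Finset.Ico (T (κ t)) t, w m :=
        hinside (κ t) _ _ le_rfl ht1 ht2.le
      have hC : edist (x (T (κ s))) (x s) ^ p ≤ ∑ m ∈ Finset.Ico s (T (κ t)), w m := by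
        have hm : κ (T (κ s + 1) - 1) = κ s := excursionIndex_eq h0 hT (by omega) (by omega)
        refine le_trans ?_ (Finset.single_le_sum (f := w) (fun _ _ => zero_le)
          (Finset.mem_Ico.2 ⟨Nat.le_sub_one_of_lt hs2, by omega⟩ :
            T (κ s + 1) - 1 ∈ Finset.Ico s (T (κ t))))
        simp only [hw, hm]
        rw [if_pos (by omega)]
        refine le_trans ?_ le_add_self
        rw [edist_comm, ← ENNReal.mul_rpow_of_nonneg _ _ hp0.le]
        refine ENNReal.rpow_le_rpow ((edist_le_mul_of_step hB hs1).trans ?_) hp0.le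
        rw [mul_comm]
        gcongr
        exact Nat.cast_le.2 (show s - T (κ s) ≤ T (κ s + 1) - T (κ s) by omega)
      have htri : edist (x t) (x s) ≤ ∑ i : Fin 3, ![edist (x t) (x (T (κ t))),
          edist (x (T (κ t))) (x (T (κ s))), edist (x (T (κ s))) (x s)] i := by
        simpa [Fin.sum_univ_three] using edist_triangle4 (x t) (x (T (κ t))) (x (T (κ s))) (x s)
      refine (ENNReal.rpow_le_rpow htri hp0.le).trans
        ((ENNReal.rpow_sum_le_const_mul_sum_rpow _ _ hp).trans ?_)
      simp only [Finset.card_univ, Fintype.card_fin, Nat.cast_ofNat, Fin.sum_univ_three,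
        Matrix.cons_val_zero, Matrix.cons_val_one, Matrix.cons_val]
      refine mul_le_mul_right ?_ _
      rw [← Finset.sum_Ico_consecutive w (hs2.le.trans hle) ht1, add_comm (edist (x t) _ ^ p),
        add_assoc, add_comm (∑ m ∈ Finset.Ico s _, w m)]
      exact add_le_add le_rfl (add_le_add hA hC)
  have hsum : ∑ m ∈ Finset.range n, w m ≤ 2 * B ^ p * ∑ k ∈ Finset.range n, ℓ k ^ p := by
    have h1 : ∑ m ∈ Finset.range n, w m ≤ ∑ m ∈ Finset.Ico (T 0) (T n), w m := by
      rw [h0, Nat.Ico_zero_eq_range]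
      exact Finset.sum_le_sum_of_subset (Finset.range_mono hT.le_apply)
    rw [← sum_sum_Ico_chain w hT.monotone n] at h1
    refine h1.trans ?_
    rw [Finset.mul_sum]
    refine Finset.sum_le_sum fun k _ => ?_
    have hk : ∀ m ∈ Finset.Ico (T k) (T (k + 1)), w m = B ^ p * ℓ k ^ (p - 1) +
        (if m = T (k + 1) - 1 then B ^ p * ℓ k ^ p else 0) := by
      intro m hm
      have hm := Finset.mem_Ico.1 hm
      have : κ m = k := excursionIndex_eq h0 hT hm.1 hm.2
      simp only [hw, this]
      congr 1
      exact if_congr (by omega) rfl rfl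
    have hlt : T k < T (k + 1) := hT k.lt_succ_self
    rw [Finset.sum_congr rfl hk, Finset.sum_add_distrib, Finset.sum_ite_eq',
      if_pos (Finset.mem_Ico.2 ⟨by omega, by omega⟩), Finset.sum_const, Nat.card_Ico,
      nsmul_eq_mul]
    change ℓ k * (B ^ p * ℓ k ^ (p - 1)) + _ ≤ _
    rw [mul_left_comm, hpp _ (ENNReal.natCast_ne_top _), two_mul, add_mul]
  refine (chainSup_mono hpair).trans ((chainSup_const_mul_le _ _ _).trans
    (mul_le_mul_right ((chainSup_add_le _ _ _).trans (add_le_add ?_ ?_)) _))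
  · exact chainSup_comp_le (excursionIndex_mono h0 hT) (excursionIndex_le n)
      (fun s t => edist (x (T t)) (x (T s)) ^ p)
  · exact (chainSup_sum_le _ _).trans hsum

end Excursions

/-! ### Distortion on cylinders -/

/-- The cylinder of length `k` with itinerary `c`: the points `x` such that
`F^i x ∈ c i` for all `i < k`. -/
def dynCylinder {X : Type*} (F : X → X) (c : ℕ → Set X) (k : ℕ) : Set X :=
  {x | ∀ i < k, F^[i] x ∈ c i}

/-- The measure-theoretic content of the Gibbs–Markov property, with no reference to the metric:
the branches of `F` distort `ν` by at most `exp (K₀ * γ ^ k)` on cylinders of length `k ≥ 1`, and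
push `ν` on a partition element to a measure with density bounded by `D` times its mass. -/
structure HasCylinderDistortion {X : Type*} [MeasurableSpace X] (ν : Measure X) (F : X → X)
    (𝒜 : Set (Set X)) (γ K₀ : ℝ) (D : ℝ≥0) : Prop where
  one_step : ∀ a ∈ 𝒜, ∀ k, 1 ≤ k → ∀ c : ℕ → Set X, (∀ i, c i ∈ 𝒜) →
    ∀ E E', E ⊆ dynCylinder F c k → E' ⊆ dynCylinder F c k → MeasurableSet E → MeasurableSet E' →
      ν (a ∩ F ⁻¹' E) * ν E' ≤
        ENNReal.ofReal (Real.exp (K₀ * γ ^ k)) * (ν (a ∩ F ⁻¹' E') * ν E)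
  bounded : ∀ a ∈ 𝒜, ∀ E, MeasurableSet E → ν (a ∩ F ⁻¹' E) ≤ D * ν a * ν E

/-- `ρ` has log-Hölder density with respect to `ν`, in the sense of cylinders: on a cylinder of
length `k ≥ 1` the density varies at most by the factor `exp (K * γ ^ k)`. The condition is stated
through measures of sets, so that no version of the density has to be chosen. -/
structure IsCylinderRegular {X : Type*} [MeasurableSpace X] (ν : Measure X) (F : X → X)
    (𝒜 : Set (Set X)) (γ K : ℝ) (ρ : Measure X) : Prop where
  ac : ρ ≪ ν
  regular : ∀ k, 1 ≤ k → ∀ c : ℕ → Set X, (∀ i, c i ∈ 𝒜) →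
    ∀ E E', E ⊆ dynCylinder F c k → E' ⊆ dynCylinder F c k → MeasurableSet E → MeasurableSet E' →
      ρ E * ν E' ≤ ENNReal.ofReal (Real.exp (K * γ ^ k)) * (ρ E' * ν E)

section Cylinders

variable {X : Type*} {F : X → X}

lemma cylinder_subset_zero {c : ℕ → Set X} {k : ℕ} (hk : 1 ≤ k) : dynCylinder F c k ⊆ c 0 :=
  fun _ hx => hx 0 hk

lemma image_mem_cylinder {c : ℕ → Set X} {k : ℕ} {x : X} (hx : x ∈ dynCylinder F c (k + 1)) :
    F x ∈ dynCylinder F (fun i => c (i + 1)) k := fun i hi => by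
  simpa [Function.iterate_succ_apply] using hx (i + 1) (by omega)

lemma iterate_mem_cylinder {c : ℕ → Set X} {j k : ℕ} {x : X} (hx : x ∈ dynCylinder F c (j + k)) :
    F^[j] x ∈ dynCylinder F (fun i => c (i + j)) k := fun i hi => by
  rw [← Function.iterate_add_apply]; exact hx (i + j) (by omega)

lemma inter_preimage_cylinder (a : Set X) (c : ℕ → Set X) (k : ℕ) :
    a ∩ F ⁻¹' dynCylinder F c k = dynCylinder F (fun i => Nat.casesOn i a c) (k + 1) := by
  ext x
  constructor
  · rintro ⟨hx, hF⟩ i hi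
    cases i with
    | zero => exact hx
    | succ i => simpa [Function.iterate_succ_apply] using hF i (by omega)
  · intro hx
    exact ⟨hx 0 k.succ_pos, image_mem_cylinder hx⟩

lemma measurableSet_cylinder [MeasurableSpace X] (hF : Measurable F) {c : ℕ → Set X}
    (hc : ∀ i, MeasurableSet (c i)) (k : ℕ) : MeasurableSet (dynCylinder F c k) := by
  have : dynCylinder F c k = ⋂ i, ⋂ (_ : i < k), F^[i] ⁻¹' c i := by
    ext x; simp [dynCylinder]
  rw [this]
  exact MeasurableSet.iInter fun i => MeasurableSet.iInter fun _ => hF.iterate i (hc i)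

lemma dist_le_of_mem_cylinder [MetricSpace X] {𝒜 : Set (Set X)} {lam R : ℝ} (hl : 1 < lam)
    (hexp : ∀ a ∈ 𝒜, ∀ z ∈ a, ∀ z' ∈ a, lam * dist z z' ≤ dist (F z) (F z'))
    (hR : ∀ x y : X, dist x y ≤ R) (k : ℕ) :
    ∀ c : ℕ → Set X, (∀ i, c i ∈ 𝒜) → ∀ x ∈ dynCylinder F c k, ∀ y ∈ dynCylinder F c k,
      dist x y ≤ (lam⁻¹) ^ k * R := by
  induction k with
  | zero => intro c _ x _ y _; simpa using hR x y
  | succ k ih =>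
    intro c hc x hx y hy
    have h1 := ih _ (fun i => hc (i + 1)) _ (image_mem_cylinder hx) _ (image_mem_cylinder hy)
    have h2 := hexp (c 0) (hc 0) x (hx 0 k.succ_pos) y (hy 0 k.succ_pos)
    have h3 : dist x y ≤ lam⁻¹ * dist (F x) (F y) := by
      rw [le_inv_mul_iff₀ (by linarith)]; exact h2
    calc dist x y ≤ lam⁻¹ * ((lam⁻¹) ^ k * R) :=
          h3.trans (mul_le_mul_of_nonneg_left h1 (by positivity))
      _ = _ := by rw [pow_succ']; ring

end Cylinders

/-- Bounded distortion of a branch in integrated form. The density is not assumed measurable. -/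
lemma measure_mul_image_le {X : Type*} [MeasurableSpace X] {ν : Measure X}
    [IsFiniteMeasure ν] {F : X → X} {ζ : X → ℝ} {a B B' : Set X}
    (hζ : ∀ z ∈ a, 0 < ζ z)
    (hint : ∀ E ⊆ a, MeasurableSet E → ν (F '' E) = ∫⁻ z in E, ENNReal.ofReal (ζ z)⁻¹ ∂ν)
    (hB : B ⊆ a) (hB' : B' ⊆ a) (hBm : MeasurableSet B) (hBm' : MeasurableSet B') {s : ℝ}
    (hs : ∀ z ∈ B, ∀ z' ∈ B', |Real.log (ζ z) - Real.log (ζ z')| ≤ s) :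
    ν B * ν (F '' B') ≤ ENNReal.ofReal (Real.exp s) * (ν (F '' B) * ν B') := by
  have hpt : ∀ z ∈ B, ν (F '' B') ≤
      ENNReal.ofReal (Real.exp s) * ν B' * ENNReal.ofReal (ζ z)⁻¹ := by
    intro z hz
    rw [hint B' hB' hBm']
    refine (setLIntegral_mono' (g := fun _ =>
      ENNReal.ofReal (Real.exp s) * ENNReal.ofReal (ζ z)⁻¹) hBm' fun z' hz' => ?_).trans
      (le_of_eq ?_)
    · rw [← ENNReal.ofReal_mul (Real.exp_nonneg s)]
      refine ENNReal.ofReal_le_ofReal ?_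
      have h1 := hζ z (hB hz)
      have h2 := hζ z' (hB' hz')
      have h3 : Real.log (ζ z) ≤ s + Real.log (ζ z') := by
        linarith [(abs_le.1 (hs z hz z' hz')).2]
      have h4 : ζ z ≤ Real.exp s * ζ z' := by
        have := Real.exp_le_exp.2 h3
        rwa [Real.exp_add, Real.exp_log h1, Real.exp_log h2] at this
      rw [← div_eq_mul_inv, le_div_iff₀ h1, inv_mul_le_iff₀ h2, mul_comm]
      exact h4
    · rw [setLIntegral_const]; ring
  calc ν B * ν (F '' B') = ∫⁻ _ in B, ν (F '' B') ∂ν := by rw [setLIntegral_const, mul_comm]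
    _ ≤ ∫⁻ z in B, ENNReal.ofReal (Real.exp s) * ν B' * ENNReal.ofReal (ζ z)⁻¹ ∂ν :=
        setLIntegral_mono' hBm hpt
    _ ≤ ENNReal.ofReal (Real.exp s) * ν B' * ∫⁻ z in B, ENNReal.ofReal (ζ z)⁻¹ ∂ν := by
        rw [lintegral_const_mul' _ _ (by finiteness)]
    _ = _ := by rw [hint B hB hBm]; ring

/-- Expansion turns the Hölder condition on the inverse Jacobian into exponentially small distortion
on cylinders, and big images bound the densities of the branches. -/
lemma IsGibbsMarkov.exists_hasCylinderDistortion {X : Type*} [MetricSpace X] [BoundedSpace X]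
    [MeasurableSpace X] {ν : Measure X} [IsFiniteMeasure ν] {𝒜 : Set (Set X)} {F : X → X}
    (h : IsGibbsMarkov ν 𝒜 F) :
    ∃ (γ K₀ : ℝ) (D : ℝ≥0), 0 < γ ∧ γ < 1 ∧ 0 ≤ K₀ ∧ HasCylinderDistortion ν F 𝒜 γ K₀ D := by
  obtain ⟨lam, hl, hexp⟩ := h.expanding
  obtain ⟨ζ, K, θ, hK, hθ, -, hζ⟩ := h.distortion
  obtain ⟨c₀, hc₀, hbig⟩ := h.big_images
  have hF : Measurable F := h.quasiErgodic.measurable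
  obtain ⟨R, hR0, hR⟩ : ∃ R : ℝ, 0 < R ∧ ∀ x y : X, dist x y ≤ R := by
    obtain ⟨R, hR⟩ := Metric.isBounded_iff.1 (BoundedSpace.bounded_univ (α := X))
    exact ⟨max R 1, by positivity, fun x y => (hR (mem_univ x) (mem_univ y)).trans
      (le_max_left _ _)⟩
  have hl0 : 0 < lam := by linarith
  have himg : ∀ (a E : Set X), F '' (a ∩ F ⁻¹' E) = F '' a ∩ E := fun a E =>
    image_inter_preimage F a E
  have hglob : ∀ a ∈ 𝒜, ∀ E, MeasurableSet E → ν (a ∩ F ⁻¹' E) * ν (F '' a) ≤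
      ENNReal.ofReal (Real.exp (K * R ^ θ)) * (ν (F '' a ∩ E) * ν a) := by
    intro a ha E hE
    have ham := h.partition.measurableSet a ha
    rw [← himg]
    refine measure_mul_image_le (hζ a ha).1 (hζ a ha).2.1 inter_subset_left subset_rfl
      (ham.inter (hF hE)) ham fun z hz z' hz' => ((hζ a ha).2.2 z hz.1 z' hz').trans ?_
    exact mul_le_mul_of_nonneg_left (Real.rpow_le_rpow dist_nonneg (hR _ _) hθ.le) hK.le
  refine ⟨lam ^ (-θ), K * R ^ θ,
    (ENNReal.ofReal (Real.exp (K * R ^ θ)) / min c₀ 1).toNNReal, by positivity,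
    Real.rpow_lt_one_of_one_lt_of_neg hl (by linarith), by positivity, ?_, ?_⟩
  · intro a ha k hk c hc E E' hE hE' hEm hEm'
    have ham := h.partition.measurableSet a ha
    obtain ⟨ℬ, hℬ, hae⟩ := h.image_union a ha
    by_cases hc0 : c 0 ∈ ℬ
    · -- the cylinder lies in the image of `a`
      have h1 : ν (F '' a ∩ E') = ν E' := by
        refine measure_congr ?_
        have h2 : (⋃₀ ℬ ∩ E' : Set X) = E' := inter_eq_right.2
          ((hE'.trans (cylinder_subset_zero hk)).trans (subset_sUnion_of_mem hc0))
        nth_rw 2 [← h2]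
        exact hae.inter EventuallyEq.rfl
      have h3 := measure_mul_image_le (B := a ∩ F ⁻¹' E) (B' := a ∩ F ⁻¹' E')
        (hζ a ha).1 (hζ a ha).2.1 inter_subset_left
        inter_subset_left (ham.inter (hF hEm)) (ham.inter (hF hEm'))
        (s := K * R ^ θ * (lam ^ (-θ)) ^ k) fun z hz z' hz' => by
          refine ((hζ a ha).2.2 z hz.1 z' hz'.1).trans ?_
          rw [mul_assoc]
          refine mul_le_mul_of_nonneg_left ?_ hK.le
          have h4 := dist_le_of_mem_cylinder hl hexp hR k c hc _ (hE hz.2) _ (hE' hz'.2)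
          refine (Real.rpow_le_rpow dist_nonneg h4 hθ.le).trans (le_of_eq ?_)
          rw [Real.mul_rpow (by positivity) hR0.le, mul_comm, ← Real.rpow_natCast,
            ← Real.rpow_natCast, ← Real.rpow_mul (by positivity), ← Real.rpow_mul (by positivity),
            ← Real.rpow_neg_one, ← Real.rpow_mul hl0.le]
          congr 2; ring
      rw [himg, himg, h1] at h3
      refine h3.trans (mul_le_mul_right ?_ _)
      rw [mul_comm]
      exact mul_le_mul_right (measure_mono inter_subset_right) _
    · -- the cylinder is disjoint from the image of `a`, up to a null set
      have h1 : ν (F '' a ∩ E) = 0 := by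
        have h2 : (⋃₀ ℬ ∩ E : Set X) = ∅ := by
          rw [← disjoint_iff_inter_eq_empty, disjoint_sUnion_left]
          intro b hb
          exact (h.partition.disjoint (hℬ hb) (hc 0) fun hbc => hc0 (hbc ▸ hb)).mono_right
            (hE.trans (cylinder_subset_zero hk))
        rw [measure_congr (hae.inter (EventuallyEq.refl _ E)), h2, measure_empty]
      have h3 := hglob a ha E hEm
      rw [h1, zero_mul, mul_zero, nonpos_iff_eq_zero, mul_eq_zero] at h3
      rw [h3.resolve_right (hc₀.trans_le (hbig a ha)).ne', zero_mul]
      exact zero_le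
  · intro a ha E hE
    have hm0 : min c₀ 1 ≠ 0 := (lt_min hc₀ one_pos).ne'
    have hmt : min c₀ 1 ≠ ∞ := ((min_le_right _ _).trans_lt ENNReal.one_lt_top).ne
    rw [ENNReal.coe_toNNReal (ENNReal.div_ne_top ENNReal.ofReal_ne_top hm0), mul_assoc,
      ← ENNReal.mul_div_right_comm, ENNReal.le_div_iff_mul_le (Or.inl hm0) (Or.inl hmt)]
    calc ν (a ∩ F ⁻¹' E) * min c₀ 1 ≤ ν (a ∩ F ⁻¹' E) * ν (F '' a) :=
          mul_le_mul_right ((min_le_left _ _).trans (hbig a ha)) _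
      _ ≤ _ := (hglob a ha E hE).trans (mul_le_mul_right ?_ _)
    rw [mul_comm]
    exact mul_le_mul_right (measure_mono inter_subset_right) _

/-! ### Measures with regular densities -/

lemma dynCylinder_const_one {X : Type*} {F : X → X} (a : Set X) :
    dynCylinder F (fun _ => a) 1 = a := by
  ext x; simp [dynCylinder]

section Regular

variable {X : Type*} [MeasurableSpace X] {ν : Measure X} {F : X → X} {𝒜 : Set (Set X)}
  {γ K K' K₀ : ℝ} {D : ℝ≥0} {ρ σ : Measure X}

lemma IsCountablePartition.eq_sum_restrict (h : IsCountablePartition ν 𝒜) (hρ : ρ ≪ ν) :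
    ρ = Measure.sum fun a : 𝒜 => ρ.restrict a := by
  have := h.countable.to_subtype
  have hdisj : Pairwise (Function.onFun Disjoint fun a : 𝒜 => (a : Set X)) := fun a b hab =>
    h.disjoint a.2 b.2 fun hc => hab (Subtype.ext hc)
  have h0 : (⋃ a : 𝒜, (a : Set X)) =ᵐ[ρ] univ := by
    rw [ae_eq_univ, ← sUnion_eq_iUnion]; exact hρ h.cover
  rw [← Measure.restrict_iUnion hdisj fun a => h.measurableSet a a.2, Measure.restrict_congr_set h0,
    Measure.restrict_univ]

lemma IsCountablePartition.measure_eq_tsum (h : IsCountablePartition ν 𝒜) (hρ : ρ ≪ ν)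
    {E : Set X} (hE : MeasurableSet E) : ρ E = ∑' a : 𝒜, ρ (a ∩ E) := by
  nth_rw 1 [h.eq_sum_restrict hρ]
  rw [Measure.sum_apply _ hE]
  exact tsum_congr fun a => by rw [Measure.restrict_apply hE, inter_comm]

lemma HasCylinderDistortion.quasiMeasurePreserving [IsFiniteMeasure ν]
    (hD : HasCylinderDistortion ν F 𝒜 γ K₀ D) (h𝒜 : IsCountablePartition ν 𝒜)
    (hF : Measurable F) : Measure.QuasiMeasurePreserving F ν ν := by
  refine ⟨hF, Measure.AbsolutelyContinuous.mk fun E hE h0 => ?_⟩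
  rw [Measure.map_apply hF hE, h𝒜.measure_eq_tsum Measure.AbsolutelyContinuous.rfl (hF hE)]
  simp only [ENNReal.tsum_eq_zero]
  exact fun a => le_antisymm ((hD.bounded a a.2 E hE).trans (by simp [h0])) zero_le

lemma ENNReal.le_of_mul_le_mul_of_ne {a b c : ℝ≥0∞} (h0 : c ≠ 0) (ht : c ≠ ∞)
    (h : a * c ≤ b * c) : a ≤ b := (ENNReal.mul_le_mul_iff_left h0 ht).1 h

lemma isCylinderRegular_self (hK : 0 ≤ K) (hγ : 0 ≤ γ) : IsCylinderRegular ν F 𝒜 γ K ν where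
  ac := Measure.AbsolutelyContinuous.rfl
  regular k _ _ _ E E' _ _ _ _ := by
    rw [mul_comm (ν E') (ν E)]
    refine le_mul_of_one_le_left zero_le (ENNReal.one_le_ofReal.2 (Real.one_le_exp (by positivity)))

namespace IsCylinderRegular

lemma mono (h : IsCylinderRegular ν F 𝒜 γ K ρ) (hK : K ≤ K') (hγ : 0 ≤ γ) :
    IsCylinderRegular ν F 𝒜 γ K' ρ where
  ac := h.ac
  regular k hk c hc E E' hE hE' hEm hEm' :=
    (h.regular k hk c hc E E' hE hE' hEm hEm').trans (mul_le_mul_left (ENNReal.ofReal_le_ofReal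
      (Real.exp_le_exp.2 (mul_le_mul_of_nonneg_right hK (by positivity)))) _)

lemma const_smul (h : IsCylinderRegular ν F 𝒜 γ K ρ) (r : ℝ≥0∞) :
    IsCylinderRegular ν F 𝒜 γ K (r • ρ) where
  ac := h.ac.smul_left r
  regular k hk c hc E E' hE hE' hEm hEm' := by
    simp only [Measure.smul_apply, smul_eq_mul]
    rw [mul_assoc r, mul_assoc r, mul_left_comm _ r]
    exact mul_le_mul_right (h.regular k hk c hc E E' hE hE' hEm hEm') r

lemma sum {ι : Type*} {ρ : ι → Measure X} (h : ∀ i, IsCylinderRegular ν F 𝒜 γ K (ρ i)) :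
    IsCylinderRegular ν F 𝒜 γ K (Measure.sum ρ) where
  ac := Measure.absolutelyContinuous_sum_left fun i => (h i).ac
  regular k hk c hc E E' hE hE' hEm hEm' := by
    rw [Measure.sum_apply _ hEm, Measure.sum_apply _ hEm', ← ENNReal.tsum_mul_right,
      ← ENNReal.tsum_mul_right, ← ENNReal.tsum_mul_left]
    exact ENNReal.tsum_le_tsum fun i => (h i).regular k hk c hc E E' hE hE' hEm hEm'

lemma restrict (h : IsCylinderRegular ν F 𝒜 γ K ρ) (h𝒜 : IsCountablePartition ν 𝒜)
    {a : Set X} (ha : a ∈ 𝒜) : IsCylinderRegular ν F 𝒜 γ K (ρ.restrict a) where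
  ac := Measure.restrict_le_self.absolutelyContinuous.trans h.ac
  regular k hk c hc E E' hE hE' hEm hEm' := by
    rw [Measure.restrict_apply hEm, Measure.restrict_apply hEm']
    by_cases hac : a = c 0
    · rw [inter_eq_left.2 (hac ▸ hE.trans (cylinder_subset_zero hk)),
        inter_eq_left.2 (hac ▸ hE'.trans (cylinder_subset_zero hk))]
      exact h.regular k hk c hc E E' hE hE' hEm hEm'
    · have : E ∩ a = ∅ := disjoint_iff_inter_eq_empty.1
        ((h𝒜.disjoint ha (hc 0) hac).symm.mono_left (hE.trans (cylinder_subset_zero hk)))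
      simp [this]

/-- One branch of `F` transports regular measures to regular measures: old irregularities are
contracted by the factor `γ`. -/
lemma map_restrict [IsFiniteMeasure ν] (h : IsCylinderRegular ν F 𝒜 γ K ρ)
    (hD : HasCylinderDistortion ν F 𝒜 γ K₀ D) (h𝒜 : IsCountablePartition ν 𝒜)
    (hF : Measurable F) {a : Set X} (ha : a ∈ 𝒜) :
    IsCylinderRegular ν F 𝒜 γ (K₀ + γ * K) ((ρ.restrict a).map F) where
  ac := ((Measure.restrict_le_self.absolutelyContinuous.trans h.ac).map hF).trans
    (hD.quasiMeasurePreserving h𝒜 hF).absolutelyContinuous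
  regular k hk c hc E E' hE hE' hEm hEm' := by
    have ham := h𝒜.measurableSet a ha
    rw [Measure.map_apply hF hEm, Measure.map_apply hF hEm', Measure.restrict_apply (hF hEm),
      Measure.restrict_apply (hF hEm'), inter_comm _ a, inter_comm _ a]
    set B := a ∩ F ⁻¹' E
    set B' := a ∩ F ⁻¹' E'
    have hsub : ∀ S, S ⊆ dynCylinder F c k →
        a ∩ F ⁻¹' S ⊆ dynCylinder F (fun i => Nat.casesOn i a c) (k + 1) := fun S hS => by
      rw [← inter_preimage_cylinder]
      exact inter_subset_inter_right _ (preimage_mono hS)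
    have h1 : ρ B * ν B' ≤ _ * (ρ B' * ν B) := h.regular (k + 1) (by omega) _
      (fun i => by cases i <;> simp [ha, hc]) B B' (hsub E hE) (hsub E' hE')
      (ham.inter (hF hEm)) (ham.inter (hF hEm'))
    have h2 : ν B * ν E' ≤ _ * (ν B' * ν E) := hD.one_step a ha k hk c hc E E' hE hE' hEm hEm'
    have hexp : Real.exp ((K₀ + γ * K) * γ ^ k) =
        Real.exp (K * γ ^ (k + 1)) * Real.exp (K₀ * γ ^ k) := by
      rw [← Real.exp_add]; congr 1; ring
    rw [hexp, ENNReal.ofReal_mul (Real.exp_nonneg _)]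
    set e₁ := ENNReal.ofReal (Real.exp (K * γ ^ (k + 1)))
    set e₂ := ENNReal.ofReal (Real.exp (K₀ * γ ^ k))
    by_cases h0 : ν B' = 0
    · rw [h0, zero_mul, mul_zero, nonpos_iff_eq_zero, mul_eq_zero] at h2
      rcases h2 with h2 | h2
      · rw [h.ac h2, zero_mul]; exact zero_le
      · rw [h2, mul_zero]; exact zero_le
    · refine ENNReal.le_of_mul_le_mul_of_ne h0 (measure_ne_top ν _) ?_
      calc ρ B * ν E' * ν B' = (ρ B * ν B') * ν E' := by ring
        _ ≤ e₁ * (ρ B' * ν B) * ν E' := mul_le_mul_left h1 _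
        _ = e₁ * ρ B' * (ν B * ν E') := by ring
        _ ≤ e₁ * ρ B' * (e₂ * (ν B' * ν E)) := mul_le_mul_right h2 _
        _ = _ := by ring

lemma map [IsFiniteMeasure ν] (h : IsCylinderRegular ν F 𝒜 γ K ρ)
    (hD : HasCylinderDistortion ν F 𝒜 γ K₀ D) (h𝒜 : IsCountablePartition ν 𝒜)
    (hF : Measurable F) : IsCylinderRegular ν F 𝒜 γ (K₀ + γ * K) (ρ.map F) := by
  rw [h𝒜.eq_sum_restrict h.ac, Measure.map_sum hF.aemeasurable]
  exact sum fun a => h.map_restrict hD h𝒜 hF a.2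

lemma map_iterate [IsFiniteMeasure ν] (h : IsCylinderRegular ν F 𝒜 γ K ρ)
    (hD : HasCylinderDistortion ν F 𝒜 γ K₀ D) (h𝒜 : IsCountablePartition ν 𝒜)
    (hF : Measurable F) (hγ : 0 ≤ γ) (hK : K₀ + γ * K ≤ K) (n : ℕ) :
    IsCylinderRegular ν F 𝒜 γ K (ρ.map F^[n]) := by
  induction n with
  | zero => simpa using h
  | succ n ih =>
    rw [Function.iterate_succ', ← Measure.map_map hF (hF.iterate n)]
    exact (ih.map hD h𝒜 hF).mono hK hγ

/-- The law of `F^m x` for `x` distributed according to a regular measure and conditioned to a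
cylinder of length `m` is regular, with the same constant. -/
lemma map_iterate_restrict_cylinder [IsFiniteMeasure ν] (h : IsCylinderRegular ν F 𝒜 γ K ρ)
    (hD : HasCylinderDistortion ν F 𝒜 γ K₀ D) (h𝒜 : IsCountablePartition ν 𝒜)
    (hF : Measurable F) (hγ : 0 ≤ γ) (hK : K₀ + γ * K ≤ K) {c : ℕ → Set X}
    (hc : ∀ i, c i ∈ 𝒜) (m : ℕ) :
    IsCylinderRegular ν F 𝒜 γ K ((ρ.restrict (dynCylinder F c m)).map F^[m]) := by
  induction m with
  | zero =>
    have : dynCylinder F c 0 = univ := by ext; simp [dynCylinder]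
    simpa [this] using h
  | succ m ih =>
    have hcm := h𝒜.measurableSet _ (hc m)
    have h1 : dynCylinder F c (m + 1) = F^[m] ⁻¹' c m ∩ dynCylinder F c m := by
      ext x
      refine ⟨fun hx => ⟨hx m (by omega), fun i hi => hx i (by omega)⟩, fun hx i hi => ?_⟩
      rcases (Nat.lt_succ_iff_lt_or_eq.1 hi) with h | rfl
      · exact hx.2 i h
      · exact hx.1
    rw [h1, ← Measure.restrict_restrict (hF.iterate m hcm), Function.iterate_succ',
      ← Measure.map_map hF (hF.iterate m), ← Measure.restrict_map (hF.iterate m) hcm]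
    exact (ih.map_restrict hD h𝒜 hF (hc m)).mono hK hγ

lemma regular_one (h : IsCylinderRegular ν F 𝒜 γ K ρ) (hγ1 : γ ≤ 1) (hK : 0 ≤ K)
    {a E E' : Set X} (ha : a ∈ 𝒜) (hE : E ⊆ a) (hE' : E' ⊆ a)
    (hEm : MeasurableSet E) (hEm' : MeasurableSet E') :
    ρ E * ν E' ≤ ENNReal.ofReal (Real.exp K) * (ρ E' * ν E) := by
  refine (h.regular 1 le_rfl (fun _ => a) (fun _ => ha) E E' (by rwa [dynCylinder_const_one])
    (by rwa [dynCylinder_const_one]) hEm hEm').trans (mul_le_mul_left ?_ _)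
  refine ENNReal.ofReal_le_ofReal (Real.exp_le_exp.2 ?_)
  rw [pow_one]; exact mul_le_of_le_one_right hK hγ1

/-- On a partition element, two regular measures are proportional up to constants. -/
lemma compare [IsFiniteMeasure ν] (h : IsCylinderRegular ν F 𝒜 γ K ρ)
    (h' : IsCylinderRegular ν F 𝒜 γ K σ) (h𝒜 : IsCountablePartition ν 𝒜) (hγ1 : γ ≤ 1)
    (hK : 0 ≤ K) {a E : Set X} (ha : a ∈ 𝒜) (hE : E ⊆ a) (hEm : MeasurableSet E) :
    ρ a * σ E ≤ ENNReal.ofReal (Real.exp (2 * K)) * (ρ E * σ a) := by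
  have ham := h𝒜.measurableSet a ha
  have h1 := h.regular_one hγ1 hK ha subset_rfl hE ham hEm
  have h2 := h'.regular_one hγ1 hK ha hE subset_rfl hEm ham
  refine ENNReal.le_of_mul_le_mul_of_ne (h𝒜.pos a ha).ne' (measure_ne_top ν _) ?_
  rw [two_mul, Real.exp_add, ENNReal.ofReal_mul (Real.exp_nonneg _)]
  set e := ENNReal.ofReal (Real.exp K)
  calc ρ a * σ E * ν a = ρ a * (σ E * ν a) := by ring
    _ ≤ ρ a * (e * (σ a * ν E)) := mul_le_mul_right h2 _
    _ = e * σ a * (ρ a * ν E) := by ring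
    _ ≤ e * σ a * (e * (ρ E * ν a)) := mul_le_mul_right h1 _
    _ = _ := by ring

/-- Big images: the image of a regular measure has bounded density. -/
lemma map_apply_le [IsFiniteMeasure ν] (h : IsCylinderRegular ν F 𝒜 γ K ρ)
    (hD : HasCylinderDistortion ν F 𝒜 γ K₀ D) (h𝒜 : IsCountablePartition ν 𝒜)
    (hF : Measurable F) (hγ1 : γ ≤ 1) (hK : 0 ≤ K) {E : Set X} (hE : MeasurableSet E) :
    ρ.map F E ≤ ENNReal.ofReal (Real.exp K) * D * ρ univ * ν E := by
  rw [Measure.map_apply hF hE, h𝒜.measure_eq_tsum h.ac (hF hE),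
    h𝒜.measure_eq_tsum h.ac MeasurableSet.univ, ← ENNReal.tsum_mul_left, ← ENNReal.tsum_mul_right]
  refine ENNReal.tsum_le_tsum fun a => ?_
  have ham := h𝒜.measurableSet a a.2
  have h1 := h.regular_one hγ1 hK a.2 (E := a ∩ F ⁻¹' E) (E' := a) inter_subset_left subset_rfl
    (ham.inter (hF hE)) ham
  refine ENNReal.le_of_mul_le_mul_of_ne (h𝒜.pos a a.2).ne' (measure_ne_top ν _) ?_
  rw [inter_univ]
  calc ρ (a ∩ F ⁻¹' E) * ν a ≤ ENNReal.ofReal (Real.exp K) * (ρ a * ν (a ∩ F ⁻¹' E)) := h1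
    _ ≤ ENNReal.ofReal (Real.exp K) * (ρ a * (D * ν a * ν E)) :=
        mul_le_mul_right (mul_le_mul_right (hD.bounded a a.2 E hE) _) _
    _ = _ := by ring

/-- Regularity leaves room for subtracting a small multiple of a dominated, more regular measure. -/
lemma sub_smul [IsFiniteMeasure ν] [IsFiniteMeasure ρ] [IsFiniteMeasure σ]
    (h : IsCylinderRegular ν F 𝒜 γ K' ρ) (h' : IsCylinderRegular ν F 𝒜 γ K' σ) (hle : σ ≤ ρ)
    (hγ : 0 ≤ γ) (hγ1 : γ ≤ 1) (hK' : 0 ≤ K') (hK : K' < K) {r : ℝ≥0}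
    (hr : (r : ℝ) ≤ (K - K') / ((K + K') * Real.exp K)) :
    IsCylinderRegular ν F 𝒜 γ K (ρ - r • σ) := by
  have hK0 : 0 < K := hK'.trans_lt hK
  have hr1 : r ≤ 1 := by
    have : (K - K') / ((K + K') * Real.exp K) ≤ 1 := by
      rw [div_le_one (by positivity)]
      nlinarith [Real.one_le_exp hK0.le, Real.exp_pos K]
    exact_mod_cast hr.trans this
  have hle' : r • σ ≤ ρ := by
    refine le_trans ?_ hle
    refine Measure.le_iff.2 fun s _ => ?_
    simp only [Measure.smul_apply, ENNReal.smul_def, smul_eq_mul]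
    exact mul_le_of_le_one_left zero_le (by exact_mod_cast hr1)
  refine ⟨(Measure.sub_le.absolutelyContinuous).trans h.ac, ?_⟩
  intro k hk c hc E E' hE hE' hEm hEm'
  have h1 := h.regular k hk c hc E E' hE hE' hEm hEm'
  have h2 := h'.regular k hk c hc E' E hE' hE hEm' hEm
  have h3 := hle E'
  have h4 := hle' E
  have h5 := hle' E'
  rw [Measure.sub_apply hEm hle', Measure.sub_apply hEm' hle']
  simp only [Measure.smul_apply, ENNReal.smul_def, smul_eq_mul] at h4 h5 ⊢
  set s := γ ^ k
  have hs0 : 0 ≤ s := pow_nonneg hγ k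
  have hs1 : s ≤ 1 := pow_le_one₀ hγ hγ1
  -- the inequality is checked on real numbers
  obtain ⟨x, hx⟩ : ∃ x : ℝ≥0, ρ E = x := ⟨(ρ E).toNNReal, by simp⟩
  obtain ⟨x', hx'⟩ : ∃ x : ℝ≥0, ρ E' = x := ⟨(ρ E').toNNReal, by simp⟩
  obtain ⟨y, hy⟩ : ∃ x : ℝ≥0, σ E = x := ⟨(σ E).toNNReal, by simp⟩
  obtain ⟨y', hy'⟩ : ∃ x : ℝ≥0, σ E' = x := ⟨(σ E').toNNReal, by simp⟩
  obtain ⟨n, hn⟩ : ∃ x : ℝ≥0, ν E = x := ⟨(ν E).toNNReal, by simp⟩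
  obtain ⟨n', hn'⟩ : ∃ x : ℝ≥0, ν E' = x := ⟨(ν E').toNNReal, by simp⟩
  obtain ⟨e, hre⟩ : ∃ e : ℝ → ℝ≥0, ∀ t, (e t : ℝ) = Real.exp t :=
    ⟨fun t => (Real.exp t).toNNReal, fun t => Real.coe_toNNReal _ (Real.exp_nonneg t)⟩
  have he : ∀ t, ENNReal.ofReal (Real.exp t) = (e t : ℝ≥0∞) := fun t => by
    rw [← hre, ENNReal.ofReal_coe_nnreal]
  rw [he, hx, hx', hn, hn', ← ENNReal.coe_mul, ← ENNReal.coe_mul, ← ENNReal.coe_mul,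
    ENNReal.coe_le_coe, ← NNReal.coe_le_coe] at h1
  rw [he, hy, hy', hn, hn', ← ENNReal.coe_mul, ← ENNReal.coe_mul, ← ENNReal.coe_mul,
    ENNReal.coe_le_coe, ← NNReal.coe_le_coe] at h2
  rw [hx', hy', ENNReal.coe_le_coe] at h3
  rw [hx, hy, ← ENNReal.coe_mul, ENNReal.coe_le_coe] at h4
  rw [hx', hy', ← ENNReal.coe_mul, ENNReal.coe_le_coe] at h5
  rw [he, hx, hx', hy, hy', hn, hn', ← ENNReal.coe_mul, ← ENNReal.coe_mul, ← ENNReal.coe_sub,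
    ← ENNReal.coe_sub, ← ENNReal.coe_mul, ← ENNReal.coe_mul, ← ENNReal.coe_mul,
    ENNReal.coe_le_coe, ← NNReal.coe_le_coe]
  push_cast [NNReal.coe_sub h4, NNReal.coe_sub h5, hre] at h1 h2 ⊢
  have h3' : (y' : ℝ) ≤ x' := h3
  -- comparison of the exponential weights
  have hw : (r : ℝ) * (Real.exp (K * s) - Real.exp (-(K' * s))) ≤
      Real.exp (K * s) - Real.exp (K' * s) := by
    have hA : Real.exp (K * s) - Real.exp (-(K' * s)) ≤ (K + K') * Real.exp K * s := by
      have e1 : Real.exp (-(K' * s)) = Real.exp (K * s) * Real.exp (-((K + K') * s)) := by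
        rw [← Real.exp_add]; congr 1; ring
      have e2 := Real.add_one_le_exp (-((K + K') * s))
      have e3 : Real.exp (K * s) ≤ Real.exp K :=
        Real.exp_le_exp.2 (mul_le_of_le_one_right hK0.le hs1)
      rw [e1]
      have e4 : 0 < Real.exp (K * s) := Real.exp_pos _
      have e5 : 0 ≤ (K + K') * s := by positivity
      nlinarith [mul_le_mul_of_nonneg_left e2 e4.le, mul_le_mul_of_nonneg_right e3 e5]
    have hB : (K - K') * s ≤ Real.exp (K * s) - Real.exp (K' * s) := by
      have e1 : Real.exp (K * s) = Real.exp (K' * s) * Real.exp ((K - K') * s) := by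
        rw [← Real.exp_add]; congr 1; ring
      have e2 := Real.add_one_le_exp ((K - K') * s)
      have e3 : 1 ≤ Real.exp (K' * s) := Real.one_le_exp (by positivity)
      have e5 : 0 ≤ (K - K') * s := mul_nonneg (by linarith) hs0
      rw [e1]
      nlinarith
    rw [le_div_iff₀ (by positivity)] at hr
    calc (r : ℝ) * (Real.exp (K * s) - Real.exp (-(K' * s)))
        ≤ r * ((K + K') * Real.exp K * s) := mul_le_mul_of_nonneg_left hA r.2
      _ = r * ((K + K') * Real.exp K) * s := by ring
      _ ≤ (K - K') * s := mul_le_mul_of_nonneg_right hr hs0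
      _ ≤ _ := hB
  have h2' : Real.exp (-(K' * s)) * (y' * n) ≤ y * n' := by
    rw [Real.exp_neg, inv_mul_le_iff₀ (Real.exp_pos _)]; exact h2
  have hgap : 0 ≤ Real.exp (K * s) - Real.exp (-(K' * s)) := by
    refine sub_nonneg.2 (Real.exp_le_exp.2 ?_)
    nlinarith [mul_nonneg hK0.le hs0, mul_nonneg hK' hs0]
  have hyx : (y' : ℝ) * n ≤ x' * n := mul_le_mul_of_nonneg_right h3' n.2
  have hx'n : (0 : ℝ) ≤ x' * n := by positivity
  have t1 : (r : ℝ) * (Real.exp (-(K' * s)) * (y' * n)) ≤ r * (y * n') :=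
    mul_le_mul_of_nonneg_left h2' r.2
  have t2 : (r : ℝ) * (Real.exp (K * s) - Real.exp (-(K' * s))) * (y' * n) ≤
      (Real.exp (K * s) - Real.exp (K' * s)) * (x' * n) :=
    (mul_le_mul_of_nonneg_left hyx (mul_nonneg r.2 hgap)).trans
      (mul_le_mul_of_nonneg_right hw hx'n)
  nlinarith [h1, t1, t2]

end IsCylinderRegular

end Regular

/-! ### Coupling -/

section Coupling

variable {X : Type*} [MeasurableSpace X] {ν μ : Measure X} {F : X → X} {𝒜 : Set (Set X)}
  {γ K K₀ : ℝ} {D : ℝ≥0}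

/-- A finite set of partition elements, independent of `ρ`, one of which has a definite proportion
of the mass of `ρ` after one step. -/
lemma exists_finset_heavy [IsFiniteMeasure ν] (hD : HasCylinderDistortion ν F 𝒜 γ K₀ D)
    (h𝒜 : IsCountablePartition ν 𝒜) (hF : Measurable F) (hγ1 : γ ≤ 1) (hK : 0 ≤ K) :
    ∃ s : Finset 𝒜, ∀ ρ : Measure X, IsFiniteMeasure ρ → IsCylinderRegular ν F 𝒜 γ K ρ →
      ρ univ ≠ 0 → ∃ a : 𝒜, a ∈ s ∧ ρ univ ≤ (2 * s.card + 1 : ℕ) * ρ.map F a := by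
  set D₁ : ℝ≥0∞ := ENNReal.ofReal (Real.exp K) * D with hD₁
  have hD₁t : D₁ ≠ ∞ := by finiteness
  have hsum : ∑' a : 𝒜, ν a ≠ ∞ := by
    have := h𝒜.measure_eq_tsum (Measure.AbsolutelyContinuous.rfl (μ := ν)) MeasurableSet.univ
    simp only [inter_univ] at this
    rw [← this]; exact measure_ne_top ν _
  have hlim : Tendsto (fun s : Finset 𝒜 => 2 * D₁ * ∑' a : {x // x ∉ s}, ν a) atTop (𝓝 0) := by
    have := ENNReal.Tendsto.const_mul (ENNReal.tendsto_tsum_compl_atTop_zero hsum)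
      (Or.inr (show 2 * D₁ ≠ ∞ by finiteness))
    simpa using this
  obtain ⟨s, hs⟩ := (hlim.eventually (ge_mem_nhds (zero_lt_one (α := ℝ≥0∞)))).exists
  refine ⟨s, fun ρ _ hρ h0 => ?_⟩
  by_contra! hc
  have hσ := hρ.map hD h𝒜 hF
  set σ := ρ.map F
  have hσX : σ univ = ρ univ := by rw [Measure.map_apply hF MeasurableSet.univ, preimage_univ]
  have hle : ∀ a : 𝒜, σ a ≤ D₁ * ρ univ * ν a := fun a =>
    hρ.map_apply_le hD h𝒜 hF hγ1 hK (h𝒜.measurableSet a a.2)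
  let u : 𝒜 → ℝ≥0∞ := fun a => σ a
  have hsplit : σ univ = ∑ a ∈ s, u a + ∑' a : {x // x ∉ s}, u a := by
    have := h𝒜.measure_eq_tsum hσ.ac MeasurableSet.univ
    simp only [inter_univ] at this
    rw [this]
    exact (ENNReal.sum_add_tsum_compl s u).symm
  set M : ℝ≥0∞ := ((2 * s.card + 1 : ℕ) : ℝ≥0∞) with hM
  have h1 : M * ∑ a ∈ s, u a ≤ s.card * ρ univ := by
    rw [Finset.mul_sum]
    refine (Finset.sum_le_sum fun a ha => (hc a ha).le).trans (le_of_eq ?_)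
    rw [Finset.sum_const, nsmul_eq_mul]
  have h2 : 2 * ∑' a : {x // x ∉ s}, u a ≤ ρ univ := by
    calc 2 * ∑' a : {x // x ∉ s}, u a ≤ 2 * ∑' a : {x // x ∉ s}, D₁ * ρ univ * ν a :=
          mul_le_mul_right (ENNReal.tsum_le_tsum fun a : {x // x ∉ s} => hle a) _
      _ = (2 * D₁ * ∑' a : {x // x ∉ s}, ν a) * ρ univ := by
          rw [ENNReal.tsum_mul_left]; ring
      _ ≤ ρ univ := mul_le_of_le_one_left zero_le hs
  have h3 : 2 * M * ρ univ ≤ (2 * s.card + M) * ρ univ := by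
    calc 2 * M * ρ univ = 2 * (M * ∑ a ∈ s, u a) + M * (2 * ∑' a : {x // x ∉ s}, u a) := by
          rw [← hσX, hsplit]; ring
      _ ≤ 2 * (s.card * ρ univ) + M * ρ univ :=
          add_le_add (mul_le_mul_right h1 _) (mul_le_mul_right h2 _)
      _ = _ := by ring
  have h4 := ENNReal.le_of_mul_le_mul_of_ne h0 (measure_ne_top ρ _) h3
  rw [hM] at h4
  have h5 : 2 * (2 * s.card + 1) ≤ 2 * s.card + (2 * s.card + 1) := by exact_mod_cast h4
  omega

/-- A Doeblin condition, uniform over regular measures: after a fixed number of steps such a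
measure dominates a multiple of `μ` on a fixed partition element. Mixing is needed only between
finitely many partition elements. -/
lemma exists_minorization [IsFiniteMeasure ν] (hD : HasCylinderDistortion ν F 𝒜 γ K₀ D)
    (h𝒜 : IsCountablePartition ν 𝒜) (hF : Measurable F) (hγ : 0 ≤ γ) (hγ1 : γ ≤ 1) (hK : 0 ≤ K)
    (hK₀ : K₀ + γ * K ≤ K) [IsProbabilityMeasure μ] (hinv : MeasurePreserving F μ μ)
    (hμ : IsCylinderRegular ν F 𝒜 γ K μ) (hmix : IsMixing F μ) :
    ∃ (N : ℕ) (e : Set X) (δ : ℝ≥0), e ∈ 𝒜 ∧ μ e ≠ 0 ∧ δ ≠ 0 ∧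
      ∀ ρ : Measure X, IsFiniteMeasure ρ → IsCylinderRegular ν F 𝒜 γ K ρ → ρ ≪ μ →
        (δ * ρ univ) • μ.restrict e ≤ ρ.map F^[N + 1] := by
  obtain ⟨e, he, hμe⟩ : ∃ e ∈ 𝒜, μ e ≠ 0 := by
    by_contra! hc
    have h1 := h𝒜.measure_eq_tsum hμ.ac MeasurableSet.univ
    simp only [inter_univ] at h1
    have h2 : ∑' a : 𝒜, μ a = 0 := ENNReal.tsum_eq_zero.2 fun a => hc a a.2
    rw [h2] at h1
    simp at h1
  have hem := h𝒜.measurableSet e he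
  obtain ⟨s, hs⟩ := exists_finset_heavy (K := K) hD h𝒜 hF hγ1 hK
  -- one time `N` serves all elements of the finite set `s`, by mixing
  obtain ⟨N, hN⟩ : ∃ N : ℕ, ∀ a : 𝒜, a ∈ s → μ a ≠ 0 → 0 < μ (a ∩ F^[N] ⁻¹' e) := by
    have : ∀ᶠ n : ℕ in atTop, ∀ a : 𝒜, a ∈ s → μ a ≠ 0 → 0 < μ (a ∩ F^[n] ⁻¹' e) := by
      rw [Filter.eventually_all_finset]
      intro a _
      by_cases ha : μ a = 0
      · simp [ha]
      · have h1 := hmix a e (h𝒜.measurableSet a a.2) hem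
        filter_upwards [h1.eventually (lt_mem_nhds (ENNReal.mul_pos ha hμe))] with n hn _
        exact hn
    exact this.exists
  classical
  set δ₀ : ℝ≥0∞ := min 1 ((s.filter fun a : 𝒜 => μ a ≠ 0).inf fun a : 𝒜 => μ (a ∩ F^[N] ⁻¹' e)) with hδ₀
  have hδ₀pos : δ₀ ≠ 0 := by
    refine (lt_min one_pos ((Finset.lt_inf_iff ENNReal.zero_lt_top).2 fun a ha => ?_)).ne'
    exact hN a (Finset.mem_filter.1 ha).1 (Finset.mem_filter.1 ha).2
  have hδ₀t : δ₀ ≠ ∞ := ((min_le_left _ _).trans_lt ENNReal.one_lt_top).ne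
  set M : ℝ≥0∞ := ((2 * s.card + 1 : ℕ) : ℝ≥0∞) with hM
  set ε := ENNReal.ofReal (Real.exp (2 * K)) with hε
  have hε0 : ε ≠ 0 := by simp [hε, Real.exp_pos]
  have hden0 : M * ε * ε ≠ 0 := mul_ne_zero (mul_ne_zero (by simp [hM]) hε0) hε0
  have hdent : M * ε * ε ≠ ∞ := by finiteness
  have hδt : δ₀ / (M * ε * ε) ≠ ∞ := ENNReal.div_ne_top hδ₀t hden0
  refine ⟨N, e, (δ₀ / (M * ε * ε)).toNNReal, he, hμe, ?_, fun ρ hfin hρ hρμ => ?_⟩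
  · rw [Ne, ENNReal.toNNReal_eq_zero_iff, not_or]
    exact ⟨ENNReal.div_ne_zero.2 ⟨hδ₀pos, hdent⟩, hδt⟩
  rw [ENNReal.coe_toNNReal hδt]
  rcases eq_or_ne (ρ univ) 0 with h0 | h0
  · rw [h0, mul_zero, zero_smul]; exact Measure.zero_le _
  obtain ⟨a, has, ha⟩ := hs ρ hfin hρ h0
  have ham := h𝒜.measurableSet a a.2
  have hσ : IsCylinderRegular ν F 𝒜 γ K (ρ.map F) := (hρ.map hD h𝒜 hF).mono hK₀ hγ
  have hσμ : ρ.map F ≪ μ := by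
    have := hρμ.map hF
    rwa [hinv.map_eq] at this
  have hcomp : ρ.map F^[N + 1] = (ρ.map F).map F^[N] := by
    rw [Function.iterate_succ, Measure.map_map (hF.iterate N) hF]
  rw [hcomp]
  set σ := ρ.map F
  have hμa : μ a ≠ 0 := fun h => by
    rw [hσμ h, mul_zero, nonpos_iff_eq_zero] at ha
    exact h0 ha
  have hτ := (hμ.restrict h𝒜 a.2).map_iterate hD h𝒜 hF hγ hK₀ N
  refine Measure.le_iff.2 fun E hE => ?_
  rw [Measure.smul_apply, smul_eq_mul, Measure.restrict_apply hE, Measure.map_apply (hF.iterate N) hE]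
  have hEe : MeasurableSet (E ∩ e) := hE.inter hem
  set B : Set X := a ∩ F^[N] ⁻¹' (E ∩ e)
  have hBm : MeasurableSet B := ham.inter (hF.iterate N hEe)
  have h1 : μ (a ∩ F^[N] ⁻¹' e) * μ (E ∩ e) ≤ ε * μ B := by
    have h := hτ.compare hμ h𝒜 hγ1 hK he (inter_subset_right (s := E)) hEe
    rw [Measure.map_apply (hF.iterate N) hem, Measure.map_apply (hF.iterate N) hEe,
      Measure.restrict_apply (hF.iterate N hem), Measure.restrict_apply (hF.iterate N hEe),
      inter_comm _ (a : Set X), inter_comm _ (a : Set X)] at h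
    exact h.trans (mul_le_mul_right (mul_le_of_le_one_right zero_le prob_le_one) _)
  have h2 : σ a * μ B ≤ ε * σ B :=
    (hσ.compare hμ h𝒜 hγ1 hK a.2 inter_subset_left hBm).trans
      (mul_le_mul_right (mul_le_of_le_one_right zero_le prob_le_one) _)
  have h3 : δ₀ ≤ μ (a ∩ F^[N] ⁻¹' e) := (min_le_right _ _).trans
    (Finset.inf_le (Finset.mem_filter.2 ⟨has, hμa⟩))
  have h4 : σ B ≤ σ (F^[N] ⁻¹' E) :=
    measure_mono (inter_subset_right.trans (preimage_mono inter_subset_left))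
  rw [mul_assoc, ← ENNReal.mul_div_right_comm, ENNReal.div_le_iff hden0 hdent]
  calc δ₀ * (ρ univ * μ (E ∩ e)) ≤ μ (a ∩ F^[N] ⁻¹' e) * (M * σ a * μ (E ∩ e)) :=
        mul_le_mul' h3 (mul_le_mul_left ha _)
    _ = M * σ a * (μ (a ∩ F^[N] ⁻¹' e) * μ (E ∩ e)) := by ring
    _ ≤ M * σ a * (ε * μ B) := mul_le_mul_right h1 _
    _ = M * ε * (σ a * μ B) := by ring
    _ ≤ M * ε * (ε * σ B) := mul_le_mul_right h2 _
    _ ≤ M * ε * (ε * σ (F^[N] ⁻¹' E)) := by gcongr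
    _ = _ := by ring

/-- One coupling step: a part of `ρ`, depending only on the mass of `ρ`, is split off after `N + 1`
steps, and the remainder is again regular. -/
lemma exists_coupling_step [IsFiniteMeasure ν] (hD : HasCylinderDistortion ν F 𝒜 γ K₀ D)
    (h𝒜 : IsCountablePartition ν 𝒜) (hF : Measurable F) (hγ : 0 ≤ γ) (hγ1 : γ ≤ 1) (hK : 0 ≤ K)
    (hK₀0 : 0 ≤ K₀)
    (hK₀ : K₀ + γ * K < K) [IsProbabilityMeasure μ] (hinv : MeasurePreserving F μ μ)
    (hμ : IsCylinderRegular ν F 𝒜 γ K μ) (hmix : IsMixing F μ) :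
    ∃ (N : ℕ) (g : Measure X), IsFiniteMeasure g ∧ g univ ≠ 0 ∧
      ∀ ρ : Measure X, IsFiniteMeasure ρ → IsCylinderRegular ν F 𝒜 γ K ρ → ρ ≪ μ →
        ∃ ρ' : Measure X, IsFiniteMeasure ρ' ∧ IsCylinderRegular ν F 𝒜 γ K ρ' ∧ ρ' ≪ μ ∧
          ρ.map F^[N + 1] = ρ univ • g + ρ' := by
  obtain ⟨N, e, δ, he, hμe, hδ, hmin⟩ :=
    exists_minorization hD h𝒜 hF hγ hγ1 hK hK₀.le hinv hμ hmix
  set K₁ := K₀ + γ * K with hK₁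
  have hK₁0 : 0 ≤ K₁ := by positivity
  have hr0 : 0 < (K - K₁) / ((K + K₁) * Real.exp K) :=
    div_pos (by linarith) (mul_pos (by linarith) (Real.exp_pos K))
  set r : ℝ≥0 := ((K - K₁) / ((K + K₁) * Real.exp K)).toNNReal with hr
  have hrr : (r : ℝ) ≤ (K - K₁) / ((K + K₁) * Real.exp K) :=
    (Real.coe_toNNReal _ hr0.le).le
  have hrne : r ≠ 0 := (Real.toNNReal_pos.2 hr0).ne'
  have hμ₁ : IsCylinderRegular ν F 𝒜 γ K₁ μ := by
    have := hμ.map hD h𝒜 hF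
    rwa [hinv.map_eq] at this
  refine ⟨N, (r * δ) • μ.restrict e, inferInstance, ?_, fun ρ hfin hρ hρμ => ?_⟩
  · simp [hμe, hδ, hrne, ENNReal.smul_def]
  have hle := hmin ρ hfin hρ hρμ
  have hσ : IsCylinderRegular ν F 𝒜 γ K₁ (ρ.map F^[N + 1]) := by
    rw [Function.iterate_succ', ← Measure.map_map hF (hF.iterate N)]
    exact (hρ.map_iterate hD h𝒜 hF hγ hK₀.le N).map hD h𝒜 hF
  have hσμ : ρ.map F^[N + 1] ≪ μ := by
    have := hρμ.map (hF.iterate (N + 1))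
    rwa [(hinv.iterate (N + 1)).map_eq] at this
  have hh : IsCylinderRegular ν F 𝒜 γ K₁ ((δ * ρ univ) • μ.restrict e) :=
    (hμ₁.restrict h𝒜 he).const_smul _
  have hhfin : IsFiniteMeasure ((δ * ρ univ) • μ.restrict e) :=
    Measure.smul_finite _ (by finiteness)
  have hσfin : IsFiniteMeasure (ρ.map F^[N + 1]) := inferInstance
  have hsub := hσ.sub_smul hh hle hγ hγ1 hK₁0 hK₀ hrr
  set h := (δ * ρ univ) • μ.restrict e with hhdef
  have hr1 : r ≤ 1 := by
    have : (K - K₁) / ((K + K₁) * Real.exp K) ≤ 1 := by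
      rw [div_le_one (mul_pos (by linarith) (Real.exp_pos K))]
      nlinarith [Real.one_le_exp hK, Real.exp_pos K]
    exact_mod_cast hrr.trans this
  have hrle : r • h ≤ ρ.map F^[N + 1] := by
    refine le_trans (Measure.le_iff.2 fun s _ => ?_) hle
    simp only [Measure.smul_apply, ENNReal.smul_def, smul_eq_mul]
    exact mul_le_of_le_one_left zero_le (by exact_mod_cast hr1)
  refine ⟨ρ.map F^[N + 1] - r • h, isFiniteMeasure_of_le _ Measure.sub_le, hsub,
    Measure.sub_le.absolutelyContinuous.trans hσμ, ?_⟩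
  have h1 : ρ univ • ((r * δ) • μ.restrict e) = r • h := by
    ext s hs
    simp only [hhdef, Measure.smul_apply, ENNReal.smul_def, smul_eq_mul, ENNReal.coe_mul]
    ring
  rw [h1, add_comm (r • h), Measure.sub_add_cancel_of_le hrle]

/-- Exponential loss of memory: after `k` steps all regular probability measures agree up to a
part of mass `C * κ ^ k`. -/
lemma exists_common_part [IsFiniteMeasure ν] (hD : HasCylinderDistortion ν F 𝒜 γ K₀ D)
    (h𝒜 : IsCountablePartition ν 𝒜) (hF : Measurable F) (hγ : 0 ≤ γ) (hγ1 : γ ≤ 1) (hK : 0 ≤ K)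
    (hK₀0 : 0 ≤ K₀)
    (hK₀ : K₀ + γ * K < K) [IsProbabilityMeasure μ] (hinv : MeasurePreserving F μ μ)
    (hμ : IsCylinderRegular ν F 𝒜 γ K μ) (hmix : IsMixing F μ) :
    ∃ C κ : ℝ, 0 < C ∧ 0 < κ ∧ κ < 1 ∧ ∀ k : ℕ, ∃ G : Measure X,
      ∀ ρ : Measure X, IsProbabilityMeasure ρ → IsCylinderRegular ν F 𝒜 γ K ρ → ρ ≪ μ →
        ∃ w : Measure X, ρ.map F^[k] = G + w ∧ w univ ≤ ENNReal.ofReal (C * κ ^ k) := by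
  obtain ⟨N, g, hgfin, hg0, hstep⟩ :=
    exists_coupling_step hD h𝒜 hF hγ hγ1 hK hK₀0 hK₀ hinv hμ hmix
  -- the part split off depends on the remainder through its mass only, which is the same for all `ρ`
  have hiter : ∀ j : ℕ, ∃ G : Measure X,
      ∀ ρ : Measure X, IsProbabilityMeasure ρ → IsCylinderRegular ν F 𝒜 γ K ρ → ρ ≪ μ →
        ∃ w : Measure X, IsFiniteMeasure w ∧ IsCylinderRegular ν F 𝒜 γ K w ∧ w ≪ μ ∧
          ρ.map F^[(N + 1) * j] = G + w ∧ w univ = (1 - g univ) ^ j := by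
    intro j
    induction j with
    | zero =>
      refine ⟨0, fun ρ hρp hρ hρμ => ⟨ρ, inferInstance, hρ, hρμ, by simp, by simp⟩⟩
    | succ j ih =>
      obtain ⟨G, hG⟩ := ih
      refine ⟨G.map F^[N + 1] + (1 - g univ) ^ j • g, fun ρ hρp hρ hρμ => ?_⟩
      obtain ⟨w, hwfin, hw, hwμ, heq, hmass⟩ := hG ρ hρp hρ hρμ
      obtain ⟨w', hw'fin, hw', hw'μ, heq'⟩ := hstep w hwfin hw hwμ
      refine ⟨w', hw'fin, hw', hw'μ, ?_, ?_⟩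
      · have : F^[(N + 1) * (j + 1)] = F^[N + 1] ∘ F^[(N + 1) * j] := by
          rw [← Function.iterate_add]; congr 1; ring
        rw [this, ← Measure.map_map (hF.iterate _) (hF.iterate _), heq,
          Measure.map_add _ _ (hF.iterate _), heq', hmass, add_assoc]
      · have h1 : w univ = w univ * g univ + w' univ := by
          have := congrArg (fun m : Measure X => m univ) heq'
          simp only [Measure.map_apply (hF.iterate (N + 1)) MeasurableSet.univ, preimage_univ,
            Measure.add_apply, Measure.smul_apply, smul_eq_mul] at this
          exact this
        have h2 : w' univ = w univ - w univ * g univ := by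
          refine ENNReal.eq_sub_of_add_eq (by finiteness) ?_
          rw [add_comm]; exact h1.symm
        rw [h2, pow_succ, ENNReal.mul_sub (fun _ _ => by finiteness), mul_one, hmass]
  set β₀ : ℝ≥0∞ := 1 - g univ with hβ₀
  have hβ₀1 : β₀ < 1 := ENNReal.sub_lt_self ENNReal.one_ne_top one_ne_zero hg0
  set β : ℝ := max β₀.toReal (1 / 2) with hβ
  have hβpos : 0 < β := by positivity
  have hβ1 : β < 1 := max_lt (by
    have := (ENNReal.toReal_lt_toReal hβ₀1.ne_top ENNReal.one_ne_top).2 hβ₀1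
    simpa using this) (by norm_num)
  have hβle : β₀ ≤ ENNReal.ofReal β := by
    rw [← ENNReal.ofReal_toReal hβ₀1.ne_top]
    exact ENNReal.ofReal_le_ofReal (le_max_left _ _)
  set κ : ℝ := β ^ (((N + 1 : ℕ) : ℝ)⁻¹) with hκ
  have hκN : κ ^ (N + 1) = β := Real.rpow_inv_natCast_pow hβpos.le N.succ_ne_zero
  have hκ0 : 0 < κ := Real.rpow_pos_of_pos hβpos _
  have hκ1 : κ < 1 := Real.rpow_lt_one hβpos.le hβ1 (by positivity)
  refine ⟨β⁻¹, κ, by positivity, hκ0, hκ1, fun k => ?_⟩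
  obtain ⟨G, hG⟩ := hiter (k / (N + 1))
  refine ⟨G.map F^[k % (N + 1)], fun ρ hρp hρ hρμ => ?_⟩
  obtain ⟨w, -, -, -, heq, hmass⟩ := hG ρ hρp hρ hρμ
  refine ⟨w.map F^[k % (N + 1)], ?_, ?_⟩
  · have : F^[k] = F^[k % (N + 1)] ∘ F^[(N + 1) * (k / (N + 1))] := by
      rw [← Function.iterate_add, Nat.mod_add_div]
    rw [this, ← Measure.map_map (hF.iterate _) (hF.iterate _), heq,
      Measure.map_add _ _ (hF.iterate _)]
  · rw [Measure.map_apply (hF.iterate _) MeasurableSet.univ, preimage_univ, hmass]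
    refine (pow_le_pow_left' hβle _).trans ?_
    rw [← ENNReal.ofReal_pow hβpos.le]
    refine ENNReal.ofReal_le_ofReal ?_
    rw [le_inv_mul_iff₀ hβpos, ← pow_succ', ← hκN, ← pow_mul]
    refine pow_le_pow_of_le_one hκ0.le hκ1.le ?_
    have := Nat.div_add_mod k (N + 1)
    have h2 : k % (N + 1) < N + 1 := Nat.mod_lt k (Nat.succ_pos N)
    rw [mul_add, mul_one]
    omega

end Coupling

/-! ### Itineraries and the regularity of the invariant measure -/

section Itinerary

variable {X : Type*} {F : X → X} {𝒜 : Set (Set X)}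

open Classical in
/-- The partition element that contains `x`, if there is one. -/
noncomputable def symbol (𝒜 : Set (Set X)) (x : X) : Option 𝒜 :=
  if h : ∃ a : 𝒜, x ∈ (a : Set X) then some h.choose else none

/-- The first `m` symbols of the orbit of `x`. -/
noncomputable def itinerary (F : X → X) (𝒜 : Set (Set X)) (m : ℕ) (x : X) : Fin m → Option 𝒜 :=
  fun i => symbol 𝒜 (F^[i] x)

lemma symbol_eq_some (hd : 𝒜.PairwiseDisjoint id) {x : X} {a : 𝒜} :
    symbol 𝒜 x = some a ↔ x ∈ (a : Set X) := by
  classical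
  unfold symbol
  constructor
  · intro h
    split_ifs at h with hx
    rw [← Option.some_injective _ h]; exact hx.choose_spec
  · intro h
    have hx : ∃ a : 𝒜, x ∈ (a : Set X) := ⟨a, h⟩
    rw [dif_pos hx]
    congr 1
    by_contra hne
    exact disjoint_left.1 (hd hx.choose.2 a.2 fun hc => hne (Subtype.ext hc)) hx.choose_spec h

lemma symbol_eq_none {x : X} : symbol 𝒜 x = none ↔ x ∉ ⋃₀ 𝒜 := by
  classical
  unfold symbol
  split_ifs with h
  · obtain ⟨a, ha⟩ := h
    simp only [false_iff, not_not]
    exact ⟨a, a.2, ha⟩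
  · simp only [true_iff]
    rintro ⟨a, ha, hx⟩
    exact h ⟨⟨a, ha⟩, hx⟩

/-- The fibre of the itinerary map through a point whose orbit stays in the partition elements is
a cylinder. -/
lemma exists_cylinder_eq_fibre (hd : 𝒜.PairwiseDisjoint id) (hne : 𝒜.Nonempty) {m : ℕ} {x : X}
    (hx : ∀ i < m, F^[i] x ∈ ⋃₀ 𝒜) :
    ∃ c : ℕ → Set X, (∀ i, c i ∈ 𝒜) ∧
      itinerary F 𝒜 m ⁻¹' {itinerary F 𝒜 m x} = dynCylinder F c m := by
  classical
  have h1 : ∀ i, ∃ a ∈ 𝒜, i < m → F^[i] x ∈ a := fun i => by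
    by_cases hi : i < m
    · obtain ⟨a, ha, hxa⟩ := hx i hi
      exact ⟨a, ha, fun _ => hxa⟩
    · exact ⟨hne.some, hne.some_mem, fun h => absurd h hi⟩
  choose c hc hxc using h1
  refine ⟨c, hc, ?_⟩
  ext y
  have key : ∀ i, i < m → symbol 𝒜 (F^[i] x) = some ⟨c i, hc i⟩ := fun i hi =>
    (symbol_eq_some hd).2 (hxc i hi)
  constructor
  · intro hy i hi
    have h2 : symbol 𝒜 (F^[i] y) = symbol 𝒜 (F^[i] x) := congrFun (mem_singleton_iff.1 hy) ⟨i, hi⟩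
    rw [key i hi] at h2
    exact (symbol_eq_some hd).1 h2
  · intro hy
    refine mem_singleton_iff.2 (funext fun i => ?_)
    change symbol 𝒜 (F^[i] y) = symbol 𝒜 (F^[i] x)
    rw [key i i.2]
    exact (symbol_eq_some hd).2 (hy i i.2)

variable [MeasurableSpace X] {ν μ : Measure X} {γ K K₀ : ℝ} {D : ℝ≥0}

lemma IsCountablePartition.measurableSet_symbol_fibre (h𝒜 : IsCountablePartition ν 𝒜)
    (o : Option 𝒜) : MeasurableSet (symbol 𝒜 ⁻¹' {o}) := by
  cases o with
  | none =>
    have : symbol 𝒜 ⁻¹' {none} = (⋃₀ 𝒜)ᶜ := by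
      ext x; simp only [mem_preimage, mem_singleton_iff, mem_compl_iff]; exact symbol_eq_none
    rw [this]
    exact (MeasurableSet.sUnion h𝒜.countable h𝒜.measurableSet).compl
  | some a =>
    have : symbol 𝒜 ⁻¹' {some a} = a := by
      ext x
      simp only [mem_preimage, mem_singleton_iff]
      exact symbol_eq_some h𝒜.disjoint
    rw [this]
    exact h𝒜.measurableSet a a.2

lemma IsCountablePartition.measurable_itinerary (h𝒜 : IsCountablePartition ν 𝒜)
    (hF : Measurable F) (m : ℕ) : Measurable[_, ⊤] (itinerary F 𝒜 m) := by
  have := h𝒜.countable.to_subtype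
  have hfib : ∀ w, MeasurableSet (itinerary F 𝒜 m ⁻¹' {w}) := fun w => by
    have : itinerary F 𝒜 m ⁻¹' {w} = ⋂ i : Fin m, F^[i] ⁻¹' (symbol 𝒜 ⁻¹' {w i}) := by
      ext x
      simp only [mem_preimage, mem_singleton_iff, mem_iInter]
      exact funext_iff
    rw [this]
    exact MeasurableSet.iInter fun i => hF.iterate i (h𝒜.measurableSet_symbol_fibre _)
  intro s _
  rw [← biUnion_preimage_singleton]
  exact MeasurableSet.biUnion s.to_countable fun w _ => hfib w

lemma IsCountablePartition.ae_iterate_mem (h𝒜 : IsCountablePartition ν 𝒜)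
    (hF : Measure.QuasiMeasurePreserving F ν ν) : ∀ᵐ x ∂ν, ∀ i, F^[i] x ∈ ⋃₀ 𝒜 := by
  rw [ae_all_iff]
  intro i
  have h0 : ∀ᵐ x ∂ν, x ∈ ⋃₀ 𝒜 := h𝒜.cover
  exact (hF.iterate i).ae h0

lemma IsCylinderRegular.zero : IsCylinderRegular ν F 𝒜 γ K (0 : Measure X) where
  ac := Measure.AbsolutelyContinuous.zero ν
  regular := by simp

/-- A measure whose density depends only on the first `n` symbols becomes regular after `n`
steps. -/
lemma isCylinderRegular_map_withDensity [IsFiniteMeasure ν]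
    (hD : HasCylinderDistortion ν F 𝒜 γ K₀ D) (h𝒜 : IsCountablePartition ν 𝒜) (hne : 𝒜.Nonempty)
    (hF : Measurable F) (hγ : 0 ≤ γ) (hK : 0 ≤ K) (hK₀ : K₀ + γ * K ≤ K) (n : ℕ)
    (u : (Fin n → Option 𝒜) → ℝ≥0∞) :
    IsCylinderRegular ν F 𝒜 γ K
      ((ν.withDensity fun x => u (itinerary F 𝒜 n x)).map F^[n]) := by
  have hcount := h𝒜.countable.to_subtype
  have hm : ∀ w, MeasurableSet (itinerary F 𝒜 n ⁻¹' {w}) := fun w =>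
    h𝒜.measurable_itinerary hF n (by trivial)
  have hdec : ν = Measure.sum fun w => ν.restrict (itinerary F 𝒜 n ⁻¹' {w}) := by
    have hdisj : Pairwise (Function.onFun Disjoint
        fun w : Fin n → Option 𝒜 => itinerary F 𝒜 n ⁻¹' {w}) := fun w w' hww =>
      Disjoint.preimage _ (disjoint_singleton.2 hww)
    rw [← Measure.restrict_iUnion hdisj hm, ← preimage_iUnion, iUnion_of_singleton,
      preimage_univ, Measure.restrict_univ]
  rw [hdec, withDensity_sum, Measure.map_sum (hF.iterate n).aemeasurable]
  refine IsCylinderRegular.sum fun w => ?_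
  rw [← hdec]
  have hconst : (ν.restrict (itinerary F 𝒜 n ⁻¹' {w})).withDensity
      (fun x => u (itinerary F 𝒜 n x)) = u w • ν.restrict (itinerary F 𝒜 n ⁻¹' {w}) := by
    rw [← withDensity_const]
    refine withDensity_congr_ae ?_
    filter_upwards [ae_restrict_mem (hm w)] with x hx
    rw [mem_singleton_iff.1 hx]
  rw [hconst, Measure.map_smul]
  refine IsCylinderRegular.const_smul ?_ _
  by_cases h0 : ν (itinerary F 𝒜 n ⁻¹' {w}) = 0
  · rw [Measure.restrict_eq_zero.2 h0, Measure.map_zero]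
    exact IsCylinderRegular.zero
  · have hgood := h𝒜.ae_iterate_mem (hD.quasiMeasurePreserving h𝒜 hF)
    obtain ⟨x, hx, hxw⟩ : ∃ x, (∀ i, F^[i] x ∈ ⋃₀ 𝒜) ∧ x ∈ itinerary F 𝒜 n ⁻¹' {w} := by
      by_contra! hc
      exact h0 (measure_mono_null (fun y hy hgy => hc y hgy hy) hgood)
    obtain ⟨c, hc, heq⟩ := exists_cylinder_eq_fibre h𝒜.disjoint hne (m := n) fun i _ => hx i
    rw [mem_singleton_iff.1 hxw] at heq
    rw [heq]
    exact (isCylinderRegular_self hK hγ).map_iterate_restrict_cylinder hD h𝒜 hF hγ hK₀ hc n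

end Itinerary

/-- An absolutely continuous invariant probability measure is regular. Its density is approximated
in `L¹` by densities depending on finitely many symbols; these become regular under iteration,
with a uniform constant, while the invariant measure does not change. -/
lemma isCylinderRegular_of_invariant {X : Type*} [MetricSpace X] [MeasurableSpace X] [BorelSpace X]
    {F : X → X} {𝒜 : Set (Set X)} {ν μ : Measure X} {γ K K₀ : ℝ} {D : ℝ≥0}
    [IsFiniteMeasure ν] [IsProbabilityMeasure μ]
    (hD : HasCylinderDistortion ν F 𝒜 γ K₀ D) (h𝒜 : IsCountablePartition ν 𝒜) (hne : 𝒜.Nonempty)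
    (hF : Measurable F) (hγ : 0 ≤ γ) (hK : 0 ≤ K) (hK₀ : K₀ + γ * K ≤ K)
    {lam R : ℝ} (hl : 1 < lam)
    (hexp : ∀ a ∈ 𝒜, ∀ z ∈ a, ∀ z' ∈ a, lam * dist z z' ≤ dist (F z) (F z'))
    (hR : ∀ x y : X, dist x y ≤ R) (hinv : MeasurePreserving F μ μ) (hμν : μ ≪ ν) :
    IsCylinderRegular ν F 𝒜 γ K μ := by
  have hX : Nonempty X := by
    by_contra hc
    rw [not_nonempty_iff] at hc
    have h1 := measure_univ (μ := μ)
    rw [univ_eq_empty_iff.2 hc, measure_empty] at h1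
    exact zero_ne_one h1
  set h : X → ℝ := fun x => (μ.rnDeriv ν x).toReal with hh
  have hhi : Integrable h ν := Measure.integrable_toReal_rnDeriv
  have hh0 : ∀ x, 0 ≤ h x := fun x => ENNReal.toReal_nonneg
  have hμB : ∀ B, MeasurableSet B → μ B = ∫⁻ x in B, ENNReal.ofReal (h x) ∂ν := by
    intro B hB
    rw [← Measure.setLIntegral_rnDeriv hμν B]
    refine setLIntegral_congr_fun_ae hB ?_
    filter_upwards [μ.rnDeriv_lt_top ν] with x hx _
    rw [hh, ENNReal.ofReal_toReal hx.ne]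
  -- approximation of the density by a function of finitely many symbols
  have happrox : ∀ ε : ℝ≥0∞, ε ≠ 0 → ∃ n : ℕ, ∃ u : (Fin n → Option 𝒜) → ℝ≥0∞,
      Measurable (fun x => u (itinerary F 𝒜 n x)) ∧ ∀ B, MeasurableSet B →
        μ B ≤ ∫⁻ x in B, u (itinerary F 𝒜 n x) ∂ν + ε ∧
        ∫⁻ x in B, u (itinerary F 𝒜 n x) ∂ν ≤ μ B + ε := by
    intro ε hε
    obtain ⟨g, hg, -⟩ := (memLp_one_iff_integrable.2 hhi).exists_boundedContinuous_eLpNorm_sub_le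
      (by simp) (ENNReal.half_pos hε).ne'
    set rep : ℕ → X → X := fun n x => Function.invFun (itinerary F 𝒜 n) (itinerary F 𝒜 n x)
      with hrep
    have hrepeq : ∀ n x, itinerary F 𝒜 n (rep n x) = itinerary F 𝒜 n x := fun n x =>
      Function.invFun_eq ⟨x, rfl⟩
    have hgm : ∀ n, Measurable fun x => g (rep n x) := fun n => by
      have : Measurable[⊤] fun w => g (Function.invFun (itinerary F 𝒜 n) w) := measurable_from_top
      exact this.comp (h𝒜.measurable_itinerary hF n)
    have hlim : Tendsto (fun n => ∫⁻ x, ‖g (rep n x) - g x‖ₑ ∂ν) atTop (𝓝 0) := by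
      have h1 := tendsto_lintegral_of_dominated_convergence (μ := ν)
        (F := fun n x => ‖g (rep n x) - g x‖ₑ) (f := fun _ => 0)
        (fun _ => ENNReal.ofReal (2 * ‖g‖))
        (fun n => ((hgm n).sub g.continuous.measurable).enorm)
        (fun n => ae_of_all _ fun x => by
          simp only [← ofReal_norm]
          refine ENNReal.ofReal_le_ofReal ?_
          rw [← dist_eq_norm]
          exact g.dist_le_two_norm _ _) (by simp [lintegral_const]; finiteness) ?_
      · simpa using h1
      · filter_upwards [h𝒜.ae_iterate_mem (hD.quasiMeasurePreserving h𝒜 hF)] with x hx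
        have hconv : Tendsto (fun n => rep n x) atTop (𝓝 x) := by
          rw [tendsto_iff_dist_tendsto_zero]
          have hgeo : Tendsto (fun n : ℕ => (lam⁻¹) ^ n * R) atTop (𝓝 0) := by
            have := (tendsto_pow_atTop_nhds_zero_of_lt_one (r := lam⁻¹) (by positivity)
              (inv_lt_one_of_one_lt₀ hl)).mul_const R
            simpa using this
          refine squeeze_zero (fun _ => dist_nonneg) (fun n => ?_) hgeo
          obtain ⟨c, hc, heq⟩ := exists_cylinder_eq_fibre h𝒜.disjoint hne (m := n) fun i _ => hx i
          have h2 : rep n x ∈ dynCylinder F c n := heq ▸ hrepeq n x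
          have h3 : x ∈ dynCylinder F c n := heq ▸ rfl
          exact dist_le_of_mem_cylinder hl hexp hR n c hc _ h2 _ h3
        have h4 := ((g.continuous.tendsto x).comp hconv).sub_const (g x)
        have h5 := h4.enorm
        simpa using h5
    obtain ⟨n, hn⟩ := (hlim.eventually (ge_mem_nhds (ENNReal.half_pos hε))).exists
    refine ⟨n, fun w => ENNReal.ofReal (g (Function.invFun (itinerary F 𝒜 n) w)),
      (hgm n).ennreal_ofReal, fun B hB => ?_⟩
    have htot : ∫⁻ x in B, ‖g (rep n x) - h x‖ₑ ∂ν ≤ ε := by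
      calc ∫⁻ x in B, ‖g (rep n x) - h x‖ₑ ∂ν ≤ ∫⁻ x, ‖g (rep n x) - h x‖ₑ ∂ν :=
            setLIntegral_le_lintegral _ _
        _ ≤ ∫⁻ x, (‖g (rep n x) - g x‖ₑ + ‖h x - g x‖ₑ) ∂ν := by
            refine lintegral_mono fun x => ?_
            have : g (rep n x) - h x = (g (rep n x) - g x) - (h x - g x) := by ring
            rw [this]; exact enorm_sub_le
        _ = ∫⁻ x, ‖g (rep n x) - g x‖ₑ ∂ν + ∫⁻ x, ‖h x - g x‖ₑ ∂ν :=
            lintegral_add_left ((hgm n).sub g.continuous.measurable).enorm _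
        _ ≤ ε / 2 + ε / 2 := add_le_add hn (by
            rw [eLpNorm_one_eq_lintegral_enorm] at hg; exact hg)
        _ = ε := ENNReal.add_halves ε
    have hpt : ∀ a b : ℝ, ENNReal.ofReal a ≤ ENNReal.ofReal b + ‖a - b‖ₑ := fun a b => by
      rw [← ofReal_norm]
      refine (ENNReal.ofReal_le_ofReal (q := b + ‖a - b‖) ?_).trans ENNReal.ofReal_add_le
      have := le_abs_self (a - b)
      rw [Real.norm_eq_abs]; linarith
    constructor
    · rw [hμB B hB]
      refine (lintegral_mono fun x => hpt (h x) (g (rep n x))).trans ?_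
      rw [lintegral_add_left (hgm n).ennreal_ofReal]
      refine add_le_add le_rfl (le_trans (le_of_eq ?_) htot)
      exact lintegral_congr fun x => by rw [enorm_sub_rev]
    · rw [hμB B hB]
      refine (lintegral_mono fun x => hpt (g (rep n x)) (h x)).trans ?_
      have hhm : Measurable h := (Measure.measurable_rnDeriv μ ν).ennreal_toReal
      have hgh : Measurable fun x => ‖g (rep n x) - h x‖ₑ := ((hgm n).sub hhm).enorm
      rw [lintegral_add_right _ hgh]
      exact add_le_add le_rfl htot
  refine ⟨hμν, fun k hk c hc E E' hE hE' hEm hEm' => ?_⟩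
  set b := ENNReal.ofReal (Real.exp (K * γ ^ k)) with hb
  refine ENNReal.le_of_forall_pos_le_add fun δ hδ _ => ?_
  set T : ℝ≥0∞ := ν univ + b * ν univ + 1 with hT
  have hTt : T ≠ ∞ := by finiteness
  have hT0 : T ≠ 0 := by simp [hT]
  obtain ⟨n, u, hum, hu⟩ := happrox (δ / T) (ENNReal.div_ne_zero.2 ⟨by simpa using hδ.ne', hTt⟩)
  have hreg := isCylinderRegular_map_withDensity hD h𝒜 hne hF hγ hK hK₀ n u
  have hFn := hF.iterate n
  have h1 := hreg.regular k hk c hc E E' hE hE' hEm hEm'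
  rw [Measure.map_apply hFn hEm, Measure.map_apply hFn hEm', withDensity_apply _ (hFn hEm),
    withDensity_apply _ (hFn hEm')] at h1
  have h2 := (hu _ (hFn hEm)).1
  have h3 := (hu _ (hFn hEm')).2
  rw [(hinv.iterate n).measure_preimage hEm.nullMeasurableSet] at h2
  rw [(hinv.iterate n).measure_preimage hEm'.nullMeasurableSet] at h3
  set I := ∫⁻ x in F^[n] ⁻¹' E, u (itinerary F 𝒜 n x) ∂ν
  set I' := ∫⁻ x in F^[n] ⁻¹' E', u (itinerary F 𝒜 n x) ∂ν
  calc μ E * ν E' ≤ (I + δ / T) * ν E' := mul_le_mul_left h2 _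
    _ = I * ν E' + δ / T * ν E' := by ring
    _ ≤ b * (I' * ν E) + δ / T * ν E' := add_le_add h1 le_rfl
    _ ≤ b * ((μ E' + δ / T) * ν E) + δ / T * ν E' :=
        add_le_add (mul_le_mul_right (mul_le_mul_left h3 _) _) le_rfl
    _ = b * (μ E' * ν E) + δ / T * (ν E' + b * ν E) := by ring
    _ ≤ b * (μ E' * ν E) + δ / T * T := by
        refine add_le_add le_rfl (mul_le_mul_right ?_ _)
        exact (add_le_add (measure_mono (subset_univ _))
          (mul_le_mul_right (measure_mono (subset_univ _)) _)).trans le_self_add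
    _ = _ := by rw [ENNReal.div_mul_cancel hT0 hTt]

/-! ### Conditional expectations on cylinders -/

section CondExp

variable {X : Type*} [MeasurableSpace X] {ν μ : Measure X} {F : X → X} {𝒜 : Set (Set X)}
  {γ K K₀ : ℝ} {D : ℝ≥0}

/-- The filtration whose `m`-th `σ`-algebra is generated by the first `m` symbols. -/
noncomputable def itineraryFiltration (h𝒜 : IsCountablePartition ν 𝒜) (hF : Measurable F) :
    Filtration ℕ (inferInstance : MeasurableSpace X) where
  seq m := MeasurableSpace.comap (itinerary F 𝒜 m) ⊤
  mono' := by
    intro i j hij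
    have : itinerary F 𝒜 i = (fun w k => w (Fin.castLE hij k)) ∘ itinerary F 𝒜 j := rfl
    simp only
    rw [this, ← MeasurableSpace.comap_comp]
    exact MeasurableSpace.comap_mono le_top
  le' m := (h𝒜.measurable_itinerary hF m).comap_le

/-- A conditional expectation given the first `m` symbols is an average over a cylinder. -/
lemma condExp_itinerary_ae_eq [IsFiniteMeasure μ] (h𝒜 : IsCountablePartition ν 𝒜)
    (hne : 𝒜.Nonempty) (hF : Measurable F) (hμν : μ ≪ ν)
    (hq : Measure.QuasiMeasurePreserving F ν ν) (m : ℕ) :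
    ∀ᵐ x ∂μ, ∃ c : ℕ → Set X, (∀ i, c i ∈ 𝒜) ∧ x ∈ dynCylinder F c m ∧
      μ (dynCylinder F c m) ≠ 0 ∧ ∀ f : X → ℝ, Integrable f μ →
        (μ[f | itineraryFiltration h𝒜 hF m]) x =
          (μ.real (dynCylinder F c m))⁻¹ * ∫ y in dynCylinder F c m, f y ∂μ := by
  have hcount := h𝒜.countable.to_subtype
  have hpos : ∀ᵐ x ∂μ, μ (itinerary F 𝒜 m ⁻¹' {itinerary F 𝒜 m x}) ≠ 0 := by
    have h1 : {x | ¬ μ (itinerary F 𝒜 m ⁻¹' {itinerary F 𝒜 m x}) ≠ 0} ⊆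
        ⋃ w ∈ {w | μ (itinerary F 𝒜 m ⁻¹' {w}) = 0}, itinerary F 𝒜 m ⁻¹' {w} := fun x hx => by
      simp only [mem_iUnion]
      exact ⟨itinerary F 𝒜 m x, not_not.1 hx, rfl⟩
    refine measure_mono_null h1 ((measure_biUnion_null_iff (to_countable _)).2 fun w hw => hw)
  filter_upwards [hpos, hμν.ae_le (h𝒜.ae_iterate_mem hq)] with x hx hgood
  obtain ⟨c, hc, heq⟩ := exists_cylinder_eq_fibre (F := F) h𝒜.disjoint hne (m := m)
    fun i _ => hgood i
  refine ⟨c, hc, heq ▸ rfl, heq ▸ hx, fun f hf => ?_⟩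
  rw [← heq]
  set s := itinerary F 𝒜 m ⁻¹' {itinerary F 𝒜 m x} with hs
  have hsm : MeasurableSet[itineraryFiltration h𝒜 hF m] s := ⟨_, trivial, rfl⟩
  set g := μ[f | itineraryFiltration h𝒜 hF m] with hg
  have hgm : Measurable[itineraryFiltration h𝒜 hF m] g := stronglyMeasurable_condExp.measurable
  have hconst : ∀ y ∈ s, g y = g x := by
    intro y hy
    obtain ⟨u, -, hu⟩ := hgm (measurableSet_singleton (g x))
    have hx' : x ∈ itinerary F 𝒜 m ⁻¹' u := by rw [hu]; rfl
    have hy' : y ∈ itinerary F 𝒜 m ⁻¹' u := by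
      rw [mem_preimage, mem_singleton_iff.1 hy]; exact hx'
    rw [hu] at hy'
    exact hy'
  have h1 : ∫ y in s, g y ∂μ = ∫ y in s, f y ∂μ :=
    setIntegral_condExp ((itineraryFiltration h𝒜 hF).le m) hf hsm
  rw [setIntegral_congr_fun (((itineraryFiltration h𝒜 hF).le m) s hsm) (g := fun _ => g x) hconst,
    setIntegral_const, smul_eq_mul] at h1
  rw [← h1, ← mul_assoc, inv_mul_cancel₀, one_mul]
  rw [measureReal_def]
  exact (ENNReal.toReal_pos hx (measure_ne_top _ _)).ne'

/-- Hölder's inequality for a measure of small mass. -/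
lemma abs_integral_rpow_le_measure {m : Measure X} [IsFiniteMeasure m] {φ : X → ℝ}
    (hφ : Measurable φ) {B : ℝ} (hB : ∀ x, |φ x| ≤ B) {q : ℝ} (hq : 1 < q) {δ : ℝ} (hδ : 0 ≤ δ)
    (hm : m univ ≤ ENNReal.ofReal δ) :
    (∫ x, |φ x| ∂m) ^ q ≤ δ ^ (q - 1) * ∫ x, |φ x| ^ q ∂m := by
  have hq0 : 0 < q := by linarith
  have hconj : q.HolderConjugate (q / (q - 1)) := Real.HolderConjugate.conjExponent hq
  have hmem : MemLp (fun x => |φ x|) (ENNReal.ofReal q) m :=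
    MemLp.of_bound hφ.abs.aestronglyMeasurable B (ae_of_all _ fun x => by simpa using hB x)
  have h1 := integral_mul_le_Lp_mul_Lq_of_nonneg hconj (μ := m) (f := fun x => |φ x|)
    (g := fun _ => (1 : ℝ)) (ae_of_all _ fun _ => abs_nonneg _) (ae_of_all _ fun _ => zero_le_one)
    hmem (memLp_const 1)
  simp only [mul_one, Real.one_rpow, integral_const, smul_eq_mul] at h1
  have hI0 : 0 ≤ ∫ x, |φ x| ^ q ∂m := integral_nonneg fun x => Real.rpow_nonneg (abs_nonneg _) q
  have h2 := Real.rpow_le_rpow (integral_nonneg fun x => abs_nonneg (φ x)) h1 hq0.le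
  have hmr : m.real univ ≤ δ := by
    rw [measureReal_def]; exact ENNReal.toReal_le_of_le_ofReal hδ hm
  rw [Real.mul_rpow (Real.rpow_nonneg hI0 _) (Real.rpow_nonneg measureReal_nonneg _),
    ← Real.rpow_mul hI0, ← Real.rpow_mul measureReal_nonneg, one_div_mul_cancel hq0.ne',
    Real.rpow_one, one_div_div, div_mul_cancel₀ _ hq0.ne'] at h2
  refine h2.trans ?_
  rw [mul_comm]
  exact mul_le_mul_of_nonneg_right
    (Real.rpow_le_rpow measureReal_nonneg hmr (by linarith)) hI0

/-- Two measures that agree up to small parts give close integrals. The bound is in terms of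
`q`-th moments with respect to the two measures themselves. -/
lemma abs_integral_sub_rpow_le {ρ₁ ρ₂ G w₁ w₂ : Measure X} [IsProbabilityMeasure ρ₁]
    [IsProbabilityMeasure ρ₂] (h₁ : ρ₁ = G + w₁) (h₂ : ρ₂ = G + w₂) {δ : ℝ} (hδ : 0 ≤ δ)
    (hw₁ : w₁ univ ≤ ENNReal.ofReal δ) (hw₂ : w₂ univ ≤ ENNReal.ofReal δ) {φ : X → ℝ}
    (hφ : Measurable φ) {B : ℝ} (hB : ∀ x, |φ x| ≤ B) {q : ℝ} (hq : 1 < q) :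
    |∫ x, φ x ∂ρ₁ - ∫ x, φ x ∂ρ₂| ^ q ≤
      (2 * δ) ^ (q - 1) * (∫ x, |φ x| ^ q ∂ρ₁ + ∫ x, |φ x| ^ q ∂ρ₂) := by
  have hq0 : 0 < q := by linarith
  have hGle : G ≤ ρ₁ := h₁ ▸ Measure.le_add_right le_rfl
  have hw₁le : w₁ ≤ ρ₁ := h₁ ▸ Measure.le_add_left le_rfl
  have hw₂le : w₂ ≤ ρ₂ := h₂ ▸ Measure.le_add_left le_rfl
  have := isFiniteMeasure_of_le _ hGle
  have := isFiniteMeasure_of_le _ hw₁le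
  have := isFiniteMeasure_of_le _ hw₂le
  have hi : ∀ m : Measure X, IsFiniteMeasure m → Integrable φ m := fun m _ =>
    Integrable.of_bound hφ.aestronglyMeasurable B (ae_of_all _ hB)
  have hiq : ∀ m : Measure X, IsFiniteMeasure m → Integrable (fun x => |φ x| ^ q) m := fun m _ =>
    Integrable.of_bound (hφ.abs.pow_const q).aestronglyMeasurable (B ^ q) (ae_of_all _ fun x => by
      rw [Real.norm_of_nonneg (Real.rpow_nonneg (abs_nonneg _) q)]
      exact Real.rpow_le_rpow (abs_nonneg _) (hB x) hq0.le)
  have h3 : |∫ x, φ x ∂ρ₁ - ∫ x, φ x ∂ρ₂| ≤ ∫ x, |φ x| ∂(w₁ + w₂) := by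
    rw [h₁, h₂, integral_add_measure (hi _ inferInstance) (hi _ inferInstance),
      integral_add_measure (hi _ inferInstance) (hi _ inferInstance),
      integral_add_measure (hi _ inferInstance).abs (hi _ inferInstance).abs, add_sub_add_left_eq_sub]
    exact (abs_sub _ _).trans (add_le_add abs_integral_le_integral_abs abs_integral_le_integral_abs)
  have h4 := abs_integral_rpow_le_measure (m := w₁ + w₂) hφ hB hq (δ := 2 * δ) (by positivity) (by
    rw [Measure.add_apply, two_mul, ENNReal.ofReal_add hδ hδ]
    exact add_le_add hw₁ hw₂)
  refine (Real.rpow_le_rpow (abs_nonneg _) h3 hq0.le).trans (h4.trans ?_)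
  refine mul_le_mul_of_nonneg_left ?_ (by positivity)
  rw [integral_add_measure (hiq _ inferInstance) (hiq _ inferInstance)]
  exact add_le_add
    (integral_mono_measure hw₁le (ae_of_all _ fun x => Real.rpow_nonneg (abs_nonneg _) q)
      (hiq _ inferInstance))
    (integral_mono_measure hw₂le (ae_of_all _ fun x => Real.rpow_nonneg (abs_nonneg _) q)
      (hiq _ inferInstance))

end CondExp

/-! ### Martingale approximation of Birkhoff sums -/

section MartingaleApproximation

variable {X : Type*} [MeasurableSpace X] {ν μ : Measure X} {F : X → X} {𝒜 : Set (Set X)}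
  {γ K K₀ : ℝ} {D : ℝ≥0}

/-- Conditional expectations of the future decay exponentially, in `L^q` with `q > 1`: given the
first `m` symbols, the law of `F^[m + k] x` and the invariant law coincide up to a mass `C * κ ^ k`. -/
lemma exists_eLpNorm_condExp_le [IsFiniteMeasure ν] (hD : HasCylinderDistortion ν F 𝒜 γ K₀ D)
    (h𝒜 : IsCountablePartition ν 𝒜) (hne : 𝒜.Nonempty) (hF : Measurable F) (hγ : 0 ≤ γ)
    (hγ1 : γ ≤ 1) (hK : 0 ≤ K) (hK₀0 : 0 ≤ K₀) (hK₀ : K₀ + γ * K < K) [IsProbabilityMeasure μ]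
    (hinv : MeasurePreserving F μ μ) (hμν : μ ≪ ν) (hμ : IsCylinderRegular ν F 𝒜 γ K μ)
    (hmix : IsMixing F μ) {q : ℝ} (hq : 1 < q) :
    ∃ C κ : ℝ, 0 < C ∧ 0 < κ ∧ κ < 1 ∧ ∀ φ : X → ℝ, Measurable φ → (∃ B, ∀ x, |φ x| ≤ B) →
      ∫ x, φ x ∂μ = 0 → ∀ m k : ℕ,
      eLpNorm (μ[fun x => φ (F^[m + k] x) | itineraryFiltration h𝒜 hF m]) (ENNReal.ofReal q) μ ≤
        ENNReal.ofReal (C * κ ^ k) * eLpNorm φ (ENNReal.ofReal q) μ := by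
  obtain ⟨C, κ, hC, hκ, hκ1, hcommon⟩ :=
    exists_common_part hD h𝒜 hF hγ hγ1 hK hK₀0 hK₀ hinv hμ hmix
  have hq0 : 0 < q := by linarith
  have hs : 0 < (q - 1) / q := div_pos (by linarith) hq0
  refine ⟨(2 * C) ^ ((q - 1) / q) * 2 ^ (1 / q), κ ^ ((q - 1) / q), by positivity, by positivity,
    Real.rpow_lt_one hκ.le hκ1 hs, ?_⟩
  rintro φ hφ ⟨B, hB⟩ hmean m k
  have hqne : ENNReal.ofReal q ≠ 0 := by simpa using hq0
  have hFm := hF.iterate (m + k)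
  have hφF : Measurable fun x => φ (F^[m + k] x) := hφ.comp hFm
  have hint : Integrable (fun x => φ (F^[m + k] x)) μ :=
    Integrable.of_bound hφF.aestronglyMeasurable B (ae_of_all _ fun x => hB _)
  have hintq : Integrable (fun x => |φ x| ^ q) μ :=
    Integrable.of_bound (hφ.abs.pow_const q).aestronglyMeasurable (B ^ q) (ae_of_all _ fun x => by
      rw [Real.norm_of_nonneg (Real.rpow_nonneg (abs_nonneg _) q)]
      exact Real.rpow_le_rpow (abs_nonneg _) (hB x) hq0.le)
  have hpres := hinv.iterate (m + k)
  have hintqF : Integrable (fun x => |φ (F^[m + k] x)| ^ q) μ := hpres.integrable_comp_of_integrable hintq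
  set ℱ := itineraryFiltration h𝒜 hF with hℱ
  set g := μ[fun x => φ (F^[m + k] x) | ℱ m] with hg
  set g2 := μ[fun x => |φ (F^[m + k] x)| ^ q | ℱ m] with hg2
  set I := ∫ x, |φ x| ^ q ∂μ with hI
  have hI0 : 0 ≤ I := integral_nonneg fun x => Real.rpow_nonneg (abs_nonneg _) q
  -- on the cylinder through `x`, compare the conditional law of `F^[m + k]` with `μ`
  have hpt : ∀ᵐ x ∂μ, |g x| ^ q ≤ (2 * (C * κ ^ k)) ^ (q - 1) * (g2 x + I) := by
    filter_upwards [condExp_itinerary_ae_eq h𝒜 hne hF hμν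
      (hD.quasiMeasurePreserving h𝒜 hF) m] with x ⟨c, hc, _, hpos, hcond⟩
    set E := dynCylinder F c m with hE
    have hEm : MeasurableSet E := measurableSet_cylinder hF (fun i => h𝒜.measurableSet _ (hc i)) m
    set ρ : Measure X := (μ E)⁻¹ • (μ.restrict E).map F^[m] with hρ
    have hρp : IsProbabilityMeasure ρ := ⟨by
      rw [hρ, Measure.smul_apply, Measure.map_apply (hF.iterate m) MeasurableSet.univ, preimage_univ,
        Measure.restrict_apply_univ, smul_eq_mul, ENNReal.inv_mul_cancel hpos (measure_ne_top _ _)]⟩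
    have hρreg : IsCylinderRegular ν F 𝒜 γ K ρ :=
      (hμ.map_iterate_restrict_cylinder hD h𝒜 hF hγ hK₀.le hc m).const_smul _
    have hρμ : ρ ≪ μ := by
      refine Measure.AbsolutelyContinuous.smul_left ?_ _
      refine Measure.AbsolutelyContinuous.trans ?_
        (hinv.iterate m).quasiMeasurePreserving.absolutelyContinuous
      exact (Measure.absolutelyContinuous_of_le Measure.restrict_le_self).map (hF.iterate m)
    obtain ⟨G, hG⟩ := hcommon k
    obtain ⟨w₁, h1, hw₁⟩ := hG ρ hρp hρreg hρμ
    obtain ⟨w₂, h2, hw₂⟩ := hG μ inferInstance hμ Measure.AbsolutelyContinuous.rfl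
    rw [(hinv.iterate k).map_eq] at h2
    have hρk : ρ.map F^[k] = (μ E)⁻¹ • (μ.restrict E).map F^[m + k] := by
      rw [hρ, Measure.map_smul, Measure.map_map (hF.iterate k) (hF.iterate m),
        ← Function.iterate_add, add_comm]
    have : IsProbabilityMeasure (ρ.map F^[k]) :=
      Measure.isProbabilityMeasure_map (hF.iterate k).aemeasurable
    have hval : ∀ ψ : X → ℝ, Measurable ψ →
        ∫ y, ψ y ∂(ρ.map F^[k]) = (μ.real E)⁻¹ * ∫ y in E, ψ (F^[m + k] y) ∂μ := by
      intro ψ hψ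
      rw [hρk, integral_smul_measure, integral_map hFm.aemeasurable hψ.aestronglyMeasurable,
        ENNReal.toReal_inv, smul_eq_mul]
      rfl
    have h3 := abs_integral_sub_rpow_le h1 h2 (by positivity) hw₁ hw₂ hφ hB hq
    rw [hmean, sub_zero, hval φ hφ, hval _ (hφ.abs.pow_const q), ← hcond _ hint,
      ← hcond _ hintqF] at h3
    exact h3
  have hgi : Integrable g2 μ := integrable_condExp
  have hle : ∫ x, |g x| ^ q ∂μ ≤ (2 * (C * κ ^ k)) ^ (q - 1) * (2 * I) := by
    have h1 : ∫ x, |g x| ^ q ∂μ ≤ ∫ x, (2 * (C * κ ^ k)) ^ (q - 1) * (g2 x + I) ∂μ :=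
      integral_mono_of_nonneg (ae_of_all _ fun x => Real.rpow_nonneg (abs_nonneg _) q)
        ((hgi.add (integrable_const I)).const_mul _) hpt
    rw [integral_const_mul, integral_add hgi (integrable_const _), integral_const,
      integral_condExp (ℱ.le m), probReal_univ, one_smul] at h1
    have h2 : ∫ x, |φ (F^[m + k] x)| ^ q ∂μ = I := by
      rw [hI, ← hpres.map_eq, integral_map hFm.aemeasurable
        (hφ.abs.pow_const q).aestronglyMeasurable, hpres.map_eq]
    rw [h2, ← two_mul] at h1
    exact h1
  have hgb : ∀ᵐ x ∂μ, ‖g x‖ ≤ B :=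
    ae_bdd_abs_condExp_of_ae_bdd_abs (ae_of_all _ fun x => hB _)
  have hgM : MemLp g (ENNReal.ofReal q) μ :=
    MemLp.of_bound (stronglyMeasurable_condExp.mono
      (ℱ.le m)).aestronglyMeasurable B hgb
  have hφM : MemLp φ (ENNReal.ofReal q) μ :=
    MemLp.of_bound hφ.aestronglyMeasurable B (ae_of_all _ hB)
  rw [hgM.eLpNorm_eq_integral_rpow_norm hqne ENNReal.ofReal_ne_top,
    hφM.eLpNorm_eq_integral_rpow_norm hqne ENNReal.ofReal_ne_top, ENNReal.toReal_ofReal hq0.le,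
    ← ENNReal.ofReal_mul (by positivity)]
  refine ENNReal.ofReal_le_ofReal ?_
  simp only [Real.norm_eq_abs]
  rw [← hI]
  refine (Real.rpow_le_rpow (integral_nonneg fun x => Real.rpow_nonneg (abs_nonneg _) q) hle
    (by positivity)).trans (le_of_eq ?_)
  rw [Real.mul_rpow (by positivity) (by positivity), Real.mul_rpow (by norm_num) hI0,
    ← Real.rpow_mul (by positivity), ← mul_assoc 2 C, Real.mul_rpow (by positivity) (by positivity),
    one_div, ← div_eq_mul_inv, ← Real.rpow_natCast (κ ^ _), ← Real.rpow_mul hκ.le,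
    ← Real.rpow_natCast κ, ← Real.rpow_mul hκ.le, mul_comm (k : ℝ)]
  ring

/-- An observable that oscillates little on long cylinders is close to its conditional expectation
given many symbols. -/
lemma eLpNorm_sub_condExp_le [MetricSpace X] [IsFiniteMeasure μ] (h𝒜 : IsCountablePartition ν 𝒜)
    (hne : 𝒜.Nonempty) (hF : Measurable F) (hinv : MeasurePreserving F μ μ) (hμν : μ ≪ ν)
    (hqm : Measure.QuasiMeasurePreserving F ν ν) {lam R : ℝ} (hl : 1 < lam)
    (hexp : ∀ a ∈ 𝒜, ∀ z ∈ a, ∀ z' ∈ a, lam * dist z z' ≤ dist (F z) (F z'))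
    (hR : ∀ x y : X, dist x y ≤ R) {φ t : X → ℝ} (hφ : Measurable φ) (ht : Measurable t)
    (hφB : ∃ B, ∀ x, |φ x| ≤ B) {η : ℝ} (hη : 0 ≤ η) (ht0 : ∀ x, 0 ≤ t x)
    (hosc : ∀ a ∈ 𝒜, ∀ z ∈ a, ∀ z' ∈ a, |φ z - φ z'| ≤ t z * dist (F z) (F z') ^ η)
    (j k : ℕ) (q : ℝ≥0∞) :
    eLpNorm ((fun x => φ (F^[j] x)) -
        μ[fun x => φ (F^[j] x) | itineraryFiltration h𝒜 hF (j + 1 + k)]) q μ ≤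
      ENNReal.ofReal ((lam⁻¹ ^ k * R) ^ η) * eLpNorm t q μ := by
  obtain ⟨B, hB⟩ := hφB
  have hint : Integrable (fun x => φ (F^[j] x)) μ :=
    Integrable.of_bound (hφ.comp (hF.iterate j)).aestronglyMeasurable B (ae_of_all _ fun x => hB _)
  rw [← eLpNorm_comp_measurePreserving (p := q) ht.aestronglyMeasurable (hinv.iterate j)]
  refine eLpNorm_le_mul_eLpNorm_of_ae_le_mul ?_ q
  filter_upwards [condExp_itinerary_ae_eq h𝒜 hne hF hμν hqm (j + 1 + k)]
    with x ⟨c, hc, hx, hpos, hcond⟩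
  rw [Pi.sub_apply, hcond _ hint]
  set E := dynCylinder F c (j + 1 + k) with hE
  have hEm : MeasurableSet E :=
    measurableSet_cylinder hF (fun i => h𝒜.measurableSet _ (hc i)) _
  have hpos' : 0 < μ.real E := ENNReal.toReal_pos hpos (measure_ne_top _ _)
  have hosc' : ∀ y ∈ E, ‖φ (F^[j] x) - φ (F^[j] y)‖ ≤ (lam⁻¹ ^ k * R) ^ η * t (F^[j] x) := by
    intro y hy
    refine (hosc (c j) (hc j) _ (hx j (by omega)) _ (hy j (by omega))).trans ?_
    rw [mul_comm]
    refine mul_le_mul_of_nonneg_right (Real.rpow_le_rpow dist_nonneg ?_ hη) (ht0 _)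
    have := dist_le_of_mem_cylinder hl hexp hR k _ (fun i => hc (i + (j + 1))) _
      (iterate_mem_cylinder hx) _ (iterate_mem_cylinder hy)
    simpa only [Function.iterate_succ_apply'] using this
  have h1 : φ (F^[j] x) - (μ.real E)⁻¹ * ∫ y in E, φ (F^[j] y) ∂μ =
      (μ.real E)⁻¹ * ∫ y in E, (φ (F^[j] x) - φ (F^[j] y)) ∂μ := by
    rw [integral_sub (integrable_const _) hint.integrableOn, setIntegral_const, smul_eq_mul, mul_sub,
      inv_mul_cancel_left₀ hpos'.ne']
  have h2 := norm_setIntegral_le_of_norm_le_const (measure_lt_top μ E) hosc'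
  rw [h1, norm_mul, norm_inv, Real.norm_of_nonneg hpos'.le, Function.comp_apply,
    Real.norm_of_nonneg (ht0 _), inv_mul_le_iff₀ hpos']
  linarith

lemma sum_ofReal_geometric_le {C κ : ℝ} (hC : 0 ≤ C) (hκ : 0 ≤ κ) (hκ1 : κ < 1) (n : ℕ) :
    ∑ k ∈ Finset.range n, ENNReal.ofReal (C * κ ^ k) ≤ ENNReal.ofReal (C * (1 - κ)⁻¹) := by
  rw [← ENNReal.ofReal_sum_of_nonneg fun i _ => by positivity, ← Finset.mul_sum]
  refine ENNReal.ofReal_le_ofReal (mul_le_mul_of_nonneg_left ?_ hC)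
  rw [← tsum_geometric_of_lt_one hκ hκ1]
  exact (summable_geometric_of_lt_one hκ hκ1).sum_le_tsum _ fun i _ => by positivity

/-- Birkhoff sums up to time `m ≤ n` agree with the martingale
`m ↦ μ[∑_{j < n} φ ∘ F^j | ℱ m]` up to an error whose `L^q` norm is bounded uniformly in `m` and `n`,
with a constant independent of `φ` and `t`. -/
lemma exists_martingale_approximation [MetricSpace X] [BoundedSpace X] [BorelSpace X]
    [IsFiniteMeasure ν] (hGM : IsGibbsMarkov ν 𝒜 F) [IsProbabilityMeasure μ]
    (hinv : MeasurePreserving F μ μ) (hμν : μ ≪ ν) (hmix : IsMixing F μ)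
    {q : ℝ} (hq : 1 < q) {η : ℝ} (hη : 0 < η) :
    ∃ A : ℝ, 0 ≤ A ∧ ∀ φ t : X → ℝ, Measurable φ → Measurable t → (∃ B, ∀ x, |φ x| ≤ B) →
      (∀ x, 0 ≤ t x) → ∫ x, φ x ∂μ = 0 →
      (∀ a ∈ 𝒜, ∀ z ∈ a, ∀ z' ∈ a, |φ z - φ z'| ≤ t z * dist (F z) (F z') ^ η) →
      ∀ m n : ℕ, m ≤ n →
      eLpNorm ((fun x => ∑ j ∈ Finset.range m, φ (F^[j] x)) -
        μ[fun x => ∑ j ∈ Finset.range n, φ (F^[j] x) |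
          itineraryFiltration hGM.partition hGM.quasiErgodic.measurable m]) (ENNReal.ofReal q) μ ≤
        ENNReal.ofReal A * (eLpNorm φ (ENNReal.ofReal q) μ + eLpNorm t (ENNReal.ofReal q) μ) := by
  have h𝒜 := hGM.partition
  have hF : Measurable F := hGM.quasiErgodic.measurable
  obtain ⟨γ, K₀, D, hγ, hγ1, hK₀0, hD⟩ := hGM.exists_hasCylinderDistortion
  obtain ⟨lam, hl, hexp⟩ := hGM.expanding
  obtain ⟨R, hR0, hR⟩ : ∃ R : ℝ, 0 < R ∧ ∀ x y : X, dist x y ≤ R := by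
    obtain ⟨R, hR⟩ := Metric.isBounded_iff.1 (BoundedSpace.bounded_univ (α := X))
    exact ⟨max R 1, by positivity, fun x y => (hR (mem_univ x) (mem_univ y)).trans
      (le_max_left _ _)⟩
  have hne : 𝒜.Nonempty := by
    by_contra hc
    rw [not_nonempty_iff_eq_empty] at hc
    have h1 := h𝒜.cover
    rw [hc, sUnion_empty, compl_empty] at h1
    exact absurd (measure_univ (μ := μ)) (by rw [hμν h1]; simp)
  have hγ' : 0 < 1 - γ := by linarith
  -- this choice leaves room in the contraction `K ↦ K₀ + γ * K` of regularity constants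
  set K := (K₀ + 1) / (1 - γ) with hKdef
  have hK : 0 ≤ K := by positivity
  have hK₀ : K₀ + γ * K < K := by
    have : (1 - γ) * K = K₀ + 1 := by rw [hKdef]; field_simp
    linarith
  have hμ : IsCylinderRegular ν F 𝒜 γ K μ :=
    isCylinderRegular_of_invariant hD h𝒜 hne hF hγ.le hK hK₀.le hl hexp hR hinv hμν
  have hqm := hD.quasiMeasurePreserving h𝒜 hF
  obtain ⟨C, κ, hC, hκ, hκ1, hfut⟩ :=
    exists_eLpNorm_condExp_le hD h𝒜 hne hF hγ.le hγ1.le hK hK₀0 hK₀ hinv hμν hμ hmix hq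
  have hl0 : 0 < lam := by linarith
  set κ' := (lam⁻¹) ^ η with hκ'
  have hκ'0 : 0 < κ' := by positivity
  have hκ'1 : κ' < 1 := Real.rpow_lt_one (by positivity) (inv_lt_one_of_one_lt₀ hl) hη
  have hA1 : 0 ≤ C * (1 - κ)⁻¹ := mul_nonneg hC.le (inv_nonneg.2 (by linarith))
  have hA2 : 0 ≤ R ^ η * (1 - κ')⁻¹ := mul_nonneg (by positivity) (inv_nonneg.2 (by linarith))
  refine ⟨C * (1 - κ)⁻¹ + R ^ η * (1 - κ')⁻¹, by positivity, ?_⟩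
  intro φ t hφ ht hφB ht0 hmean hosc m n hmn
  set ℱ := itineraryFiltration h𝒜 hF with hℱ
  have hq1 : (1 : ℝ≥0∞) ≤ ENNReal.ofReal q := by
    rw [← ENNReal.ofReal_one]; exact ENNReal.ofReal_le_ofReal hq.le
  have hint : ∀ j, Integrable (fun x => φ (F^[j] x)) μ := fun j => by
    obtain ⟨B, hB⟩ := hφB
    exact Integrable.of_bound (hφ.comp (hF.iterate j)).aestronglyMeasurable B
      (ae_of_all _ fun x => hB _)
  set g : ℕ → X → ℝ := fun j => μ[fun x => φ (F^[j] x) | ℱ m] with hg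
  have hgm : ∀ j, AEStronglyMeasurable (g j) μ := fun j =>
    (stronglyMeasurable_condExp.mono (ℱ.le m)).aestronglyMeasurable
  have hsum : μ[fun x => ∑ j ∈ Finset.range n, φ (F^[j] x) | ℱ m] =ᵐ[μ]
      ∑ j ∈ Finset.range n, g j := by
    have := condExp_finsetSum (μ := μ) (s := Finset.range n) (f := fun j x => φ (F^[j] x))
      (fun j _ => hint j) (ℱ m)
    refine (Eq.eventuallyEq ?_).trans this
    congr 1
    ext x
    simp
  have hdecomp : (fun x => ∑ j ∈ Finset.range m, φ (F^[j] x)) -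
      μ[fun x => ∑ j ∈ Finset.range n, φ (F^[j] x) | ℱ m] =ᵐ[μ]
      (∑ j ∈ Finset.range m, ((fun x => φ (F^[j] x)) - g j)) -
        ∑ k ∈ Finset.range (n - m), g (m + k) := by
    filter_upwards [hsum] with x hx
    rw [Pi.sub_apply, hx, Pi.sub_apply, Finset.sum_apply, Finset.sum_apply, Finset.sum_apply]
    simp only [Pi.sub_apply, Finset.sum_sub_distrib]
    obtain ⟨r, rfl⟩ := Nat.exists_eq_add_of_le hmn
    rw [Finset.sum_range_add, Nat.add_sub_cancel_left]
    ring
  rw [eLpNorm_congr_ae hdecomp]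
  refine (eLpNorm_sub_le (Finset.aestronglyMeasurable_sum _ fun j _ =>
    (hint j).aestronglyMeasurable.sub (hgm j))
    (Finset.aestronglyMeasurable_sum _ fun k _ => hgm _) hq1).trans ?_
  have h1 : eLpNorm (∑ k ∈ Finset.range (n - m), g (m + k)) (ENNReal.ofReal q) μ ≤
      ENNReal.ofReal (C * (1 - κ)⁻¹) * eLpNorm φ (ENNReal.ofReal q) μ := by
    refine (eLpNorm_sum_le (fun k _ => hgm _) hq1).trans ?_
    refine (Finset.sum_le_sum fun k _ => hfut φ hφ hφB hmean m k).trans ?_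
    rw [← Finset.sum_mul]
    gcongr
    exact sum_ofReal_geometric_le hC.le hκ.le hκ1 _
  have h2 : eLpNorm (∑ j ∈ Finset.range m, ((fun x => φ (F^[j] x)) - g j)) (ENNReal.ofReal q) μ ≤
      ENNReal.ofReal (R ^ η * (1 - κ')⁻¹) * eLpNorm t (ENNReal.ofReal q) μ := by
    refine (eLpNorm_sum_le (fun j _ => (hint j).aestronglyMeasurable.sub (hgm j)) hq1).trans ?_
    -- reindexed by the number `k` of symbols known after the one that governs `φ ∘ F^j`
    rw [← Finset.sum_range_reflect]
    refine (Finset.sum_le_sum (g := fun k => ENNReal.ofReal (R ^ η * κ' ^ k) *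
      eLpNorm t (ENNReal.ofReal q) μ) fun k hk => ?_).trans ?_
    · have hk' := Finset.mem_range.1 hk
      have h3 := eLpNorm_sub_condExp_le h𝒜 hne hF hinv hμν hqm hl hexp hR hφ ht hφB hη.le ht0 hosc
        (m - 1 - k) k (ENNReal.ofReal q)
      have h4 : m - 1 - k + 1 + k = m := by omega
      rw [h4] at h3
      have h5 : (lam⁻¹ ^ k * R) ^ η = R ^ η * κ' ^ k := by
        rw [Real.mul_rpow (by positivity) hR0.le, hκ', ← Real.rpow_natCast, ← Real.rpow_natCast,
          ← Real.rpow_mul (by positivity), ← Real.rpow_mul (by positivity), mul_comm (k : ℝ), mul_comm]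
      rw [h5] at h3
      exact h3
    · rw [← Finset.sum_mul]
      gcongr
      exact sum_ofReal_geometric_le (by positivity) hκ'0.le hκ'1 _
  rw [ENNReal.ofReal_add hA1 hA2]
  calc _ ≤ _ := add_le_add h2 h1
    _ ≤ _ := by
      rw [add_mul, mul_add, mul_add, add_comm]
      exact add_le_add le_self_add le_add_self

end MartingaleApproximation

/-! ### Tightness of the variation of normalized Birkhoff sums -/

section TruncatedMoments

variable {Ω : Type*} [MeasurableSpace Ω] {μ : Measure Ω} {ξ : Ω → ℝ} {α : ℝ}

/-- With `n μ(ξ > b n) → 1`, the truncated moments of `ξ` at level `b n` have size at most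
`b n / n` and `(b n)^q / n`. -/
lemma exists_truncated_moment_bounds [IsProbabilityMeasure μ] (h2 : Tendsto
    (fun t => μ.real {ω | 2 * t < ξ ω} / μ.real {ω | t < ξ ω}) atTop (𝓝 ((2 : ℝ) ^ (-α))))
    (hα : 1 < α) {q : ℝ} (hq : α < q) (hξ : Measurable ξ) (hξ0 : ∀ ω, 0 < ξ ω)
    (hint : Integrable ξ μ) {b : ℕ → ℝ} (hb0 : ∀ n, 1 ≤ n → 0 < b n)
    (hb : Tendsto (fun n : ℕ => (n : ℝ) * μ.real {ω | b n < ξ ω}) atTop (𝓝 1)) :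
    ∃ C : ℝ≥0, ∀ n : ℕ, 1 ≤ n →
      n * ∫⁻ ω in {ω | b n < ξ ω}, ENNReal.ofReal (ξ ω) ∂μ ≤ C * ENNReal.ofReal (b n) ∧
      n * ∫⁻ ω in {ω | ξ ω ≤ b n}, ENNReal.ofReal (ξ ω) ^ q ∂μ ≤ C * ENNReal.ofReal (b n) ^ q := by
  obtain ⟨C₁, t₁, hC₁, ht₁, h₁⟩ := lintegral_above_le h2 hα hξ
  obtain ⟨C₂, t₂, hC₂, ht₂, h₂⟩ := lintegral_below_le h2 (by linarith) hq hξ hξ0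
  have hq0 : 0 < q := by linarith
  have hbt := tendsto_atTop_of_tail (tail_pos h2) hb
  have hev : ∀ᶠ n in atTop, 1 ≤ n ∧ t₁ ≤ b n ∧ t₂ ≤ b n ∧ (n : ℝ) * μ.real {ω | b n < ξ ω} < 2 :=
    (eventually_ge_atTop 1).and ((hbt.eventually_ge_atTop t₁).and
      ((hbt.eventually_ge_atTop t₂).and (hb.eventually (gt_mem_nhds one_lt_two))))
  have hev' : ∀ᶠ n : ℕ in atTop,
      n * ∫⁻ ω in {ω | b n < ξ ω}, ENNReal.ofReal (ξ ω) ∂μ ≤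
        ENNReal.ofReal (2 * C₁) * ENNReal.ofReal (b n) ∧
      n * ∫⁻ ω in {ω | ξ ω ≤ b n}, ENNReal.ofReal (ξ ω) ^ q ∂μ ≤
        ENNReal.ofReal (2 * C₂) * ENNReal.ofReal (b n) ^ q := by
    filter_upwards [hev] with n ⟨hn, hb₁, hb₂, hlt⟩
    have hbn := hb0 n hn
    simp only [ENNReal.ofReal_rpow_of_pos (hξ0 _), ENNReal.ofReal_rpow_of_pos hbn]
    rw [← ENNReal.ofReal_natCast n, ← ENNReal.ofReal_mul (by positivity),
      ← ENNReal.ofReal_mul (by positivity)]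
    constructor
    · refine (mul_le_mul_right (h₁ _ hb₁) _).trans ?_
      rw [← ENNReal.ofReal_mul (by positivity)]
      refine ENNReal.ofReal_le_ofReal ?_
      have : C₁ * b n * (n * μ.real {ω | b n < ξ ω}) ≤ C₁ * b n * 2 :=
        mul_le_mul_of_nonneg_left hlt.le (by positivity)
      linarith
    · refine (mul_le_mul_right (h₂ _ hb₂) _).trans ?_
      rw [← ENNReal.ofReal_mul (by positivity)]
      refine ENNReal.ofReal_le_ofReal ?_
      have : C₂ * b n ^ q * (n * μ.real {ω | b n < ξ ω}) ≤ C₂ * b n ^ q * 2 :=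
        mul_le_mul_of_nonneg_left hlt.le (by positivity)
      linarith
  obtain ⟨N, hN⟩ := eventually_atTop.1 hev'
  have hfinI : ∫⁻ ω, ENNReal.ofReal (ξ ω) ∂μ ≠ ∞ := by
    rw [← ofReal_integral_eq_lintegral_ofReal hint (ae_of_all _ fun ω => (hξ0 ω).le)]
    exact ENNReal.ofReal_ne_top
  set I := ∫⁻ ω, ENNReal.ofReal (ξ ω) ∂μ with hI
  -- the finitely many small values of `n` are absorbed in the constant
  set c : ℕ → ℝ≥0 := fun n => (n * I / ENNReal.ofReal (b n) + n).toNNReal with hc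
  refine ⟨(2 * C₁).toNNReal + (2 * C₂).toNNReal + ∑ n ∈ Finset.range N, c n, fun n hn => ?_⟩
  have hbn := hb0 n hn
  have hbn' : ENNReal.ofReal (b n) ≠ 0 := by simpa using hbn
  rcases le_or_gt N n with hNn | hNn
  · refine ⟨(hN n hNn).1.trans ?_, (hN n hNn).2.trans ?_⟩ <;> push_cast <;> gcongr
    · rw [add_assoc]; exact le_self_add
    · rw [add_right_comm]; exact le_add_self
  · have hcn : (c n : ℝ≥0∞) = n * I / ENNReal.ofReal (b n) + n := by
      rw [hc, ENNReal.coe_toNNReal]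
      exact ENNReal.add_ne_top.2 ⟨ENNReal.div_ne_top (ENNReal.mul_ne_top (by simp) hfinI) hbn',
        by simp⟩
    have hle : (c n : ℝ≥0∞) ≤
        ((2 * C₁).toNNReal + (2 * C₂).toNNReal + ∑ n ∈ Finset.range N, c n : ℝ≥0) := by
      refine ENNReal.coe_le_coe.2 (le_add_left ?_)
      exact Finset.single_le_sum (f := c) (fun _ _ => zero_le) (Finset.mem_range.2 hNn)
    constructor
    · refine le_trans ?_ (mul_le_mul_left hle _)
      rw [hcn]
      calc _ ≤ (n : ℝ≥0∞) * I := by gcongr; exact setLIntegral_le_lintegral _ _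
        _ = n * I / ENNReal.ofReal (b n) * ENNReal.ofReal (b n) :=
          (ENNReal.div_mul_cancel hbn' ENNReal.ofReal_ne_top).symm
        _ ≤ _ := by gcongr; exact le_self_add
    · refine le_trans ?_ (mul_le_mul_left hle _)
      rw [hcn]
      refine le_trans (mul_le_mul_right ?_ (n : ℝ≥0∞)) (mul_le_mul_left le_add_self _)
      calc ∫⁻ ω in {ω | ξ ω ≤ b n}, ENNReal.ofReal (ξ ω) ^ q ∂μ
          ≤ ∫⁻ _ in {ω | ξ ω ≤ b n}, ENNReal.ofReal (b n) ^ q ∂μ := by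
            refine setLIntegral_mono measurable_const fun ω hω => ?_
            exact ENNReal.rpow_le_rpow (ENNReal.ofReal_le_ofReal hω) hq0.le
        _ ≤ ENNReal.ofReal (b n) ^ q := by
            rw [setLIntegral_const]
            exact mul_le_of_le_one_right' prob_le_one

lemma lintegral_birkhoffSum {F : Ω → Ω} (hinv : MeasurePreserving F μ μ) {g : Ω → ℝ≥0∞}
    (hg : Measurable g) (n : ℕ) :
    ∫⁻ ω, ∑ k ∈ Finset.range n, g (F^[k] ω) ∂μ = n * ∫⁻ ω, g ω ∂μ := by
  rw [lintegral_finsetSum _ fun k _ => by exact hg.comp (hinv.measurable.iterate k)]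
  simp only [(hinv.iterate _).lintegral_comp hg, Finset.sum_const, Finset.card_range, nsmul_eq_mul]

/-- Sums of stationary variables with regularly varying tails, raised to a power above the index,
are tight at the scale `b n`. -/
lemma isTightSeq_sum_rpow [IsProbabilityMeasure μ] {F : Ω → Ω} (hinv : MeasurePreserving F μ μ)
    (h2 : Tendsto
    (fun t => μ.real {ω | 2 * t < ξ ω} / μ.real {ω | t < ξ ω}) atTop (𝓝 ((2 : ℝ) ^ (-α))))
    (hα : 1 < α) {p : ℝ} (hp : α < p) (hξ : Measurable ξ) (hξ0 : ∀ ω, 0 < ξ ω)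
    (hint : Integrable ξ μ) {b : ℕ → ℝ} (hb0 : ∀ n, 1 ≤ n → 0 < b n)
    (hb : Tendsto (fun n : ℕ => (n : ℝ) * μ.real {ω | b n < ξ ω}) atTop (𝓝 1)) :
    IsTightSeq μ (fun n ω => ∑ k ∈ Finset.range n,
      (ENNReal.ofReal (b n)⁻¹ * ENNReal.ofReal (ξ (F^[k] ω))) ^ p) := by
  obtain ⟨C, hC⟩ := exists_truncated_moment_bounds h2 hα hp hξ hξ0 hint hb0 hb
  have hp1 : 1 ≤ p := by linarith
  have hp0 : 0 < p := by linarith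
  have hS : ∀ c : ℝ, MeasurableSet {ω | ξ ω ≤ c} := fun c => measurableSet_le hξ measurable_const
  have hL : ∀ c : ℝ, MeasurableSet {ω | c < ξ ω} := fun c => measurableSet_lt measurable_const hξ
  have hm1 : ∀ n, Measurable ({ω | ξ ω ≤ b n}.indicator fun ω =>
      (ENNReal.ofReal (b n)⁻¹ * ENNReal.ofReal (ξ ω)) ^ p) := fun n =>
    ((hξ.ennreal_ofReal.const_mul _).pow_const p).indicator (hS _)
  have hm2 : ∀ n, Measurable ({ω | b n < ξ ω}.indicator fun ω =>
      ENNReal.ofReal (b n)⁻¹ * ENNReal.ofReal (ξ ω)) := fun n =>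
    (hξ.ennreal_ofReal.const_mul _).indicator (hL _)
  have hcancel : ∀ n, 1 ≤ n → ENNReal.ofReal (b n)⁻¹ * ENNReal.ofReal (b n) = 1 := fun n hn => by
    rw [← ENNReal.ofReal_mul (inv_nonneg.2 (hb0 n hn).le), inv_mul_cancel₀ (hb0 n hn).ne',
      ENNReal.ofReal_one]
  have hA : IsTightSeq μ (fun n ω => ∑ k ∈ Finset.range n, {ω | ξ ω ≤ b n}.indicator (fun ω =>
      (ENNReal.ofReal (b n)⁻¹ * ENNReal.ofReal (ξ ω)) ^ p) (F^[k] ω)) := by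
    refine isTightSeq_of_lintegral_le (C := C) ENNReal.coe_ne_top (fun n _ =>
      (Finset.measurable_fun_sum _ fun k _ =>
        (hm1 n).comp (hinv.measurable.iterate k)).aemeasurable) fun n hn => ?_
    rw [lintegral_birkhoffSum hinv (hm1 n), lintegral_indicator (hS _)]
    simp only [ENNReal.mul_rpow_of_nonneg _ _ hp0.le]
    rw [lintegral_const_mul _ (hξ.ennreal_ofReal.pow_const p), mul_left_comm]
    refine (mul_le_mul_right (hC n hn).2 _).trans (le_of_eq ?_)
    rw [mul_left_comm, ← ENNReal.mul_rpow_of_nonneg _ _ hp0.le, hcancel n hn, ENNReal.one_rpow,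
      mul_one]
  have hB : IsTightSeq μ (fun n ω => (∑ k ∈ Finset.range n, {ω | b n < ξ ω}.indicator (fun ω =>
      ENNReal.ofReal (b n)⁻¹ * ENNReal.ofReal (ξ ω)) (F^[k] ω)) ^ p) := by
    refine IsTightSeq.rpow_const ?_ hp0
    refine isTightSeq_of_lintegral_le (C := C) ENNReal.coe_ne_top (fun n _ =>
      (Finset.measurable_fun_sum _ fun k _ =>
        (hm2 n).comp (hinv.measurable.iterate k)).aemeasurable) fun n hn => ?_
    rw [lintegral_birkhoffSum hinv (hm2 n), lintegral_indicator (hL _), lintegral_const_mul _ hξ.ennreal_ofReal, mul_left_comm]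
    refine (mul_le_mul_right (hC n hn).1 _).trans (le_of_eq ?_)
    rw [mul_left_comm, hcancel n hn, mul_one]
  refine (hA.add hB).mono fun n hn => ae_of_all _ fun ω => ?_
  refine le_trans (Finset.sum_le_sum (g := fun k => {ω | ξ ω ≤ b n}.indicator (fun ω =>
      (ENNReal.ofReal (b n)⁻¹ * ENNReal.ofReal (ξ ω)) ^ p) (F^[k] ω) + ({ω | b n < ξ ω}.indicator
      (fun ω => ENNReal.ofReal (b n)⁻¹ * ENNReal.ofReal (ξ ω)) (F^[k] ω)) ^ p) fun k _ => ?_) ?_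
  · rcases le_or_gt (ξ (F^[k] ω)) (b n) with h | h
    · rw [indicator_of_mem (by exact h)]; exact le_self_add
    · rw [indicator_of_mem (s := {ω | b n < ξ ω}) (by exact h)]; exact le_add_self
  · rw [Finset.sum_add_distrib]
    gcongr
    exact sum_rpow_le_rpow_sum_of_one_le _ _ hp1

end TruncatedMoments

section BirkhoffSums

lemma lintegral_enorm_rpow_eq_eLpNorm_rpow {Ω : Type*} [MeasurableSpace Ω] (μ : Measure Ω) (f : Ω → ℝ)
    {q : ℝ} (hq : 0 < q) : ∫⁻ x, ‖f x‖ₑ ^ q ∂μ = eLpNorm f (ENNReal.ofReal q) μ ^ q := by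
  rw [eLpNorm_eq_lintegral_rpow_enorm_toReal (by simpa using hq) ENNReal.ofReal_ne_top,
    ENNReal.toReal_ofReal hq.le, ← ENNReal.rpow_mul, one_div_mul_cancel hq.ne', ENNReal.rpow_one]

variable {X : Type*} [MetricSpace X] [BoundedSpace X] [MeasurableSpace X] [BorelSpace X]
  {ν μ : Measure X} {F : X → X} {𝒜 : Set (Set X)}

/-- Decomposition of the Birkhoff sums up to time `n` into a martingale and a remainder whose
`L^q` norms are controlled. -/
lemma exists_martingale_decomposition
    [IsFiniteMeasure ν] (hGM : IsGibbsMarkov ν 𝒜 F) [IsProbabilityMeasure μ]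
    (hinv : MeasurePreserving F μ μ) (hμν : μ ≪ ν) (hmix : IsMixing F μ)
    {q : ℝ} (hq : 1 < q) {η : ℝ} (hη : 0 < η) :
    ∃ A : ℝ≥0, ∀ φ t : X → ℝ, Measurable φ → Measurable t → (∃ B, ∀ x, |φ x| ≤ B) →
      (∀ x, 0 ≤ t x) → ∫ x, φ x ∂μ = 0 →
      (∀ a ∈ 𝒜, ∀ z ∈ a, ∀ z' ∈ a, |φ z - φ z'| ≤ t z * dist (F z) (F z') ^ η) →
      ∀ n : ℕ, ∃ M R : ℕ → X → ℝ,
        Martingale M (itineraryFiltration hGM.partition hGM.quasiErgodic.measurable) μ ∧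
        (∀ m, MemLp (M m) (ENNReal.ofReal q) μ) ∧ (∀ m, Measurable (R m)) ∧
        (∀ m x, ∑ j ∈ Finset.range m, φ (F^[j] x) = M m x + R m x) ∧
        (∀ j < n, eLpNorm (M (j + 1) - M j) (ENNReal.ofReal q) μ ≤
          A * (eLpNorm φ (ENNReal.ofReal q) μ + eLpNorm t (ENNReal.ofReal q) μ)) ∧
        ∀ m ≤ n, eLpNorm (R m) (ENNReal.ofReal q) μ ≤
          A * (eLpNorm φ (ENNReal.ofReal q) μ + eLpNorm t (ENNReal.ofReal q) μ) := by
  obtain ⟨A, hA, happrox⟩ := exists_martingale_approximation hGM hinv hμν hmix hq hη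
  have hF : Measurable F := hGM.quasiErgodic.measurable
  set ℱ := itineraryFiltration hGM.partition hF with hℱ
  refine ⟨1 + 2 * A.toNNReal, fun φ t hφ ht hφB ht0 hmean hosc n => ?_⟩
  set S : ℕ → X → ℝ := fun m x => ∑ j ∈ Finset.range m, φ (F^[j] x) with hS
  set N := eLpNorm φ (ENNReal.ofReal q) μ + eLpNorm t (ENNReal.ofReal q) μ with hN
  have hSm : ∀ m, Measurable (S m) := fun m =>
    Finset.measurable_fun_sum _ fun j _ => hφ.comp (hF.iterate j)
  have hq1 : (1 : ℝ≥0∞) ≤ ENNReal.ofReal q := by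
    rw [← ENNReal.ofReal_one]; exact ENNReal.ofReal_le_ofReal hq.le
  obtain ⟨B, hB⟩ := hφB
  have hSB : ∀ x, |S n x| ≤ n * B := fun x => by
    refine (Finset.abs_sum_le_sum_abs _ _).trans ((Finset.sum_le_sum fun j _ => hB _).trans ?_)
    simp
  set M : ℕ → X → ℝ := fun m => μ[S n | ℱ m] with hM
  have hMm : ∀ m, Measurable (M m) := fun m =>
    stronglyMeasurable_condExp.measurable.mono (ℱ.le m) le_rfl
  have hR : ∀ m ≤ n, eLpNorm (S m - M m) (ENNReal.ofReal q) μ ≤ ENNReal.ofReal A * N := fun m hm =>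
    happrox φ t hφ ht ⟨B, hB⟩ ht0 hmean hosc m n hm
  refine ⟨M, fun m => S m - M m, martingale_condExp _ _ _, fun m => ?_,
    fun m => (hSm m).sub (hMm m), fun m x => ?_, fun j hj => ?_, fun m hm => ?_⟩
  · exact MemLp.of_bound (hMm m).aestronglyMeasurable (n * B)
      (ae_bdd_abs_condExp_of_ae_bdd_abs (ae_of_all _ hSB))
  · simp [hS]
  · have h1 : M (j + 1) - M j =
        (fun x => φ (F^[j] x)) - (S (j + 1) - M (j + 1)) + (S j - M j) := by
      ext x
      simp only [Pi.sub_apply, Pi.add_apply, hS, Finset.sum_range_succ]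
      ring
    have h2 : eLpNorm (fun x => φ (F^[j] x)) (ENNReal.ofReal q) μ ≤ N :=
      (eLpNorm_comp_measurePreserving hφ.aestronglyMeasurable (hinv.iterate j)).le.trans le_self_add
    have hm1 := (hφ.comp (hF.iterate j)).aestronglyMeasurable (μ := μ)
    have hm2 := ((hSm (j + 1)).sub (hMm (j + 1))).aestronglyMeasurable (μ := μ)
    rw [h1]
    refine (eLpNorm_add_le (hm1.sub hm2)
      ((hSm j).sub (hMm j)).aestronglyMeasurable hq1).trans ?_
    refine (add_le_add ((eLpNorm_sub_le hm1 hm2 hq1).trans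
      (add_le_add h2 (hR (j + 1) hj))) (hR j hj.le)).trans (le_of_eq ?_)
    rw [ENNReal.coe_add, ENNReal.coe_mul, ENNReal.ofReal]
    push_cast
    ring
  · refine (hR m hm).trans (mul_le_mul_left ?_ _)
    rw [ENNReal.ofReal, ENNReal.coe_le_coe, two_mul, ← add_assoc]
    exact le_add_self

/-- Tightness of the `p`-variation of the Birkhoff sums of an unbounded observable `V` dominated,
together with its oscillation on partition elements, by a function `ξ` that is constant on partition
elements and has regularly varying tails. -/
theorem isTightSeq_discreteVar_birkhoffSum
    [IsFiniteMeasure ν] (hGM : IsGibbsMarkov ν 𝒜 F) [IsProbabilityMeasure μ]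
    (hinv : MeasurePreserving F μ μ) (hμν : μ ≪ ν) (hmix : IsMixing F μ)
    {ξ : X → ℝ} (hξ : Measurable ξ) (hξ0 : ∀ x, 0 < ξ x) (hint : Integrable ξ μ)
    (hconst : ∀ a ∈ 𝒜, ∀ z ∈ a, ∀ z' ∈ a, ξ z = ξ z') {α : ℝ} (hα : 1 < α) (hα2 : α < 2)
    (h2 : Tendsto (fun t => μ.real {x | 2 * t < ξ x} / μ.real {x | t < ξ x}) atTop
      (𝓝 ((2 : ℝ) ^ (-α))))
    {b : ℕ → ℝ} (hb0 : ∀ n, 1 ≤ n → 0 < b n)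
    (hb : Tendsto (fun n : ℕ => (n : ℝ) * μ.real {x | b n < ξ x}) atTop (𝓝 1))
    {V : X → ℝ} (hV : Measurable V) {B : ℝ} (hB : 0 ≤ B) (hVB : ∀ x, |V x| ≤ B * ξ x) {η : ℝ}
    (hη : 0 < η) {L : ℝ} (hL : 0 ≤ L)
    (hosc : ∀ a ∈ 𝒜, ∀ z ∈ a, ∀ z' ∈ a, |V z - V z'| ≤ L * ξ z * dist (F z) (F z') ^ η)
    (hmean : ∫ x, V x ∂μ = 0) {p : ℝ} (hp : α < p) :
    IsTightSeq μ fun n x =>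
      discreteVar p n fun m => (b n)⁻¹ * ∑ j ∈ Finset.range m, V (F^[j] x) := by
  obtain ⟨q, hαq, hq⟩ := exists_between (lt_min hp hα2)
  have hqp := hq.trans_le (min_le_left _ _)
  have hq2 := hq.trans_le (min_le_right _ _)
  have hq1 : 1 < q := hα.trans hαq
  have hq0 : 0 < q := by linarith
  have hp1 : 1 ≤ p := by linarith
  have hp0 : 0 < p := by linarith
  have hF : Measurable F := hGM.quasiErgodic.measurable
  obtain ⟨C, hC⟩ := exists_truncated_moment_bounds h2 hα hαq hξ hξ0 hint hb0 hb
  obtain ⟨A, hA⟩ := exists_martingale_decomposition hGM hinv hμν hmix hq1 hη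
  set ℱ := itineraryFiltration hGM.partition hF with hℱ
  have hVint : Integrable V μ := (hint.const_mul B).mono' hV.aestronglyMeasurable (ae_of_all _ hVB)
  set T : ℕ → Set X := fun n => {x | ξ x ≤ b n} with hT
  have hTm : ∀ n, MeasurableSet (T n) := fun n => measurableSet_le hξ measurable_const
  have hTc : ∀ n, (T n)ᶜ = {x | b n < ξ x} := fun n => by ext x; simp [hT]
  set e : ℕ → ℝ := fun n => ∫ x, (T n).indicator V x ∂μ with he
  set φ : ℕ → X → ℝ := fun n x => (T n).indicator V x - e n with hφ
  set t : ℕ → X → ℝ := fun n x => L * (T n).indicator ξ x with ht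
  have hIm : ∀ n, Measurable ((T n).indicator V) := fun n => hV.indicator (hTm n)
  have hφm : ∀ n, Measurable (φ n) := fun n => (hIm n).sub_const _
  have htm : ∀ n, Measurable (t n) := fun n => (hξ.indicator (hTm n)).const_mul L
  have hIle : ∀ n x, |(T n).indicator V x| ≤ B * (T n).indicator ξ x := fun n x => by
    by_cases hx : x ∈ T n
    · simpa [hx] using hVB x
    · simp [hx]
  have hIb : ∀ n x, |(T n).indicator V x| ≤ B * |b n| := fun n x => by
    refine (hIle n x).trans (mul_le_mul_of_nonneg_left ?_ hB)
    by_cases hx : x ∈ T n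
    · rw [indicator_of_mem hx]; exact le_trans hx (le_abs_self _)
    · rw [indicator_of_notMem hx]; exact abs_nonneg _
  have ht0 : ∀ n x, 0 ≤ t n x := fun n x =>
    mul_nonneg hL (indicator_nonneg (fun x _ => (hξ0 x).le) x)
  have hIi : ∀ n, Integrable ((T n).indicator V) μ := fun n => hVint.indicator (hTm n)
  have hφmean : ∀ n, ∫ x, φ n x ∂μ = 0 := fun n => by
    rw [hφ]
    simp only
    rw [integral_sub (hIi n) (integrable_const _), integral_const, probReal_univ, one_smul, sub_self]
  have hφosc : ∀ n, ∀ a ∈ 𝒜, ∀ z ∈ a, ∀ z' ∈ a,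
      |φ n z - φ n z'| ≤ t n z * dist (F z) (F z') ^ η := by
    intro n a ha z hz z' hz'
    have hzz := hconst a ha z hz z' hz'
    have h1 : φ n z - φ n z' = (T n).indicator V z - (T n).indicator V z' := by simp [hφ]
    rw [h1]
    by_cases hx : z ∈ T n
    · have hx' : z' ∈ T n := by rw [hT, mem_ofPred_eq, ← hzz]; exact hx
      simp only [ht, indicator_of_mem hx, indicator_of_mem hx']
      exact hosc a ha z hz z' hz'
    · have hx' : z' ∉ T n := by rw [hT, mem_ofPred_eq, ← hzz]; exact hx
      simp [ht, indicator_of_notMem hx, indicator_of_notMem hx']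
  set N : ℕ → ℝ≥0∞ := fun n => eLpNorm ((T n).indicator ξ) (ENNReal.ofReal q) μ with hN
  have hqE : (1 : ℝ≥0∞) ≤ ENNReal.ofReal q := by
    rw [← ENNReal.ofReal_one]; exact ENNReal.ofReal_le_ofReal hq1.le
  have hNq : ∀ n, 1 ≤ n → n * N n ^ q ≤ C * ENNReal.ofReal (b n) ^ q := fun n hn => by
    refine le_trans (le_of_eq ?_) (hC n hn).2
    rw [hN]
    simp only
    rw [← lintegral_enorm_rpow_eq_eLpNorm_rpow μ _ hq0, ← lintegral_indicator (hTm n)]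
    congr 2
    ext x
    by_cases hx : x ∈ T n
    · simp only [indicator_of_mem hx]
      rw [Real.enorm_eq_ofReal (hξ0 x).le]
    · simp only [indicator_of_notMem hx, enorm_zero, ENNReal.zero_rpow_of_pos hq0]
  have hNt : ∀ n, eLpNorm (t n) (ENNReal.ofReal q) μ ≤ ENNReal.ofReal L * N n := fun n => by
    have : t n = L • (T n).indicator ξ := rfl
    rw [this, eLpNorm_const_smul, Real.enorm_eq_ofReal hL]
  have hNI : ∀ n, eLpNorm ((T n).indicator V) (ENNReal.ofReal q) μ ≤ ENNReal.ofReal B * N n :=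
    fun n => eLpNorm_le_mul_eLpNorm_of_ae_le_mul (ae_of_all _ fun x => by
      rw [Real.norm_of_nonneg (indicator_nonneg (fun x _ => (hξ0 x).le) x)]
      exact hIle n x) _
  have hNφ : ∀ n, eLpNorm (φ n) (ENNReal.ofReal q) μ ≤ 2 * ENNReal.ofReal B * N n := fun n => by
    have h1 : ‖e n‖ₑ ≤ eLpNorm ((T n).indicator V) (ENNReal.ofReal q) μ := by
      refine (enorm_integral_le_lintegral_enorm _).trans ?_
      rw [← eLpNorm_one_eq_lintegral_enorm]
      exact eLpNorm_le_eLpNorm_of_exponent_le hqE (hIm n).aestronglyMeasurable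
    have h2 : eLpNorm (fun _ : X => e n) (ENNReal.ofReal q) μ = ‖e n‖ₑ := by
      rw [eLpNorm_const _ (by simpa using hq0) (IsProbabilityMeasure.ne_zero μ)]
      simp
    refine (eLpNorm_sub_le (hIm n).aestronglyMeasurable aestronglyMeasurable_const hqE).trans ?_
    rw [h2, mul_assoc, two_mul]
    exact add_le_add (hNI n) (h1.trans (hNI n))
  choose M R hMart hML hRm hdec hMinc hRle using fun n =>
    hA (φ n) (t n) (hφm n) (htm n)
      ⟨B * |b n| + |e n|, fun x => (abs_sub _ _).trans (add_le_add (hIb n x) le_rfl)⟩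
      (ht0 n) (hφmean n) (hφosc n) n
  set A' : ℝ≥0∞ := A * (2 * ENNReal.ofReal B + ENNReal.ofReal L) with hA'
  have hA't : A' ≠ ∞ := by
    refine ENNReal.mul_ne_top ENNReal.coe_ne_top (ENNReal.add_ne_top.2
      ⟨ENNReal.mul_ne_top (by simp) ENNReal.ofReal_ne_top, ENNReal.ofReal_ne_top⟩)
  have hAN : ∀ n, A * (eLpNorm (φ n) (ENNReal.ofReal q) μ + eLpNorm (t n) (ENNReal.ofReal q) μ) ≤
      A' * N n := fun n => by
    rw [hA', mul_assoc, add_mul]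
    exact mul_le_mul_right (add_le_add (hNφ n) (hNt n)) _
  -- `q`-th moments of functions with `L^q` norm at most `A' * N n`, rescaled by `b n`
  have hmom : ∀ n, 1 ≤ n → ∀ f : X → ℝ, eLpNorm f (ENNReal.ofReal q) μ ≤ A' * N n →
      n * ∫⁻ x, ‖(b n)⁻¹ * f x‖ₑ ^ q ∂μ ≤ A' ^ q * C := by
    intro n hn f hf
    have hbn := hb0 n hn
    have h1 : ∫⁻ x, ‖(b n)⁻¹ * f x‖ₑ ^ q ∂μ ≤ (ENNReal.ofReal (b n)⁻¹ * (A' * N n)) ^ q := by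
      rw [lintegral_enorm_rpow_eq_eLpNorm_rpow μ (fun x => (b n)⁻¹ * f x) hq0]
      refine ENNReal.rpow_le_rpow ?_ hq0.le
      have : (fun x => (b n)⁻¹ * f x) = (b n)⁻¹ • f := rfl
      rw [this, eLpNorm_const_smul, Real.enorm_eq_ofReal (inv_nonneg.2 hbn.le)]
      exact mul_le_mul_right hf _
    calc (n : ℝ≥0∞) * ∫⁻ x, ‖(b n)⁻¹ * f x‖ₑ ^ q ∂μ
        ≤ n * (ENNReal.ofReal (b n)⁻¹ * (A' * N n)) ^ q := mul_le_mul_right h1 _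
      _ = A' ^ q * (ENNReal.ofReal (b n)⁻¹ ^ q * (n * N n ^ q)) := by
          rw [ENNReal.mul_rpow_of_nonneg _ _ hq0.le, ENNReal.mul_rpow_of_nonneg _ _ hq0.le]; ring
      _ ≤ A' ^ q * (ENNReal.ofReal (b n)⁻¹ ^ q * (C * ENNReal.ofReal (b n) ^ q)) := by
          exact mul_le_mul_right (mul_le_mul_right (hNq n hn) _) _
      _ = A' ^ q * C := by
          rw [mul_left_comm (ENNReal.ofReal (b n)⁻¹ ^ q), ← ENNReal.mul_rpow_of_nonneg _ _ hq0.le,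
            ← ENNReal.ofReal_mul (inv_nonneg.2 hbn.le), inv_mul_cancel₀ hbn.ne', ENNReal.ofReal_one,
            ENNReal.one_rpow, mul_one]
  have hACt : A' ^ q * C ≠ ∞ :=
    ENNReal.mul_ne_top (ENNReal.rpow_ne_top_of_nonneg hq0.le hA't) ENNReal.coe_ne_top
  -- the martingale part
  have hpartM : IsTightSeq μ fun n x => discreteVar p n fun m => (b n)⁻¹ * M n m x := by
    have hincL : ∀ n j, MemLp (fun x => (b n)⁻¹ * M n (j + 1) x - (b n)⁻¹ * M n j x)
        (ENNReal.ofReal q) μ := fun n j => ((hML n (j + 1)).const_mul _).sub ((hML n j).const_mul _)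
    refine isTightSeq_discreteVar_martingale (fun _ => ℱ) (fun n m x => (b n)⁻¹ * M n m x) hq1 hq2.le
      hqp (A := (A' ^ q * C).toReal) (fun n _ => (hMart n).smul (b n)⁻¹) (fun n _ j => ?_)
      fun n hn => ?_
    · have := (hincL n j).integrable_norm_rpow (by simpa using hq0) ENNReal.ofReal_ne_top
      simpa only [Real.norm_eq_abs, ENNReal.toReal_ofReal hq0.le] using this
    · have h1 : ∀ j ∈ Finset.range n,
          ∫ x, |(b n)⁻¹ * M n (j + 1) x - (b n)⁻¹ * M n j x| ^ q ∂μ ≤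
            (A' ^ q * C).toReal / n := fun j hj => by
        have h2 := hmom n hn (M n (j + 1) - M n j)
          ((hMinc n j (Finset.mem_range.1 hj)).trans (hAN n))
        rw [integral_eq_lintegral_of_nonneg_ae
          (ae_of_all _ fun x => Real.rpow_nonneg (abs_nonneg _) q)
          ((hincL n j).aestronglyMeasurable.aemeasurable.abs.pow_const q).aestronglyMeasurable]
        have h3 : ∀ x, ENNReal.ofReal (|(b n)⁻¹ * M n (j + 1) x - (b n)⁻¹ * M n j x| ^ q) =
            ‖(b n)⁻¹ * (M n (j + 1) - M n j) x‖ₑ ^ q := fun x => by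
          rw [← ENNReal.ofReal_rpow_of_nonneg (abs_nonneg _) hq0.le, ← mul_sub,
            ← Real.norm_eq_abs, ofReal_norm]
          rfl
        simp only [h3]
        have hn0 : (0 : ℝ) < n := by exact_mod_cast hn
        rw [le_div_iff₀ hn0, mul_comm, ← ENNReal.toReal_natCast n, ← ENNReal.toReal_mul]
        exact ENNReal.toReal_mono hACt h2
      refine (Finset.sum_le_sum h1).trans (le_of_eq ?_)
      have hn0 : (n : ℝ) ≠ 0 := by positivity
      rw [Finset.sum_const, Finset.card_range, nsmul_eq_mul, mul_div_cancel₀ _ hn0]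
  -- the remainder
  have hpartR : IsTightSeq μ fun n x => discreteVar p n fun m => (b n)⁻¹ * R n m x := by
    have h1 : IsTightSeq μ fun n x =>
        ∑ m ∈ Finset.range (n + 1), ‖(b n)⁻¹ * R n m x‖ₑ ^ q := by
      have hmeas : ∀ n m, Measurable fun x => ‖(b n)⁻¹ * R n m x‖ₑ ^ q := fun n m =>
        (((hRm n m).const_mul _).enorm).pow_const q
      refine isTightSeq_of_lintegral_le (C := 2 * (A' ^ q * C)) (ENNReal.mul_ne_top (by simp) hACt)
        (fun n _ => (Finset.measurable_fun_sum _ fun m _ => hmeas n m).aemeasurable) fun n hn => ?_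
      rw [lintegral_finsetSum _ fun m _ => hmeas n m]
      have hn0 : (n : ℝ≥0∞) ≠ 0 := by simp; omega
      have h2 : ∀ m ∈ Finset.range (n + 1), ∫⁻ x, ‖(b n)⁻¹ * R n m x‖ₑ ^ q ∂μ ≤
          (A' ^ q * C) / n := fun m hm => by
        rw [ENNReal.le_div_iff_mul_le (Or.inl hn0) (Or.inl (by simp)), mul_comm]
        exact hmom n hn _ ((hRle n m (Nat.lt_succ_iff.1 (Finset.mem_range.1 hm))).trans (hAN n))
      refine (Finset.sum_le_sum h2).trans ?_
      rw [Finset.sum_const, Finset.card_range, nsmul_eq_mul]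
      calc ((n + 1 : ℕ) : ℝ≥0∞) * (A' ^ q * C / n) ≤ (2 * n) * (A' ^ q * C / n) := by
            gcongr; exact_mod_cast (by omega : n + 1 ≤ 2 * n)
        _ = 2 * (A' ^ q * C) := by
            rw [mul_assoc, ENNReal.mul_div_cancel hn0 (by simp)]
    refine ((h1.rpow_const (s := p / q) (by positivity)).const_mul (c := 2 ^ p)
      (by simp)).mono fun n hn => ae_of_all _ fun x => ?_
    refine (discreteVar_le_sum_enorm hp1 n _).trans (mul_le_mul_right ?_ _)
    refine le_trans (le_of_eq ?_) (sum_rpow_le_rpow_sum_of_one_le _ _ ((one_le_div hq0).2 hqp.le))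
    refine Finset.sum_congr rfl fun m _ => ?_
    rw [← ENNReal.rpow_mul, mul_div_cancel₀ _ hq0.ne']
  -- large values of `V` and the drift of the truncated variables
  have hpartY : IsTightSeq μ fun n x => discreteVar p n fun m =>
      (b n)⁻¹ * ((∑ j ∈ Finset.range m, (T n)ᶜ.indicator V (F^[j] x)) + m * e n) := by
    have hlarge : ∀ n, 1 ≤ n →
        n * ∫⁻ x, ‖(T n)ᶜ.indicator V x‖ₑ ∂μ ≤ ENNReal.ofReal B * (C * ENNReal.ofReal (b n)) := by
      intro n hn
      have h1 : ∫⁻ x, ‖(T n)ᶜ.indicator V x‖ₑ ∂μ ≤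
          ENNReal.ofReal B * ∫⁻ x in {x | b n < ξ x}, ENNReal.ofReal (ξ x) ∂μ := by
        rw [← lintegral_const_mul _ hξ.ennreal_ofReal, ← hTc, ← lintegral_indicator (hTm n).compl]
        refine lintegral_mono fun x => ?_
        by_cases hx : x ∈ (T n)ᶜ
        · simp only [indicator_of_mem hx]
          rw [← ENNReal.ofReal_mul hB, ← ofReal_norm]
          exact ENNReal.ofReal_le_ofReal (hVB x)
        · simp [indicator_of_notMem hx]
      refine (mul_le_mul_right h1 _).trans ?_
      rw [mul_left_comm]
      exact mul_le_mul_right (hC n hn).1 _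
    have hdrift : ∀ n, ‖e n‖ₑ ≤ ∫⁻ x, ‖(T n)ᶜ.indicator V x‖ₑ ∂μ := fun n => by
      have h1 : e n + ∫ x, (T n)ᶜ.indicator V x ∂μ = 0 := by
        rw [he]
        simp only
        rw [← integral_add (hIi n) (hVint.indicator (hTm n).compl), ← hmean]
        exact integral_congr_ae (ae_of_all _ fun x => congrFun (indicator_self_add_compl (T n) V) x)
      rw [eq_neg_of_add_eq_zero_left h1, enorm_neg]
      exact enorm_integral_le_lintegral_enorm _
    have hgm : ∀ n, Measurable fun x => ‖(b n)⁻¹‖ₑ * (‖(T n)ᶜ.indicator V x‖ₑ + ‖e n‖ₑ) := fun n =>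
      (((hV.indicator (hTm n).compl).enorm).add_const _).const_mul _
    have h1 : IsTightSeq μ fun n x => ∑ j ∈ Finset.range n,
        ‖(b n)⁻¹‖ₑ * (‖(T n)ᶜ.indicator V (F^[j] x)‖ₑ + ‖e n‖ₑ) := by
      refine isTightSeq_of_lintegral_le (C := 2 * (ENNReal.ofReal B * C))
        (ENNReal.mul_ne_top (by simp) (ENNReal.mul_ne_top ENNReal.ofReal_ne_top ENNReal.coe_ne_top))
        (fun n _ => (Finset.measurable_fun_sum _ fun j _ =>
          (hgm n).comp (hF.iterate j)).aemeasurable) fun n hn => ?_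
      have hbn := hb0 n hn
      rw [lintegral_birkhoffSum hinv (hgm n), lintegral_const_mul _
        ((hV.indicator (hTm n).compl).enorm.add_const _), lintegral_add_right _ measurable_const,
        lintegral_const, measure_univ, mul_one]
      calc (n : ℝ≥0∞) * (‖(b n)⁻¹‖ₑ * (∫⁻ x, ‖(T n)ᶜ.indicator V x‖ₑ ∂μ + ‖e n‖ₑ))
          ≤ n * (‖(b n)⁻¹‖ₑ * (∫⁻ x, ‖(T n)ᶜ.indicator V x‖ₑ ∂μ +
              ∫⁻ x, ‖(T n)ᶜ.indicator V x‖ₑ ∂μ)) := by gcongr; exact hdrift n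
        _ = 2 * (‖(b n)⁻¹‖ₑ * (n * ∫⁻ x, ‖(T n)ᶜ.indicator V x‖ₑ ∂μ)) := by ring
        _ ≤ 2 * (‖(b n)⁻¹‖ₑ * (ENNReal.ofReal B * (C * ENNReal.ofReal (b n)))) := by
            exact mul_le_mul_right (mul_le_mul_right (hlarge n hn) _) _
        _ = 2 * (ENNReal.ofReal B * C) * (ENNReal.ofReal (b n)⁻¹ * ENNReal.ofReal (b n)) := by
            rw [Real.enorm_eq_ofReal (inv_nonneg.2 hbn.le)]; ring
        _ = 2 * (ENNReal.ofReal B * C) := by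
            rw [← ENNReal.ofReal_mul (inv_nonneg.2 hbn.le), inv_mul_cancel₀ hbn.ne',
              ENNReal.ofReal_one, mul_one]
    refine (h1.rpow_const hp0).mono fun n hn => ae_of_all _ fun x => ?_
    refine discreteVar_le_rpow_sum hp1 n _ _ fun m _ => ?_
    rw [edist_eq_enorm_sub, ← mul_sub, enorm_mul]
    refine mul_le_mul_right ?_ _
    have h2 : (∑ j ∈ Finset.range (m + 1), (T n)ᶜ.indicator V (F^[j] x)) + ((m + 1 : ℕ) : ℝ) * e n -
        ((∑ j ∈ Finset.range m, (T n)ᶜ.indicator V (F^[j] x)) + m * e n) =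
        (T n)ᶜ.indicator V (F^[m] x) + e n := by
      rw [Finset.sum_range_succ]; push_cast; ring
    rw [h2]
    exact enorm_add_le _ _
  have h2p : (2 : ℝ≥0∞) ^ (p - 1) ≠ ∞ := by simp
  refine ((hpartM.add ((hpartR.add hpartY).const_mul h2p)).const_mul h2p).mono
    fun n hn => ae_of_all _ fun x => ?_
  have hx : (fun m => (b n)⁻¹ * ∑ j ∈ Finset.range m, V (F^[j] x)) = fun m =>
      (b n)⁻¹ * M n m x + ((b n)⁻¹ * R n m x + (b n)⁻¹ *
        ((∑ j ∈ Finset.range m, (T n)ᶜ.indicator V (F^[j] x)) + m * e n)) := by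
    ext m
    have h1 : ∑ j ∈ Finset.range m, V (F^[j] x) = ∑ j ∈ Finset.range m, φ n (F^[j] x) +
        ((∑ j ∈ Finset.range m, (T n)ᶜ.indicator V (F^[j] x)) + m * e n) := by
      have h3 : ∀ y, V y = φ n y + ((T n)ᶜ.indicator V y + e n) := fun y => by
        have := congrFun (indicator_self_add_compl (T n) V) y
        rw [Pi.add_apply] at this
        simp only [hφ]
        linarith
      rw [Finset.sum_congr rfl fun j _ => h3 (F^[j] x)]
      simp [Finset.sum_add_distrib]
    rw [h1, hdec n m x]
    ring
  rw [hx]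
  refine (discreteVar_add_le hp1 n _ _).trans (mul_le_mul_right (add_le_add le_rfl ?_) _)
  exact discreteVar_add_le hp1 n _ _

end BirkhoffSums

/-! ### Excursions from the base -/

section Excursions

variable {Y : Type*}

/-- The Birkhoff sum of `u` along the excursion of length `τ z` that starts at `z`. -/
def excursionSum {Z : Set Y} (f : Y → Y) (τ : Z → ℕ) (u : Y → ℝ) (z : Z) : ℝ :=
  ∑ l ∈ Finset.range (τ z), u (f^[l] z)

/-- The total length of the first `k` excursions. -/
def excursionTime {Z : Type*} (τ : Z → ℕ) (F : Z → Z) (z : Z) (k : ℕ) : ℕ :=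
  ∑ i ∈ Finset.range k, τ (F^[i] z)

lemma iterate_excursionTime {Z : Set Y} {f : Y → Y} {τ : Z → ℕ} {F : Z → Z} {z : Z}
    (h : ∀ i, (F (F^[i] z) : Y) = f^[τ (F^[i] z)] (F^[i] z : Y)) (k : ℕ) :
    f^[excursionTime τ F z k] (z : Y) = F^[k] z := by
  induction k with
  | zero => simp [excursionTime]
  | succ k ih =>
    rw [excursionTime, Finset.sum_range_succ, add_comm, Function.iterate_add_apply]
    change f^[_] (f^[excursionTime τ F z k] (z : Y)) = _
    rw [ih, ← h, Function.iterate_succ_apply']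

lemma sum_range_excursionTime {Z : Set Y} {f : Y → Y} {τ : Z → ℕ} {F : Z → Z} {z : Z}
    (h : ∀ i, (F (F^[i] z) : Y) = f^[τ (F^[i] z)] (F^[i] z : Y)) (u : Y → ℝ) (k : ℕ) :
    ∑ j ∈ Finset.range (excursionTime τ F z k), u (f^[j] z) =
      ∑ i ∈ Finset.range k, excursionSum f τ u (F^[i] z) := by
  induction k with
  | zero => simp [excursionTime]
  | succ k ih =>
    rw [Finset.sum_range_succ, ← ih, excursionTime, Finset.sum_range_succ, Finset.sum_range_add]
    congr 1
    refine Finset.sum_congr rfl fun l _ => ?_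
    rw [add_comm, Function.iterate_add_apply]
    change u (f^[l] (f^[excursionTime τ F z k] (z : Y))) = _
    rw [iterate_excursionTime h]

lemma abs_excursionSum_le {Z : Set Y} {f : Y → Y} {τ : Z → ℕ} {u : Y → ℝ} {B : ℝ}
    (hB : ∀ y, |u y| ≤ B) (z : Z) :
    |excursionSum f τ u z| ≤ B * τ z := by
  refine (Finset.abs_sum_le_sum_abs _ _).trans ((Finset.sum_le_sum fun l _ => hB _).trans ?_)
  simp [mul_comm]

variable [MeasurableSpace Y] {Z : Set Y} {f : Y → Y} {τ : Z → ℕ}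

lemma measurable_excursionSum (hf : Measurable f) (hτ : Measurable τ) {u : Y → ℝ}
    (hu : Measurable u) : Measurable (excursionSum f τ u) := by
  have h : Measurable fun q : ℕ × Z => ∑ l ∈ Finset.range q.1, u (f^[l] q.2) :=
    measurable_from_prod_countable_right fun k => by
      simp only
      exact Finset.measurable_fun_sum _ fun l _ =>
        hu.comp ((hf.iterate l).comp measurable_subtype_coe)
  exact h.comp (hτ.prodMk measurable_id)

lemma measurable_towerProjection (hf : Measurable f) :
    Measurable fun q : Z × ℕ => f^[q.2] (q.1 : Y) :=
  measurable_from_prod_countable_left fun k => (hf.iterate k).comp measurable_subtype_coe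

lemma measurableSet_tower (hτ : Measurable τ) : MeasurableSet {q : Z × ℕ | q.2 < τ q.1} :=
  measurableSet_lt measurable_snd (hτ.comp measurable_fst)

lemma prod_count_tower (hτ : Measurable τ) (μZ : Measure Z) [SFinite μZ] :
    (μZ.prod (Measure.count : Measure ℕ)) {q | q.2 < τ q.1} = ∫⁻ z, (τ z : ℝ≥0∞) ∂μZ := by
  rw [Measure.prod_apply (measurableSet_tower hτ)]
  refine lintegral_congr fun z => ?_
  have : Prod.mk z ⁻¹' {q : Z × ℕ | q.2 < τ q.1} = ↑(Finset.range (τ z)) := by ext; simp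
  rw [this, Measure.count_apply_finset, Finset.card_range]

lemma lintegral_natCast_ne_top {μZ : Measure Z} (hint : Integrable (fun z => (τ z : ℝ)) μZ) :
    ∫⁻ z, (τ z : ℝ≥0∞) ∂μZ ≠ ∞ := by
  have h : ∀ z, (τ z : ℝ≥0∞) = ENNReal.ofReal (τ z : ℝ) := fun z => by simp
  simp only [h]
  rw [← ofReal_integral_eq_lintegral_ofReal hint (ae_of_all _ fun z => Nat.cast_nonneg _)]
  exact ENNReal.ofReal_ne_top

lemma isFiniteMeasure_inducedMeasure (hτ : Measurable τ) {μZ : Measure Z} [SFinite μZ] :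
    IsFiniteMeasure (inducedMeasure f τ μZ) := by
  have : IsFiniteMeasure (towerMeasure τ μZ) := ⟨by
    rw [towerMeasure, Measure.smul_apply, Measure.restrict_apply_univ, prod_count_tower hτ,
      smul_eq_mul]
    exact (ENNReal.inv_mul_le_one _).trans_lt ENNReal.one_lt_top⟩
  exact Measure.isFiniteMeasure_map _ _

/-- Integrals with respect to the projected tower measure are integrals of excursion sums. -/
lemma integral_inducedMeasure (hf : Measurable f) (hτ : Measurable τ) (μZ : Measure Z) [SFinite μZ]
    (hfin : ∫⁻ z, (τ z : ℝ≥0∞) ∂μZ ≠ ∞) {u : Y → ℝ} (hu : Measurable u) {B : ℝ}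
    (hB : ∀ y, |u y| ≤ B) :
    ∫ y, u y ∂(inducedMeasure f τ μZ) =
      (∫⁻ z, (τ z : ℝ≥0∞) ∂μZ)⁻¹.toReal * ∫ z, excursionSum f τ u z ∂μZ := by
  set E : Set (Z × ℕ) := {q | q.2 < τ q.1} with hE
  have hEm : MeasurableSet E := measurableSet_tower hτ
  have hπ := measurable_towerProjection (Z := Z) hf
  have hEfin : (μZ.prod (Measure.count : Measure ℕ)) E ≠ ∞ := by
    rw [hE, prod_count_tower hτ]; exact hfin
  have hi : Integrable (E.indicator fun q : Z × ℕ => u (f^[q.2] (q.1 : Y)))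
      (μZ.prod (Measure.count : Measure ℕ)) := by
    rw [integrable_indicator_iff hEm]
    exact Measure.integrableOn_of_bounded hEfin (hu.comp hπ).aestronglyMeasurable (M := B)
      (ae_of_all _ fun q => hB _)
  rw [inducedMeasure, integral_map hπ.aemeasurable hu.aestronglyMeasurable, towerMeasure,
    integral_smul_measure, smul_eq_mul, ← integral_indicator hEm, integral_prod _ hi]
  congr 1
  refine integral_congr_ae (ae_of_all _ fun z => ?_)
  simp only
  have h1 : (fun l : ℕ => E.indicator (fun q : Z × ℕ => u (f^[q.2] (q.1 : Y))) (z, l)) =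
      (↑(Finset.range (τ z)) : Set ℕ).indicator fun l => u (f^[l] (z : Y)) := by
    ext l
    simp [indicator, hE]
  rw [h1, integral_indicator (Finset.measurableSet _), setIntegral_finset]
  · simp [excursionSum, Measure.real]
  · exact Measure.integrableOn_of_bounded (by simp)
      (Measurable.of_discrete.aestronglyMeasurable) (M := B) (ae_of_all _ fun l => hB _)

end Excursions

lemma HolderWith.exists_norm_le {Y E : Type*} [PseudoMetricSpace Y] [BoundedSpace Y]
    [SeminormedAddCommGroup E] {C η : ℝ≥0} {v : Y → E} (hv : HolderWith C η v) :
    ∃ B : ℝ, 0 ≤ B ∧ ∀ y, ‖v y‖ ≤ B := by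
  obtain ⟨R, hR⟩ := Metric.isBounded_iff.1 (BoundedSpace.bounded_univ (α := Y))
  rcases isEmpty_or_nonempty Y with hY | ⟨⟨y₀⟩⟩
  · exact ⟨0, le_rfl, fun y => (hY.false y).elim⟩
  · have hle : ∀ y, ‖v y‖ ≤ C * R ^ (η : ℝ) + ‖v y₀‖ := fun y => by
      have h1 := (hv.dist_le y y₀).trans (mul_le_mul_of_nonneg_left (Real.rpow_le_rpow dist_nonneg
        (hR (mem_univ y) (mem_univ y₀)) η.2) C.2)
      rw [dist_eq_norm] at h1
      exact sub_le_iff_le_add.1 ((norm_sub_norm_le _ _).trans h1)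
    exact ⟨_, (norm_nonneg _).trans (hle y₀), hle⟩

section Base

variable {Y : Type*} [MetricSpace Y] [BoundedSpace Y] [MeasurableSpace Y] [BorelSpace Y]

/-- Tightness of the variation for initial points in the base. On the base, the path is
sampled at the ends of excursions, where it is a Birkhoff sum of excursion sums for the
Gibbs–Markov map. -/
theorem isTightSeq_discreteVar_base (ν : Measure Y) [IsFiniteMeasure ν]
    {f : Y → Y} {Z : Set Y} {𝒜 : Set (Set Z)} {τ : Z → ℕ} {F : Z → Z}
    (hf : IsNonuniformlyExpanding ν f Z 𝒜 τ F) (μZ : Measure Z) [IsProbabilityMeasure μZ]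
    (hinv : MeasurePreserving F μZ μZ) (hac : μZ ≪ subMeasure ν Z) (hmix : IsMixing F μZ)
    (hint : Integrable (fun z => (τ z : ℝ)) μZ) {u : Y → ℝ} {C η : ℝ≥0} (hη : 0 < η)
    (hu : HolderWith C η u) (hmean : ∫ y, u y ∂(inducedMeasure f τ μZ) = 0)
    {α : ℝ} (hα : 1 < α) (hα2 : α < 2) (hτ : IsRegularlyVarying μZ (fun z => (τ z : ℝ)) α)
    {b : ℕ → ℝ} (hb0 : ∀ n, 1 ≤ n → 0 < b n)
    (hb : Tendsto (fun n : ℕ => (n : ℝ) * μZ.real {z | b n < (τ z : ℝ)}) atTop (𝓝 1))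
    {p : ℝ} (hp : α < p) :
    IsTightSeq μZ fun n z =>
      discreteVar p n fun m => (b n)⁻¹ * ∑ j ∈ Finset.range m, u (f^[j] (z : Y)) := by
  have hp0 : 0 < p := by linarith
  have hp1 : 1 ≤ p := by linarith
  have hGM := hf.gibbsMarkov
  have hF : Measurable F := hGM.quasiErgodic.measurable
  have hτ0 : ∀ z, (0 : ℝ) < τ z := fun z => by exact_mod_cast hf.one_le_tau z
  have hτm : Measurable fun z => (τ z : ℝ) := measurable_from_nat.comp hf.measurable_tau
  have h2 := hτ.tendsto_tail_ratio hτ0 two_pos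
  have hum : Measurable u := (hu.continuous hη).measurable
  obtain ⟨B, hB0, hB⟩ := hu.exists_norm_le
  set V := excursionSum f τ u with hV
  obtain ⟨C₁, hC₁, hexc⟩ := hf.excursion
  have hosc : ∀ a ∈ 𝒜, ∀ z ∈ a, ∀ z' ∈ a,
      |V z - V z'| ≤ (C * C₁ ^ (η : ℝ)) * τ z * dist (F z) (F z') ^ (η : ℝ) := by
    intro a ha z hz z' hz'
    simp only [hV, excursionSum]
    rw [← hf.tau_const a ha z hz z' hz', ← Finset.sum_sub_distrib]
    refine (Finset.abs_sum_le_sum_abs _ _).trans ?_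
    have h3 : ∀ l ∈ Finset.range (τ z), |u (f^[l] (z : Y)) - u (f^[l] (z' : Y))| ≤
        C * (C₁ ^ (η : ℝ) * dist (F z) (F z') ^ (η : ℝ)) := fun l hl => by
      rw [← Real.dist_eq]
      refine (hu.dist_le _ _).trans (mul_le_mul_of_nonneg_left ?_ C.2)
      rw [← Real.mul_rpow hC₁.le dist_nonneg]
      exact Real.rpow_le_rpow dist_nonneg
        (hexc a ha z hz z' hz' l (Finset.mem_range.1 hl).le) η.2
    refine (Finset.sum_le_sum h3).trans (le_of_eq ?_)
    rw [Finset.sum_const, Finset.card_range, nsmul_eq_mul]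
    ring
  have hτI : ∫⁻ z, (τ z : ℝ≥0∞) ∂μZ ≠ ∞ := lintegral_natCast_ne_top hint
  -- `τ̄` is neither `0` nor `∞`, so that the normalization of the tower measure is invertible
  have hτI0 : ∫⁻ z, (τ z : ℝ≥0∞) ∂μZ ≠ 0 := by
    have h3 : (1 : ℝ≥0∞) ≤ ∫⁻ z, (τ z : ℝ≥0∞) ∂μZ := by
      calc (1 : ℝ≥0∞) = ∫⁻ _, 1 ∂μZ := by simp
        _ ≤ _ := lintegral_mono fun z => Nat.one_le_cast.2 (hf.one_le_tau z)
    exact (zero_lt_one.trans_le h3).ne'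
  have hVmean : ∫ z, V z ∂μZ = 0 := by
    rw [integral_inducedMeasure hf.measurable hf.measurable_tau μZ hτI hum hB] at hmean
    refine (mul_eq_zero.1 hmean).resolve_left ?_
    rw [ENNReal.toReal_inv]
    exact inv_ne_zero (ENNReal.toReal_ne_zero.2 ⟨hτI0, hτI⟩)
  have hbirk := isTightSeq_discreteVar_birkhoffSum hGM hinv hac hmix hτm hτ0 hint
    (fun a ha z hz z' hz' => by rw [hf.tau_const a ha z hz z' hz']) hα hα2 h2 hb0 hb
    (measurable_excursionSum hf.measurable hf.measurable_tau hum) hB0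
    (fun z => abs_excursionSum_le hB z) (by exact_mod_cast hη)
    (mul_nonneg C.2 (Real.rpow_nonneg hC₁.le _)) hosc hVmean hp
  have hlen := isTightSeq_sum_rpow hinv h2 hα hp hτm hτ0 hint hb0 hb
  refine ((hbirk.add (hlen.const_mul (c := 2 * ENNReal.ofReal B ^ p) (ENNReal.mul_ne_top (by simp)
    (ENNReal.rpow_ne_top_of_nonneg hp0.le ENNReal.ofReal_ne_top)))).const_mul (c := 3 ^ (p - 1))
    (by simp)).mono fun n hn => ?_
  filter_upwards [hac.ae_le (hGM.partition.ae_iterate_mem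
    hGM.quasiErgodic.toQuasiMeasurePreserving)] with z hz
  have hret : ∀ i, (F (F^[i] z) : Y) = f^[τ (F^[i] z)] (F^[i] z : Y) := fun i => by
    obtain ⟨a, ha, hza⟩ := hz i
    exact hf.induced a ha _ hza
  have hT : StrictMono (excursionTime τ F z) := strictMono_nat_of_lt_succ fun k => by
    rw [excursionTime, excursionTime, Finset.sum_range_succ]
    exact Nat.lt_add_of_pos_right (hf.one_le_tau _)
  have hbn := hb0 n hn
  have h3 := discreteVar_le_sampled (E := ℝ) hp1 (T := excursionTime τ F z) (by simp [excursionTime])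
    hT (x := fun m => (b n)⁻¹ * ∑ j ∈ Finset.range m, u (f^[j] (z : Y)))
    (B := ENNReal.ofReal B * ENNReal.ofReal (b n)⁻¹) (fun m => by
      rw [edist_eq_enorm_sub, ← mul_sub, Finset.sum_range_succ, add_sub_cancel_left, ← ofReal_norm,
        norm_mul, Real.norm_of_nonneg (inv_nonneg.2 hbn.le), mul_comm, ← ENNReal.ofReal_mul hB0]
      exact ENNReal.ofReal_le_ofReal
        (mul_le_mul_of_nonneg_right (hB _) (inv_nonneg.2 hbn.le))) n
  refine h3.trans (mul_le_mul_right (add_le_add (le_of_eq ?_) (le_of_eq ?_)) _)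
  · simp only [sum_range_excursionTime hret]
  · rw [ENNReal.mul_rpow_of_nonneg _ _ hp0.le, ← mul_assoc, mul_assoc (2 * ENNReal.ofReal B ^ p),
      Finset.mul_sum]
    congr 1
    refine Finset.sum_congr rfl fun k _ => ?_
    have h4 : excursionTime τ F z (k + 1) - excursionTime τ F z k = τ (F^[k] z) := by
      rw [excursionTime, excursionTime, Finset.sum_range_succ, Nat.add_sub_cancel_left]
    rw [h4, ENNReal.mul_rpow_of_nonneg _ _ hp0.le, ENNReal.ofReal_natCast]

end Base

/-! ### Passage to absolutely continuous initial laws -/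

section EntranceTime

variable {Y : Type*} [MeasurableSpace Y] {ν m P : Measure Y} {f : Y → Y}

/-- If orbits started from `m` enter every set of full `m`-measure infinitely often, then orbits
started from `P ≪ ν` can be stopped at a finite random time in such a way that the law of the
stopped point is absolutely continuous with respect to `m`. -/
lemma exists_entranceTime [IsFiniteMeasure ν] [IsProbabilityMeasure m] (hfν : QuasiErgodic f ν)
    (hm : m ≪ ν) (hrec : ∀ H, MeasurableSet H → m Hᶜ = 0 →
      ∀ᵐ y ∂m, ∃ᶠ k in atTop, f^[k] y ∈ H) (hP : P ≪ ν) :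
    ∃ κ : Y → ℕ, Measurable κ ∧ (Measurable fun y => f^[κ y] y) ∧
      P.map (fun y => f^[κ y] y) ≪ m := by
  classical
  have hf := hfν.measurable
  set H : Set Y := {y | m.rnDeriv ν y ≠ 0} with hH
  have hHm : MeasurableSet H :=
    (Measure.measurable_rnDeriv m ν (measurableSet_singleton 0)).compl
  have hdens : ν.withDensity (m.rnDeriv ν) = m := Measure.withDensity_rnDeriv_eq m ν hm
  have hmH : m Hᶜ = 0 := by
    rw [← hdens, withDensity_apply _ hHm.compl,
      setLIntegral_congr_fun hHm.compl (g := fun _ => 0) fun y hy => by simpa [hH] using hy]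
    simp
  have hνH : ν.restrict H ≪ m := by
    have h1 : ν.restrict H ≪ (ν.restrict H).withDensity (m.rnDeriv ν) :=
      withDensity_absolutelyContinuous' (Measure.measurable_rnDeriv m ν).aemeasurable
        ((ae_restrict_iff' hHm).2 (ae_of_all _ fun _ hy => hy))
    rw [← restrict_withDensity hHm, hdens] at h1
    exact h1.trans (Measure.absolutelyContinuous_of_le Measure.restrict_le_self)
  -- infinitely many visits are required to make `J` invariant exactly, not only up to null sets
  set J : Set Y := {y | ∃ᶠ k in atTop, f^[k] y ∈ H} with hJ
  have hJm : MeasurableSet J := by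
    have : J = ⋂ n : ℕ, ⋃ k ≥ n, f^[k] ⁻¹' H := by
      ext y; simp [hJ, frequently_atTop]
    rw [this]
    exact MeasurableSet.iInter fun n => MeasurableSet.iUnion fun k => MeasurableSet.iUnion fun _ =>
      hf.iterate k hHm
  have hJinv : f ⁻¹' J = J := by
    ext y
    simp only [hJ, mem_preimage, mem_ofPred_eq, ← Function.iterate_succ_apply]
    conv_rhs => rw [← map_add_atTop_eq_nat 1]
    exact frequently_map.symm
  have hJν : ν Jᶜ = 0 := by
    refine (hfν.toPreErgodic.measure_self_or_compl_eq_zero hJm hJinv).resolve_left fun h0 => ?_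
    have h1 : m Jᶜ = 0 := hrec H hHm hmH
    have h2 := measure_add_measure_compl (μ := m) hJm
    rw [hm h0, h1, measure_univ] at h2
    simp at h2
  -- outside of `J` the time is set to `0`
  have hex : ∀ y, ∃ k, f^[k] y ∈ H ∨ y ∉ J := fun y => by
    by_cases hy : y ∈ J
    · obtain ⟨k, hk⟩ := Frequently.exists hy
      exact ⟨k, Or.inl hk⟩
    · exact ⟨0, Or.inr hy⟩
  set κ : Y → ℕ := fun y => Nat.find (hex y) with hκ
  have hκm : Measurable κ := measurable_find hex fun k =>
    (hf.iterate k hHm).union hJm.compl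
  have hg : Measurable fun y => f^[κ y] y := by
    have h : Measurable fun q : ℕ × Y => f^[q.1] q.2 :=
      measurable_from_prod_countable_right fun k => hf.iterate k
    exact h.comp (hκm.prodMk measurable_id)
  refine ⟨κ, hκm, hg, Measure.AbsolutelyContinuous.mk fun E hE hE0 => ?_⟩
  rw [Measure.map_apply hg hE]
  refine hP (measure_mono_null (t := Jᶜ ∪ ⋃ k, f^[k] ⁻¹' (E ∩ H)) (fun y hy => ?_)
    (measure_union_null hJν (measure_iUnion_null fun k => ?_)))
  · by_cases hyJ : y ∈ J
    · exact Or.inr (mem_iUnion.2 ⟨κ y, hy, (Nat.find_spec (hex y)).resolve_right (not_not.2 hyJ)⟩)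
    · exact Or.inl hyJ
  · refine (hfν.toQuasiMeasurePreserving.iterate k).preimage_null ?_
    rw [← Measure.restrict_apply hE]
    exact hνH hE0

end EntranceTime

section Final

variable {Y : Type*} [MetricSpace Y] [MeasurableSpace Y]

/-- Almost every orbit started in the base returns infinitely often to any set of full measure,
namely at the ends of excursions. -/
lemma ae_frequently_mem [BorelSpace Y] {ν : Measure Y} {f : Y → Y} {Z : Set Y} {𝒜 : Set (Set Z)}
    {τ : Z → ℕ} {F : Z → Z} (hf : IsNonuniformlyExpanding ν f Z 𝒜 τ F) {μZ : Measure Z}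
    (hinv : MeasurePreserving F μZ μZ) (hac : μZ ≪ subMeasure ν Z) {H : Set Y}
    (hH0 : μZ.map Subtype.val Hᶜ = 0) :
    ∀ᵐ y ∂(μZ.map Subtype.val), ∃ᶠ k in atTop, f^[k] y ∈ H := by
  have hGM := hf.gibbsMarkov
  have hemb := MeasurableEmbedding.subtype_coe hf.measurableSet_base
  rw [hemb.ae_map_iff]
  rw [hemb.map_apply] at hH0
  have h1 : ∀ᵐ z ∂μZ, ∀ i, (F^[i] z : Y) ∈ H := ae_all_iff.2 fun i =>
    (hinv.iterate i).quasiMeasurePreserving.preimage_null hH0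
  filter_upwards [h1, hac.ae_le (hGM.partition.ae_iterate_mem
    hGM.quasiErgodic.toQuasiMeasurePreserving)] with z hz1 hz
  have hret : ∀ i, (F (F^[i] z) : Y) = f^[τ (F^[i] z)] (F^[i] z : Y) := fun i => by
    obtain ⟨a, ha, hza⟩ := hz i
    exact hf.induced a ha _ hza
  rw [frequently_atTop]
  intro n
  refine ⟨excursionTime τ F z n, ?_, ?_⟩
  · have : ∑ i ∈ Finset.range n, 1 ≤ excursionTime τ F z n :=
      Finset.sum_le_sum fun i _ => hf.one_le_tau _
    simpa using this
  · rw [iterate_excursionTime hret]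
    exact hz1 n

end Final

theorem theorem6p2
    {Y : Type*} [MetricSpace Y] [BoundedSpace Y] [MeasurableSpace Y] [BorelSpace Y]
    (ν : Measure Y) [IsFiniteMeasure ν]
    (f : Y → Y) (Z : Set Y) (𝒜 : Set (Set Z)) (τ : Z → ℕ) (F : Z → Z)
    (hf : IsNonuniformlyExpanding ν f Z 𝒜 τ F)
    -- `f` is nonsingular and ergodic with respect to the reference measure
    (hfν : QuasiErgodic f ν)
    -- the absolutely continuous `F`-invariant probability measure
    (μZ : Measure Z) [IsProbabilityMeasure μZ]
    (hμZ_inv : MeasurePreserving F μZ μZ) (hμZ_ac : μZ ≪ subMeasure ν Z)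
    (hμZ_mix : IsMixing F μZ)
    (hτ_int : Integrable (fun z => (τ z : ℝ)) μZ)
    -- the Hölder observable, with mean zero
    (d : ℕ) (v : Y → EuclideanSpace ℝ (Fin d))
    (hv : ∃ C η : ℝ≥0, 0 < η ∧ η ≤ 1 ∧ HolderWith C η v)
    (hv_mean : ∫ y, v y ∂(inducedMeasure f τ μZ) = 0)
    -- regular variation of the return time, and the normalising sequence
    (α : ℝ) (hα₁ : 1 < α) (hα₂ : α < 2)
    (hτ : IsRegularlyVarying μZ (fun z => (τ z : ℝ)) α)
    (b : ℕ → ℝ) (hb_pos : ∀ n, 1 ≤ n → 0 < b n)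
    (hb : Tendsto (fun n : ℕ => (n : ℝ) * μZ.real {z | b n < (τ z : ℝ)}) atTop (𝓝 1))
    (p : ℝ) (hp : α < p)
    (P : Measure Y) [IsProbabilityMeasure P] (hP : P ≪ ν) :
    IsTightSeq P (fun n y => pVariation p (birkhoffProcess f v b n y)) := by
  obtain ⟨C, η, hη, -, hv⟩ := hv
  have hp0 : 0 < p := by linarith
  have hp1 : 1 ≤ p := by linarith
  obtain ⟨B, hB0, hB⟩ := hv.exists_norm_le
  have hemb := MeasurableEmbedding.subtype_coe hf.measurableSet_base
  have hτ0 : ∀ z, (0 : ℝ) < τ z := fun z => by exact_mod_cast hf.one_le_tau z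
  have h2 := hτ.tendsto_tail_ratio hτ0 two_pos
  set x : ℕ → Y → ℕ → EuclideanSpace ℝ (Fin d) := fun n y m =>
    (b n)⁻¹ • ∑ j ∈ Finset.range m, v (f^[j] y) with hx
  set m : Measure Y := μZ.map Subtype.val with hm
  have hmp : IsProbabilityMeasure m :=
    Measure.isProbabilityMeasure_map measurable_subtype_coe.aemeasurable
  have hmν : m ≪ ν := by
    refine (hμZ_ac.map measurable_subtype_coe).trans ?_
    rw [hemb.map_comap]
    exact Measure.absolutelyContinuous_of_le Measure.restrict_le_self
  -- initial points in the base, one coordinate at a time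
  have hbase : IsTightSeq m fun n y => discreteVar p n (x n y) := by
    have hcoord : ∀ i, IsTightSeq μZ fun n z => discreteVar p n fun k => x n (z : Y) k i := by
      intro i
      have hvi : HolderWith C η fun y => v y i := fun y y' => (by
        rw [edist_dist, edist_dist]
        exact ENNReal.ofReal_le_ofReal (by
          rw [dist_eq_norm, dist_eq_norm]
          exact PiLp.norm_apply_le (v y - v y') i) : _ ≤ edist (v y) (v y')).trans (hv y y')
      have hmean : ∫ y, v y i ∂(inducedMeasure f τ μZ) = 0 := by
        have := isFiniteMeasure_inducedMeasure (f := f) hf.measurable_tau (μZ := μZ)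
        have h3 := (EuclideanSpace.proj (𝕜 := ℝ) i).integral_comp_comm
          (Integrable.of_bound (μ := inducedMeasure f τ μZ)
            (hv.continuous hη).measurable.aestronglyMeasurable B (ae_of_all _ hB))
        rw [hv_mean, map_zero] at h3
        exact h3
      have h3 := isTightSeq_discreteVar_base ν hf μZ hμZ_inv hμZ_ac hμZ_mix hτ_int hη hvi hmean
        hα₁ hα₂ hτ hb_pos hb hp
      simpa [hx] using h3
    have h3 : IsTightSeq μZ fun n z => discreteVar p n (x n (z : Y)) :=
      ((IsTightSeq.finset_sum Finset.univ fun i _ => hcoord i).const_mul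
        (c := (d : ℝ≥0∞) ^ (p - 1)) (ENNReal.rpow_ne_top_of_nonneg (by linarith) (by simp))).mono
        fun n _ => ae_of_all _ fun z => discreteVar_euclideanSpace_le hp1 n _
    intro ε hε
    obtain ⟨M, hM⟩ := h3 ε hε
    refine ⟨M, fun n hn => ?_⟩
    rw [hm, hemb.map_apply]
    exact hM n hn
  -- a general initial point is replaced by the orbit point at the entrance time
  obtain ⟨κ, hκm, hg, hκ⟩ := exists_entranceTime (P := P) hfν hmν
    (fun H _ hH0 => ae_frequently_mem hf hμZ_inv hμZ_ac hH0) hP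
  have hlate : IsTightSeq P fun n y => discreteVar p n (x n (f^[κ y] y)) :=
    have := Measure.isFiniteMeasure_map P fun y => f^[κ y] y
    IsTightSeq.comp_map hg.aemeasurable (hbase.of_absolutelyContinuous hκ)
  obtain ⟨c, hc⟩ : ∃ c, ∀ n, (b n)⁻¹ ≤ c := by
    obtain ⟨c, hc⟩ := (tendsto_inv_atTop_zero.comp
      (tendsto_atTop_of_tail (tail_pos h2) hb)).bddAbove_range
    exact ⟨c, fun n => hc ⟨n, rfl⟩⟩
  have hstart : IsTightSeq P fun _ y => (κ y : ℝ≥0∞) * ENNReal.ofReal (c * B) :=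
    isTightSeq_const ((measurable_from_nat.comp hκm).mul_const _) fun y =>
      ENNReal.mul_ne_top (by simp) ENNReal.ofReal_ne_top
  refine ((((hstart.rpow_const hp0).add hlate).const_mul (c := 2 ^ (p - 1))
    (by simp)).rpow_const (s := 1 / p) (by positivity)).mono fun n hn => ae_of_all _ fun y => ?_
  refine (pVariation_le_discreteVar hp0 n (x n y)).trans (ENNReal.rpow_le_rpow ?_ (by positivity))
  have hbn := hb_pos n hn
  have hshift := discreteVar_le_shift hp1 n (κ y) (x n y) (fun _ => ENNReal.ofReal (c * B)) fun k => by
    rw [edist_eq_enorm_sub, hx]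
    simp only
    rw [← smul_sub, Finset.sum_range_succ, add_sub_cancel_left, ← ofReal_norm, norm_smul,
      Real.norm_of_nonneg (inv_nonneg.2 hbn.le)]
    exact ENNReal.ofReal_le_ofReal (mul_le_mul (hc n) (hB _) (norm_nonneg _)
      ((inv_nonneg.2 hbn.le).trans (hc n)))
  refine hshift.trans (mul_le_mul_right (add_le_add (le_of_eq ?_) (le_of_eq ?_)) _)
  · simp
  · congr 1
    ext1 k
    rw [hx]
    simp only
    rw [← smul_sub, add_comm, Finset.sum_range_add, add_sub_cancel_left]
    simp only [← Function.iterate_add_apply, add_comm]
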